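/- Let $p$ be a prime, $s\ge 0$ and $t$ integers with $t\geq 1$ and $p\nmid t$, and put $k=p^st$, $n=2k$. Let $R=\mathbb F_{p^2}+v\mathbb F_{p^2}$ with $v^2=v$, and let $\theta(a+vb)=a^p+vb^p$ on $R$ (so $\theta(a)=a^p$ on $\mathbb F_{p^2}$). For $\lambda\in R$, a linear code (submodule) $C\subseteq R^n$ is skew $\lambda$-constacyclic if $(c_0,\dots,c_{n-1})\in C$ implies $(\lambda\theta(c_{n-1}),\theta(c_0),\dots,\theta(c_{n-2}))\in C$. It is Euclidean (resp. Hermitian) LCD if $C\cap C^\perp=\{0\}$, the dual being taken with respect to $\sum x_iy_i$ (resp. $\sum x_i\theta(y_i)$). Write $C=vC_1\oplus(1-v)C_2$ with $C_1,C_2\subseteq\mathbb F_{p^2}^n$; if $\lambda=\alpha+v\beta$, then $C_1$ is skew $(\alpha+\beta)$-constacyclic and $C_2$ is skew $\alpha$-constacyclic over $\mathbb F_{p^2}$. The skew generator polynomial of a skew $\mu$-constacyclic code $D\subseteq\mathbb F_{p^2}^n$ is the monic right divisor $g$ of $x^n-\mu$ in $\mathbb F_{p^2}[x;\theta]$ (with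 $xa=a^px$) such that the words of $D$, written as polynomials $\sum c_ix^i$ of degree $<n$, are exactly the left multiples of $g$ of degree $<n$. Call $C$ admissible if, for $i=1,2$, the component $C_i$ has dimension $k$ and its skew generator polynomial is not divisible by any nonconstant central polynomial of $\mathbb F_{p^2}[x;\theta]$. For $f\in\mathbb F_p[x^2]$, let $\deg f$ denote its degree as a polynomial in $x^2$, and let $f^\natural$ be its monic reciprocal polynomial. Let $\mathcal D_{F}$ be the set of monic divisors of $F$ in $\mathbb F_p[x^2]$, let $\mathcal F_{ir}$ be the set of irreducible $f\in\mathbb F_p[x^2]$ with $f=f^\natural$ and $\deg f>1$, and let $\mathcal F_{red}$ be the set of products $f=e e^\natural$ with $e$ monic irreducible in $\mathbb F_p[x^2]$ and $e\ne e^\natural$. Put $$N_1=\begin{cases}2^{2^s}&p=2\\(p^{p^s-1})^2(p^2-1)&p\text{ odd},\ k\text{ even}\\p^{p^s-1}\bigl(p-(-1)^{(p+1)/2}\bigr)&p\text{ odd},\ k\text{ odd,}\end{cases}\qquad N_2=\begin{cases}0&p=2\\0&p\text{ odd},\ k\text{ even}\\p^{p^s-1}(p+1)&p\text{ odd},\ k\text{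 odd,}\end{cases}$$ $$N_3=\begin{cases}2^{2^s}&p=2\\1&p\text{ odd},\ k\text{ even}\\p^{p^s-1}\bigl(p-(-1)^{(p-1)/2}\bigr)&p\text{ odd},\ k\text{ odd,}\end{cases}\qquad N_4=\begin{cases}0&p=2\\1&p\text{ odd},\ k\text{ even}\\0&p\text{ odd},\ k\text{ odd,}\end{cases}$$ and, for $\varepsilon\in\{1,-1\}$, with $d=\deg f$, $$P_\varepsilon=\prod_{f\in\mathcal F_{ir}\cap\mathcal D_{x^n-\varepsilon}}(p^d-p^{d/2})\,p^{d(p^s-1)},\qquad Q_\varepsilon=\prod_{f\in\mathcal F_{red}\cap\mathcal D_{x^n-\varepsilon}}(1+p^{d/2})\,p^{(2p^s-1)d/2}.$$ Then the number of admissible Euclidean LCD skew $\lambda$-constacyclic codes of length $2k$ over $R$ is - for $\lambda=1$: $\;N_1^2\prod_{f\in\mathcal F_{ir}\cap\mathcal D_{x^n-1}}(p^d-p^{d/2})^2p^{2d(p^s-1)}\prod_{f\in\mathcal F_{red}\cap\mathcal D_{x^n-1}}(1+p^{d/2})^2p^{(2p^s-1)d}$; - for $\lambda=-1$: $\;N_3^2\prod_{f\in\mathcal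 F_{ir}\cap\mathcal D_{x^n+1}}(p^d-p^{d/2})^2p^{2d(p^s-1)}\prod_{f\in\mathcal F_{red}\cap\mathcal D_{x^n+1}}(1+p^{d/2})^2p^{(2p^s-1)d}$; - for $\lambda=1-2v$: $\;N_1N_3\,P_1Q_1P_{-1}Q_{-1}$; and the number of admissible Hermitian LCD skew $\lambda$-constacyclic codes of length $2k$ over $R$ is - for $\lambda=1$: $\;N_2^2\prod_{f\in\mathcal F_{ir}\cap\mathcal D_{x^n-1}}(p^d-p^{d/2})^2p^{2d(p^s-1)}\prod_{f\in\mathcal F_{red}\cap\mathcal D_{x^n-1}}(1+p^{d/2})^2p^{(2p^s-1)d}$; - for $\lambda=-1$: $\;N_4\prod_{f\in\mathcal F_{ir}\cap\mathcal D_{x^n+1}}(p^d-p^{d/2})^2p^{2d(p^s-1)}\prod_{f\in\mathcal F_{red}\cap\mathcal D_{x^n+1}}(1+p^{d/2})^2p^{(2p^s-1)d}$; - for $\lambda=1-2v$: $\;N_4N_2\,P_{-1}Q_{-1}P_1Q_1$. -/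

import Mathlib

open Polynomial

noncomputable section

namespace SkewLCD

/-! ### Linear codes over a commutative ring with an endomorphism -/

section Codes

variable {A : Type*} [CommRing A] {n : ℕ}

/-- `(c₀, …, c_{n-1}) ↦ (l σ(c_{n-1}), σ(c₀), …, σ(c_{n-2}))`. -/
def skewShift (σ : A →+* A) (l : A) (c : Fin n → A) : Fin n → A := fun i =>
  if i.val = 0 then l * σ (c ⟨n - 1, Nat.sub_one_lt_of_lt i.isLt⟩)
  else σ (c ⟨i.val - 1, lt_of_le_of_lt (Nat.sub_le _ _) i.isLt⟩)

/-- A linear code is skew `l`-constacyclic if it is stable under the skew constacyclic shift. -/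
def IsSkewConstacyclic (σ : A →+* A) (l : A) (C : Submodule A (Fin n → A)) : Prop :=
  ∀ c ∈ C, skewShift σ l c ∈ C

/-- The dual of `C` for the form `⟨x, y⟩ = ∑ x_i σ(y_i)`. -/
def dualCode (σ : A →+* A) (C : Submodule A (Fin n → A)) : Submodule A (Fin n → A) where
  carrier := {x | ∀ y ∈ C, ∑ i, x i * σ (y i) = 0}
  zero_mem' := by
    intro y _
    simp
  add_mem' := by
    intro a b ha hb y hy
    simp only [Pi.add_apply, add_mul, Finset.sum_add_distrib]
    rw [ha y hy, hb y hy, add_zero]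
  smul_mem' := by
    intro r a ha y hy
    simp only [Pi.smul_apply, smul_eq_mul, mul_assoc, ← Finset.mul_sum]
    rw [ha y hy, mul_zero]

/-- Linear complementary dual code for the form `⟨x, y⟩ = ∑ x_i y_i`. -/
def IsEuclideanLCD (C : Submodule A (Fin n → A)) : Prop :=
  C ⊓ dualCode (RingHom.id A) C = ⊥

/-- Linear complementary dual code for the form `⟨x, y⟩ = ∑ x_i σ(y_i)`, where `σ` is the
conjugation of the ring. -/
def IsHermitianLCD (σ : A →+* A) (C : Submodule A (Fin n → A)) : Prop :=
  C ⊓ dualCode σ C = ⊥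

end Codes

section Field

variable (p : ℕ) [Fact p.Prime]

/-- The field with `p ^ 2` elements. -/
abbrev Fq : Type := GaloisField p 2

/-- `Multiplicative ℕ` acts on the field through the powers of the Frobenius `a ↦ a ^ p`; this
fixes the multiplication `x a = a ^ p x` of `SkewPolynomial (Fq p)`. -/
instance frobeniusAction : MulSemiringAction (Multiplicative ℕ) (Fq p) where
  smul m a := iterateFrobenius (Fq p) p m.toAdd a
  one_smul a := by
    change iterateFrobenius (Fq p) p 0 a = a
    simp
  mul_smul m m' a := by
    change iterateFrobenius (Fq p) p (m.toAdd + m'.toAdd) a =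
      iterateFrobenius (Fq p) p m.toAdd (iterateFrobenius (Fq p) p m'.toAdd a)
    exact iterateFrobenius_add_apply ..
  smul_zero m := map_zero (iterateFrobenius (Fq p) p m.toAdd)
  smul_add m a b := map_add (iterateFrobenius (Fq p) p m.toAdd) a b
  smul_one m := map_one (iterateFrobenius (Fq p) p m.toAdd)
  smul_mul m a b := map_mul (iterateFrobenius (Fq p) p m.toAdd) a b

/-- The skew polynomial ring `𝔽_{p²}[x; θ]`, with `θ(a) = a ^ p`. -/
abbrev SkewPoly : Type := SkewPolynomial (Fq p)

/-- The ring `𝔽_{p²} + v 𝔽_{p²}` with `v ^ 2 = v`. -/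
abbrev Rv : Type := QuadraticAlgebra (Fq p) 0 1

/-- The element `v` of `𝔽_{p²} + v 𝔽_{p²}`. -/
abbrev v : Rv p := QuadraticAlgebra.omega

/-- The automorphism `a + v b ↦ a ^ p + v b ^ p`. -/
def theta : Rv p →+* Rv p where
  toFun z := ⟨z.re ^ p, z.im ^ p⟩
  map_one' := by
    ext
    · exact one_pow p
    · exact zero_pow (Fact.out : p.Prime).ne_zero
  map_zero' := by
    ext
    · exact zero_pow (Fact.out : p.Prime).ne_zero
    · exact zero_pow (Fact.out : p.Prime).ne_zero
  map_add' x y := by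
    ext <;> simp [add_pow_char]
  map_mul' x y := by
    ext <;> simp [add_pow_char, mul_pow]

variable {p} {n : ℕ}

/-- The skew polynomial `c₀ + c₁ x + ⋯ + c_{n-1} x^{n-1}` of a word. -/
def wordPoly (c : Fin n → Fq p) : SkewPoly p :=
  ∑ i : Fin n, SkewPolynomial.monomial i.val (c i)

/-- Leading coefficient one. -/
def IsMonicSkew (g : SkewPoly p) : Prop :=
  ∃ d : ℕ, SkewPolynomial.coeff g d = 1 ∧ ∀ m, d < m → SkewPolynomial.coeff g m = 0

/-- `g` is the skew generator polynomial of the skew `l`-constacyclic code `C` of length `n`: it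
is a monic right divisor of `x ^ n - l`, and the words of `C` are those of the left ideal
generated by `g`. -/
def IsSkewGenerator (l : Fq p) (C : Submodule (Fq p) (Fin n → Fq p)) (g : SkewPoly p) : Prop :=
  IsMonicSkew g ∧
    (∃ h : SkewPoly p, h * g = SkewPolynomial.X ^ n - SkewPolynomial.C l) ∧
    ∀ c : Fin n → Fq p, c ∈ C ↔ ∃ a : SkewPoly p, wordPoly c = a * g

/-- `g` is divisible by some nonconstant polynomial of the centre of `𝔽_{p²}[x; θ]`. -/
def HasCentralDivisor (g : SkewPoly p) : Prop :=
  ∃ f ∈ Subring.center (SkewPoly p),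
    f ∉ Set.range (SkewPolynomial.C : Fq p →+ SkewPoly p) ∧ f ∣ g

/-- The word `v x + (1 - v) y` over `𝔽_{p²} + v 𝔽_{p²}`. -/
def glue (x y : Fin n → Fq p) : Fin n → Rv p := fun i =>
  v p * algebraMap (Fq p) (Rv p) (x i) + (1 - v p) * algebraMap (Fq p) (Rv p) (y i)

theorem glue_zero : glue (0 : Fin n → Fq p) 0 = 0 := by
  funext i
  simp [glue]

theorem glue_add (x x' y y' : Fin n → Fq p) :
    glue (x + x') (y + y') = glue x y + glue x' y' := by
  funext i
  simp only [glue, Pi.add_apply, map_add]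
  ring

theorem glue_smul (r : Fq p) (x y : Fin n → Fq p) :
    glue (r • x) (r • y) = algebraMap (Fq p) (Rv p) r • glue x y := by
  funext i
  simp only [glue, Pi.smul_apply, smul_eq_mul, map_mul]
  ring

/-- The component `C₁` of `C = v C₁ ⊕ (1 - v) C₂`. -/
def component₁ (C : Submodule (Rv p) (Fin n → Rv p)) : Submodule (Fq p) (Fin n → Fq p) where
  carrier := {x | ∃ y, glue x y ∈ C}
  zero_mem' := ⟨0, by rw [glue_zero]; exact C.zero_mem⟩
  add_mem' := by
    rintro a b ⟨y, hy⟩ ⟨z, hz⟩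
    exact ⟨y + z, by rw [glue_add]; exact C.add_mem hy hz⟩
  smul_mem' := by
    rintro r a ⟨y, hy⟩
    exact ⟨r • y, by rw [glue_smul]; exact C.smul_mem _ hy⟩

/-- The component `C₂` of `C = v C₁ ⊕ (1 - v) C₂`. -/
def component₂ (C : Submodule (Rv p) (Fin n → Rv p)) : Submodule (Fq p) (Fin n → Fq p) where
  carrier := {y | ∃ x, glue x y ∈ C}
  zero_mem' := ⟨0, by rw [glue_zero]; exact C.zero_mem⟩
  add_mem' := by
    rintro a b ⟨x, hx⟩ ⟨z, hz⟩
    exact ⟨x + z, by rw [glue_add]; exact C.add_mem hx hz⟩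
  smul_mem' := by
    rintro r a ⟨x, hx⟩
    exact ⟨r • x, by rw [glue_smul]; exact C.smul_mem _ hx⟩

/-- `D` has dimension `k`, and its skew generator polynomial (as a skew `l`-constacyclic code) is
not divisible by any nonconstant central polynomial. -/
def IsAdmissible (k : ℕ) (l : Fq p) (D : Submodule (Fq p) (Fin n → Fq p)) : Prop :=
  Module.finrank (Fq p) D = k ∧ ∃ g : SkewPoly p, IsSkewGenerator l D g ∧ ¬ HasCentralDivisor g

variable (p)

/-- The skew `l`-constacyclic codes `C = v C₁ ⊕ (1 - v) C₂` of length `2k` over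
`𝔽_{p²} + v 𝔽_{p²}` whose components are admissible. For `l = α + v β` the code `C₁` is skew
`(α + β)`-constacyclic and `C₂` is skew `α`-constacyclic. -/
def admissibleCodes (k : ℕ) (l : Rv p) : Set (Submodule (Rv p) (Fin (2 * k) → Rv p)) :=
  {C | IsSkewConstacyclic (theta p) l C ∧
    IsAdmissible k (l.re + l.im) (component₁ C) ∧ IsAdmissible k l.re (component₂ C)}

/-- The number of admissible Euclidean LCD skew `l`-constacyclic codes of length `2k`. -/
def euclideanCount (k : ℕ) (l : Rv p) : ℕ :=
  {C ∈ admissibleCodes p k l | IsEuclideanLCD C}.ncard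

/-- The number of admissible Hermitian LCD skew `l`-constacyclic codes of length `2k`. -/
def hermitianCount (k : ℕ) (l : Rv p) : ℕ :=
  {C ∈ admissibleCodes p k l | IsHermitianLCD (theta p) C}.ncard

/-! ### The data of the formulas

A polynomial `f(x²)` of `𝔽_p[x²]` is represented by `f ∈ 𝔽_p[X]`, so that `natDegree` is the
degree in `x²`. -/

variable {p}

/-- The monic reciprocal polynomial `X ^ (deg f) f(1/X) / f(0)`. -/
def monicReciprocal (f : (ZMod p)[X]) : (ZMod p)[X] :=
  Polynomial.C (f.coeff 0)⁻¹ * f.reverse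

/-- The monic divisors of `F`. -/
def monicDivisors (F : (ZMod p)[X]) : Set (ZMod p)[X] := {f | f.Monic ∧ f ∣ F}

variable (p)

/-- Self-reciprocal irreducible polynomials of degree greater than one. -/
def Fir : Set (ZMod p)[X] := {f | f = monicReciprocal f ∧ Irreducible f ∧ 1 < f.natDegree}

/-- Products of two distinct reciprocal irreducible polynomials. -/
def Fred : Set (ZMod p)[X] :=
  {f | ∃ e : (ZMod p)[X], e.Monic ∧ Irreducible e ∧ e ≠ monicReciprocal e ∧
    f = e * monicReciprocal e}

end Field

def N₁ (p s k : ℕ) : ℤ :=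
  if p = 2 then 2 ^ 2 ^ s
  else if Even k then ((p : ℤ) ^ (p ^ s - 1)) ^ 2 * ((p : ℤ) ^ 2 - 1)
  else (p : ℤ) ^ (p ^ s - 1) * ((p : ℤ) - (-1) ^ ((p + 1) / 2))

def N₂ (p s k : ℕ) : ℤ :=
  if p = 2 then 0
  else if Even k then 0
  else (p : ℤ) ^ (p ^ s - 1) * ((p : ℤ) + 1)

/-- For `p = 2` this is `N₁`, as `-1 = 1` then. -/
def N₃ (p s k : ℕ) : ℤ :=
  if p = 2 then 2 ^ 2 ^ s
  else if Even k then 1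
  else (p : ℤ) ^ (p ^ s - 1) * ((p : ℤ) - (-1) ^ ((p - 1) / 2))

/-- For `p = 2` this is `N₂`, as `-1 = 1` then. -/
def N₄ (p k : ℕ) : ℤ :=
  if p = 2 then 0
  else if Even k then 1
  else 0

end SkewLCD

end

/-! Specializing v to 1 and to 0 identifies R with two copies of 𝔽_{p²}. A code over R is a pair of
codes over the field, and it is LCD exactly when both are (`gluedCode_lcd_iff`). Each count is
therefore a product of two counts over the field, for skew ε-constacyclic codes with ε = ±1.

Put z = x² and B = 𝔽_{p²}[z]/(z^k - ε), and let A = 𝔽_p[z]/(z^k - ε) be the subring of B fixed by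
the conjugation w ↦ w̄ of coefficients. Modulo the central element x^{2k} - ε, the skew polynomial
ring is B ⊕ Bx. The equation uū = z is solvable in B (`exists_norm_eq_root`), and then x(uw̄ - wx) =
-ū(uw̄ - wx), so the B-line through uw̄ - wx is a left ideal. The admissible codes are exactly these
lines with w and w̄ generating the unit ideal (`IsModulus.isAdmissible_iff`), and w is determined up
to a unit of A (`exists_mul_eq_of_span_eq`).

The form on words is the constant coefficient of a B-valued form whose second argument is twisted by
ρ: z ↦ z⁻¹, with the identity (Euclidean) or Frobenius (Hermitian) on coefficients. The line of w is
LCD exactly when h(w) = wρ(w) + γ·conj(wρ(w)), with γ = uρ(u), is a unit (`IsModulus.code_lcd_iff`).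
Hence the number of codes times |A^×| is the number of w with h(w) a unit
(`IsModulus.ncard_mul_fixedUnitCount`).

Being a unit is decided modulo the irreducible factors of z^k - ε, which are grouped into orbits
under e ↦ e♮ so that ρ acts on each residue ring. All multiplicities are p^s, so after division by
the units of A the nilpotents contribute p^{(p^s-1) deg F} for each orbit product F. The residual
counts are of three kinds. - F irreducible and self-reciprocal of degree d > 1: h is a nondegenerate
hermitian form in two variables over a field with p^d elements, which leaves p^d - p^{d/2}
(`unitFormCount_hermitian`). - F = ee♮ with e ≠ e♮: ρ swaps the two halves and h becomes a bilinear
pairing, which leaves (1+Q)Q with Q = p^{deg e} (`card_isUnit_pairing`). - F = z - η with η = ±1: h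
lives on 𝔽_{p²}. In the Euclidean case it is a product of two semilinear factors; in the Hermitian
case it is (1+η) times the norm, hence identically zero at η = -1. The numbers N₁, …, N₄ collect the
linear factors, that is, the roots ±1 of z^k - ε. -/

noncomputable section

namespace SkewLCD

/-! ### Fixed points of semilinear involutions and the trace pairing -/

section TwistedFixed

variable {E : Type*} [CommRing E]

/-- The additive group of the `y` with `γ τ(y) = y`. -/
def twistedFixed (τ : E →+* E) (γ : E) : AddSubgroup E where
  carrier := {y | γ * τ y = y}
  zero_mem' := by simp
  add_mem' {a b} ha hb := by
    simp only [Set.mem_ofPred_eq] at *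
    rw [map_add, mul_add, ha, hb]
  neg_mem' {a} ha := by
    simp only [Set.mem_ofPred_eq] at *
    rw [map_neg, mul_neg, ha]

theorem mem_twistedFixed {τ : E →+* E} {γ y : E} : y ∈ twistedFixed τ γ ↔ γ * τ y = y := Iff.rfl

/-- Galois descent for the semilinear involution y ↦ γτ(y): its fixed group L satisfies E = L ⊕ αL.
The inverse c of α - τα recovers the second coordinate of y as c(y - γτ(y)). -/
theorem card_twistedFixed_sq [Finite E] {τ : E →+* E} (hτ : ∀ x, τ (τ x) = x) {γ α : E}
    (hγ : γ * τ γ = 1) (hα : IsUnit (α - τ α)) :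
    Nat.card (twistedFixed τ γ) ^ 2 = Nat.card E := by
  obtain ⟨c, hc⟩ := hα.exists_left_inv
  have hτc : τ c = -c := by
    have h1 : τ c * (τ α - α) = 1 := by
      have := congrArg τ hc
      rwa [map_mul, map_sub, hτ, map_one] at this
    linear_combination (-τ c) * hc - c * h1
  rw [sq, ← Nat.card_prod]
  refine Nat.card_congr (Equiv.ofBijective
    (fun l : twistedFixed τ γ × twistedFixed τ γ => (l.1 : E) + α * l.2) ⟨?_, ?_⟩)
  · rintro ⟨⟨a, ha⟩, ⟨b, hb⟩⟩ ⟨⟨a', ha'⟩, ⟨b', hb'⟩⟩ h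
    simp only [mem_twistedFixed] at ha hb ha' hb' h
    have h2 := congrArg (fun y => γ * τ y) h
    simp only [map_add, map_mul] at h2
    have h3 : b = b' := by
      linear_combination (-(b - b')) * hc + c * h - c * h2 + c * ha - c * ha' + c * τ α * hb
        - c * τ α * hb'
    subst h3
    simpa using h
  · intro y
    have h1 : γ * τ (c * (y - γ * τ y)) = c * (y - γ * τ y) := by
      simp only [map_mul, map_sub, hτ, hτc]
      linear_combination (c * y) * hγ
    have h2 : γ * τ (y - α * (c * (y - γ * τ y))) = y - α * (c * (y - γ * τ y)) := by
      rw [map_sub, map_mul τ α]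
      linear_combination (- τ α) * h1 - (γ * τ y - y) * hc
    exact ⟨(⟨_, h2⟩, ⟨_, h1⟩), by simp⟩

/-- The fixed ring is a field but E may be split, so nonzero elements of E need not be units. On the
twisted line they are: if yθ(y) = 0 then y² = γyθ(y) = 0, so every trace ty + θ(ty) squares to zero
inside a field and vanishes. Taking t = 1 and t = α then gives y = 0. -/
theorem isUnit_of_mem_twistedFixed {θ : E →+* E} (hθ : ∀ x, θ (θ x) = x) {γ α : E}
    (hα : IsUnit (α - θ α))
    (hK : ∀ a, θ a = a → a ≠ 0 → IsUnit a) {y : E}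
    (hy : y ∈ twistedFixed θ γ) (h0 : y ≠ 0) : IsUnit y := by
  rw [mem_twistedFixed] at hy
  by_cases h : y * θ y = 0
  · exfalso
    apply h0
    have hyy : y * y = 0 := by
      linear_combination γ * h - y * hy
    have hθy : θ y * θ y = 0 := by
      simpa using congrArg θ hyy
    have key : ∀ t : E, t * y + θ (t * y) = 0 := by
      intro t
      by_contra hne
      have hu := hK (t * y + θ (t * y)) (by rw [map_add, hθ, add_comm]) hne
      have hz : (t * y + θ (t * y)) * (t * y + θ (t * y)) = 0 := by
        rw [map_mul]
        linear_combination t * t * hyy + θ t * θ t * hθy + 2 * t * θ t * h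
      exact hne ((hu.mul_right_eq_zero).1 hz)
    have h1 := key 1
    have h2 := key α
    rw [map_mul] at h1 h2
    rw [map_one] at h1
    have : (α - θ α) * y = 0 := by linear_combination h2 - θ α * h1
    exact (hα.mul_right_eq_zero).1 this
  · exact isUnit_of_mul_isUnit_left (hK (y * θ y) (by rw [map_mul, hθ, mul_comm]) h)

theorem card_ker_mul_card_range {G H : Type*} [AddGroup G] [AddGroup H] (f : G →+ H) :
    Nat.card f.ker * Nat.card f.range = Nat.card G := by
  rw [← AddSubgroup.index_ker, AddSubgroup.card_mul_index]

/-- The additive map `w' ↦ w w' + γ θ(w w')`. -/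
def pairingHom (θ : E →+* E) (γ w : E) : E →+ E where
  toFun w' := w * w' + γ * θ (w * w')
  map_zero' := by simp
  map_add' a b := by simp only [mul_add, map_add]; ring

theorem pairingHom_apply (θ : E →+* E) (γ w w' : E) :
    pairingHom θ γ w w' = w * w' + γ * θ (w * w') := rfl

theorem pairingHom_mem {θ : E →+* E} (hθ : ∀ x, θ (θ x) = x) {γ : E} (hγ : γ * θ γ = 1)
    (w w' : E) : pairingHom θ γ w w' ∈ twistedFixed θ γ := by
  rw [mem_twistedFixed, pairingHom_apply, map_add, map_mul θ γ, hθ]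
  linear_combination (w * w') * hγ

theorem eq_zero_of_pairingHom_eq_zero {θ : E →+* E} {γ α : E} (hα : IsUnit (α - θ α)) {w : E}
    (h : ∀ w', pairingHom θ γ w w' = 0) : w = 0 := by
  have h1 := h 1
  have h2 := h α
  simp only [pairingHom_apply, mul_one, map_mul] at h1 h2
  have : (α - θ α) * w = 0 := by linear_combination h2 - θ α * h1
  exact (hα.mul_right_eq_zero).1 this

/-- Pairing with w ≠ 0 is a nonzero linear map over the fixed field into a line of Q elements. It
takes a unit value, whose multiples by fixed elements fill the line, so the kernel has Q²/Q
elements. -/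
theorem card_ker_pairingHom [Finite E] {θ : E →+* E} (hθ : ∀ x, θ (θ x) = x) {γ α : E}
    (hα : IsUnit (α - θ α)) (hγ : γ * θ γ = 1)
    (hK : ∀ a, θ a = a → a ≠ 0 → IsUnit a) {Q : ℕ} (hQ : Nat.card E = Q ^ 2) {w : E}
    (hw : w ≠ 0) : Nat.card (pairingHom θ γ w).ker = Q := by
  have hcL : Nat.card (twistedFixed θ γ) = Q := by
    have := card_twistedFixed_sq hθ hγ hα
    rw [hQ] at this
    exact (Nat.pow_left_injective two_ne_zero) this
  have hcK : Nat.card (twistedFixed θ 1) = Q := by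
    have := card_twistedFixed_sq hθ (γ := 1) (by simp) hα
    rw [hQ] at this
    exact (Nat.pow_left_injective two_ne_zero) this
  have hQ0 : 0 < Q := hcL ▸ Nat.card_pos
  have hrange : (pairingHom θ γ w).range = twistedFixed θ γ := by
    apply SetLike.coe_injective
    have hsub : ((pairingHom θ γ w).range : Set E) ⊆ twistedFixed θ γ := by
      rintro _ ⟨w', rfl⟩
      exact pairingHom_mem hθ hγ w w'
    refine Set.eq_of_subset_of_ncard_le hsub ?_ (Set.toFinite _)
    change Nat.card (twistedFixed θ γ) ≤ Nat.card (pairingHom θ γ w).range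
    rw [hcL, ← hcK]
    obtain ⟨w', hw'⟩ : ∃ w', pairingHom θ γ w w' ≠ 0 := by
      by_contra! h
      exact hw (eq_zero_of_pairingHom_eq_zero hα h)
    have hu := isUnit_of_mem_twistedFixed hθ hα hK (pairingHom_mem hθ hγ w w') hw'
    refine Nat.card_le_card_of_injective
      (fun a : twistedFixed θ 1 => (⟨a * pairingHom θ γ w w', a * w', ?_⟩ :
        (pairingHom θ γ w).range)) ?_
    · have ha : 1 * θ (a : E) = a := a.2
      rw [one_mul] at ha
      simp only [pairingHom_apply, map_mul, ha]
      ring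
    · intro a b hab
      exact Subtype.ext (hu.mul_left_injective (congrArg Subtype.val hab))
  have := card_ker_mul_card_range (pairingHom θ γ w)
  rw [hrange, hcL, hQ, sq] at this
  exact Nat.eq_of_mul_eq_mul_right hQ0 this

theorem card_subtype_not {α : Type*} [Finite α] (P : α → Prop) :
    Nat.card {a // ¬ P a} = Nat.card α - Nat.card {a // P a} := by
  classical
  have := Fintype.ofFinite α
  rw [Nat.card_eq_fintype_card, Nat.card_eq_fintype_card, Nat.card_eq_fintype_card,
    Fintype.card_subtype_compl]

theorem card_subtype_ne_zero (α : Type*) [Finite α] [Zero α] :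
    Nat.card {a : α // a ≠ 0} = Nat.card α - 1 := by
  rw [card_subtype_not (fun a : α => a = 0)]
  simp

/-- The local model for a factor ee♮. For each of the Q² - 1 nonzero w, the second variable only has
to avoid a kernel of Q elements. -/
theorem card_isUnit_pairing [Finite E] {θ : E →+* E} (hθ : ∀ x, θ (θ x) = x) {γ α : E}
    (hα : IsUnit (α - θ α)) (hγ : γ * θ γ = 1)
    (hK : ∀ a, θ a = a → a ≠ 0 → IsUnit a) {Q : ℕ} (hQ : Nat.card E = Q ^ 2) [Nontrivial E] :
    Nat.card {w : E × E // IsUnit (w.1 * w.2 + γ * θ (w.1 * w.2))} =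
      (Q ^ 2 - 1) * (Q ^ 2 - Q) := by
  classical
  have := Fintype.ofFinite E
  have e : {w : E × E // IsUnit (w.1 * w.2 + γ * θ (w.1 * w.2))} ≃
      Σ w : {w : E // w ≠ 0}, {w' : E // ¬ w' ∈ (pairingHom θ γ w.1).ker} :=
    { toFun := fun w => ⟨⟨w.1.1, by
          rintro h
          have := w.2
          simp [h] at this⟩, ⟨w.1.2, by
          intro h
          have h1 := w.2
          rw [AddMonoidHom.mem_ker, pairingHom_apply] at h
          rw [h] at h1
          exact not_isUnit_zero h1⟩⟩
      invFun := fun w => ⟨(w.1.1, w.2.1),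
        isUnit_of_mem_twistedFixed hθ hα hK (pairingHom_mem hθ hγ w.1.1 w.2.1)
          (fun h => w.2.2 h)⟩
      left_inv := fun w => rfl
      right_inv := fun w => rfl }
  rw [Nat.card_congr e, Nat.card_sigma, Finset.sum_congr rfl (g := fun _ => Q ^ 2 - Q)]
  · simp only [Finset.sum_const, Finset.card_univ, smul_eq_mul]
    rw [← Nat.card_eq_fintype_card, card_subtype_ne_zero, hQ]
  · intro w _
    rw [card_subtype_not (fun w' => w' ∈ (pairingHom θ γ w.1).ker), hQ]
    congr 1
    exact card_ker_pairingHom hθ hα hγ hK hQ w.2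

end TwistedFixed

/-! ### Fibres of the norm of a quadratic extension of finite fields -/

section NormFibre

variable {K : Type*} [Field K] [Finite K]

/-- Hilbert 90 by counting: x ↦ x/τ(x) has the Q - 1 fixed units as kernel and the norm-one group as
image, so that group has Q + 1 elements. The norm therefore has Q - 1 values, which are all the
fixed units. -/
theorem card_norm_fibre {τ : K →+* K} (hτ : ∀ x, τ (τ x) = x) {α : K} (hα : τ α ≠ α) {Q : ℕ}
    (hQ : Nat.card K = Q ^ 2) {κ : K} (hκ : τ κ = κ) (hκ0 : κ ≠ 0) :
    Nat.card {a : K // a * τ a = κ} = Q + 1 := by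
  have hα' : IsUnit (α - τ α) := (sub_ne_zero.2 hα.symm).isUnit
  let T : Kˣ →* Kˣ := Units.map τ
  have hT : ∀ x, ((T x : Kˣ) : K) = τ x := fun x => rfl
  let N : Kˣ →* Kˣ := MonoidHom.id Kˣ * T
  let D : Kˣ →* Kˣ := MonoidHom.id Kˣ / T
  have hN : ∀ x, N x = x * T x := fun x => rfl
  have hD : ∀ x, D x = x / T x := fun x => rfl
  have hcard : ∀ γ : K, γ * τ γ = 1 → Nat.card (twistedFixed τ γ) = Q := by
    intro γ hγ
    have := card_twistedFixed_sq hτ hγ hα'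
    rw [hQ] at this
    exact (Nat.pow_left_injective two_ne_zero) this
  have hQ1 : 1 < Q := by
    have h1 : 1 < Nat.card K := Finite.one_lt_card
    rw [hQ] at h1
    by_contra h
    interval_cases Q <;> simp_all
  have hker : Nat.card D.ker = Q - 1 := by
    rw [← hcard 1 (by simp), ← card_subtype_ne_zero]
    refine Nat.card_congr
      { toFun := fun x => ⟨⟨(x : Kˣ), ?_⟩, ?_⟩
        invFun := fun x => ⟨Units.mk0 (x : K) ?_, ?_⟩
        left_inv := ?_
        right_inv := ?_ }
    · have := x.2
      rw [MonoidHom.mem_ker, hD, div_eq_one, Units.ext_iff, hT] at this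
      rw [mem_twistedFixed, one_mul]
      exact this.symm
    · intro h
      exact (x : Kˣ).ne_zero (congrArg Subtype.val h)
    · intro h
      exact x.2 (Subtype.ext h)
    · have := x.1.2
      rw [mem_twistedFixed, one_mul] at this
      rw [MonoidHom.mem_ker, hD, div_eq_one, Units.ext_iff, hT]
      exact this.symm
    · intro x; ext; rfl
    · intro x; ext; rfl
  have hunits : Nat.card Kˣ = (Q - 1) * (Q + 1) := by
    rw [Nat.card_units, hQ, mul_comm, ← Nat.sq_sub_sq, one_pow]
  have hrange : D.range = N.ker := by
    ext a
    constructor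
    · rintro ⟨x, rfl⟩
      rw [MonoidHom.mem_ker, hN, hD, _root_.map_div]
      have : T (T x) = x := by ext; simp [hT, hτ]
      rw [this]; simp
    -- An element a of norm one makes y ↦ aτ(y) an involution. Its fixed group has Q > 1 elements,
    -- and any nonzero y in it satisfies a = y/τ(y).
    · intro ha
      rw [MonoidHom.mem_ker, hN, Units.ext_iff] at ha
      have ha : (a : K) * τ a = 1 := ha
      have h2 := hcard a ha
      obtain ⟨y, hy⟩ : ∃ y : twistedFixed τ (a : K), y ≠ 0 := by
        have : Nontrivial (twistedFixed τ (a : K)) := by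
          rw [← Finite.one_lt_card_iff_nontrivial, h2]; exact hQ1
        exact exists_ne 0
      have hy0 : (y : K) ≠ 0 := fun h => hy (Subtype.ext h)
      refine ⟨Units.mk0 (y : K) hy0, ?_⟩
      rw [hD, div_eq_iff_eq_mul, Units.ext_iff]
      exact (mem_twistedFixed.1 y.2).symm
  have hcr : ∀ f : Kˣ →* Kˣ, Nat.card f.ker * Nat.card f.range = Nat.card Kˣ := by
    intro f
    rw [← Subgroup.index_ker, Subgroup.card_mul_index]
  have hkN : Nat.card N.ker = Q + 1 := by
    have := hcr D
    rw [hker, hunits, hrange] at this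
    exact Nat.eq_of_mul_eq_mul_left (by omega) this
  have hrN : Nat.card N.range = Q - 1 := by
    have := hcr N
    rw [hkN, hunits, mul_comm] at this
    exact Nat.eq_of_mul_eq_mul_right (by omega) this
  have hND : N.range = D.ker := by
    apply SetLike.coe_injective
    refine Set.eq_of_subset_of_ncard_le ?_ ?_ (Set.toFinite _)
    · rintro _ ⟨x, rfl⟩
      rw [SetLike.mem_coe, MonoidHom.mem_ker, hD, hN, map_mul]
      have : T (T x) = x := by ext; simp [hT, hτ]
      rw [this, mul_comm, div_self']
    · change Nat.card D.ker ≤ Nat.card N.range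
      rw [hker, hrN]
  obtain ⟨x, hx⟩ : Units.mk0 κ hκ0 ∈ N.range := by
    rw [hND, MonoidHom.mem_ker, hD, div_eq_one, Units.ext_iff, hT]
    exact hκ.symm
  rw [hN, Units.ext_iff] at hx
  have hx : (x : K) * τ x = κ := hx
  rw [← hkN]
  refine Nat.card_congr
    { toFun := fun a => ⟨Units.mk0 (a : K) ?_ / x, ?_⟩
      invFun := fun y => ⟨(y : Kˣ) * (x : K), ?_⟩
      left_inv := ?_
      right_inv := ?_ }
  · intro h
    have := a.2
    rw [h, zero_mul] at this
    exact hκ0 this.symm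
  · rw [MonoidHom.mem_ker, _root_.map_div, div_eq_one, hN, hN, Units.ext_iff]
    change (a : K) * τ a = x * τ x
    rw [a.2, hx]
  · have := y.2
    rw [MonoidHom.mem_ker, hN, Units.ext_iff] at this
    have h1 : ((y : Kˣ) : K) * τ (y : Kˣ) = 1 := this
    rw [map_mul]
    linear_combination κ * h1 + ((y : Kˣ) : K) * τ (y : Kˣ) * hx
  · intro a
    ext
    simp
  · intro y
    ext
    simp

end NormFibre

/-! ### Hermitian forms in two variables over a finite field -/

section Hermitian

variable {E : Type*} [CommRing E]

/-- The value at `w` of the form `w ρ(w) + γ θ(w ρ(w))`. -/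
def formVal (θ ρ : E →+* E) (γ w : E) : E := w * ρ w + γ * θ (w * ρ w)

theorem formVal_eq_pairingHom (θ ρ : E →+* E) (γ w : E) :
    formVal θ ρ γ w = pairingHom θ γ w (ρ w) := rfl

/-- The number of `w` at which the form is a unit. -/
def unitFormCount (θ ρ : E →+* E) (γ : E) : ℕ := Nat.card {w : E // IsUnit (formVal θ ρ γ w)}

/-- The number of units fixed by `θ`. -/
def fixedUnitCount (θ : E →+* E) : ℕ := Nat.card {a : E // θ a = a ∧ IsUnit a}

/-- E is a plane over K and h(w, w') is a nondegenerate hermitian form with values in a twisted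
line. Split E as Kv plus the orthogonal of an anisotropic v. For each vector w of that orthogonal,
isotropy of av + w is a norm equation on a: it has one solution if w = 0 and Q + 1 otherwise. So
there are 1 + (Q² - 1)(Q + 1) isotropic vectors, and the other vectors have unit values. -/
theorem unitFormCount_hermitian [Finite E] [Nontrivial E] {K : Type*} [Field K] [Finite K]
    {θ ρ : E →+* E}
    (hθ : ∀ x, θ (θ x) = x) (hρ : ∀ x, ρ (ρ x) = x) (hθρ : ∀ x, θ (ρ x) = ρ (θ x)) {γ α : E}
    (hα : IsUnit (α - θ α)) (hγ : γ * θ γ = 1) (hργ : ρ γ = γ)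
    {i : K →+* E} (hi : ∀ y, θ y = y ↔ ∃ a, i a = y)
    {τ : K →+* K} (hτ : ∀ a, i (τ a) = ρ (i a)) {β : K} (hβ : τ β ≠ β)
    {Q : ℕ} (hK : Nat.card K = Q ^ 2) (hE : Nat.card E = (Q ^ 2) ^ 2) :
    unitFormCount θ ρ γ = (Q ^ 2 - 1) * (Q ^ 2 - Q) := by
  classical
  have := Fintype.ofFinite E
  have hii : Function.Injective i := i.injective
  have hττ : ∀ a, τ (τ a) = a := fun a => hii (by rw [hτ, hτ, hρ])
  have hiθ : ∀ a, θ (i a) = i a := fun a => (hi _).2 ⟨a, rfl⟩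
  have hKu : ∀ a, θ a = a → a ≠ 0 → IsUnit a := by
    intro a ha h0
    obtain ⟨b, rfl⟩ := (hi a).1 ha
    have : b ≠ 0 := fun h => h0 (by rw [h, map_zero])
    exact this.isUnit.map i
  set h : E → E → E := fun w w' => pairingHom θ γ w (ρ w') with hh
  have hdef : ∀ w w', h w w' = w * ρ w' + γ * θ (w * ρ w') := fun w w' => rfl
  have hρh : ∀ w w', ρ (h w w') = h w' w := by
    intro w w'
    simp only [hdef, map_add, map_mul, hργ, hρ, ← hθρ]
    ring
  have hsm : ∀ (a : K) w w', h (i a * w) w' = i a * h w w' := by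
    intro a w w'
    simp only [hdef, map_mul, hiθ]
    ring
  have hsm' : ∀ (a : K) w w', h w (i a * w') = i (τ a) * h w w' := by
    intro a w w'
    simp only [hdef, map_mul, ← hτ, hiθ]
    ring
  have hadd : ∀ w₁ w₂ w', h (w₁ + w₂) w' = h w₁ w' + h w₂ w' := by
    intro a b c
    simp only [hdef, add_mul, map_add]; ring
  have hadd' : ∀ w w₁ w₂, h w (w₁ + w₂) = h w w₁ + h w w₂ := by
    intro a b c
    simp only [hdef, mul_add, map_add]; ring
  have hmem : ∀ w w', h w w' ∈ twistedFixed θ γ := fun w w' => pairingHom_mem hθ hγ _ _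
  have hunit : ∀ w w', h w w' ≠ 0 → IsUnit (h w w') := fun w w' hne =>
    isUnit_of_mem_twistedFixed hθ hα hKu (hmem w w') hne
  have hnd : ∀ w, (∀ w', h w w' = 0) → w = 0 := by
    intro w hw
    refine eq_zero_of_pairingHom_eq_zero (γ := γ) hα fun w' => ?_
    have := hw (ρ w')
    simpa only [hh, hρ] using this
  -- Polarization: if all h(w, w) vanished, expanding at w + w' and at βw + w' would give (β -
  -- τβ)h(w, w') = 0.
  obtain ⟨v, hv⟩ : ∃ v, h v v ≠ 0 := by
    by_contra! hz
    have h1 : ∀ w w', h w w' = 0 := by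
      intro w w'
      have e1 := hz (w + w')
      have e2 := hz (i β * w + w')
      simp only [hadd, hadd', hsm, hsm', hz, mul_zero, zero_add, add_zero] at e1 e2
      have e3 : (i (β - τ β)) * h w w' = 0 := by
        rw [map_sub]
        linear_combination e2 - i (τ β) * e1
      have : IsUnit (i (β - τ β)) := (sub_ne_zero.2 hβ.symm).isUnit.map i
      exact (this.mul_right_eq_zero).1 e3
    exact one_ne_zero (hnd 1 (h1 1))
  have hv0 : v ≠ 0 := by
    rintro rfl
    simp [hdef] at hv
  -- the orthogonal of `v`
  let M : AddSubgroup E := ((pairingHom θ γ v).comp ρ.toAddMonoidHom).ker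
  have hM : ∀ w, w ∈ M ↔ h v w = 0 := fun w => Iff.rfl
  have hcM : Nat.card M = Q ^ 2 := by
    rw [← card_ker_pairingHom hθ hα hγ hKu hE hv0]
    refine Nat.card_congr
      { toFun := fun w => ⟨ρ w, w.2⟩
        invFun := fun w => ⟨ρ w, ?_⟩
        left_inv := fun w => Subtype.ext (hρ _)
        right_inv := fun w => Subtype.ext (hρ _) }
    have := w.2
    rw [AddMonoidHom.mem_ker] at this ⊢
    rw [← this]
    exact congrArg (pairingHom θ γ v) (hρ _)
  have hMsm : ∀ (a : K) w, w ∈ M → i a * w ∈ M := by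
    intro a w hw
    rw [hM] at hw ⊢
    rw [hsm', hw, mul_zero]
  let F : K × M → E := fun x => i x.1 * v + x.2
  have hFinj : Function.Injective F := by
    rintro ⟨a, w, hw⟩ ⟨a', w', hw'⟩ hEq
    simp only [F] at hEq
    have e := congrArg (h v) hEq
    rw [hM] at hw hw'
    rw [hadd', hadd', hw, hw', hsm', hsm', add_zero, add_zero] at e
    have e1 : a = a' := by
      have := hii ((hunit v v hv).mul_left_injective e)
      rw [← hττ a, this, hττ]
    subst e1
    simpa using hEq
  have hFbij : Function.Bijective F := by
    refine hFinj.bijective_of_nat_card_le ?_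
    rw [Nat.card_prod, hK, hcM, hE, sq (Q ^ 2)]
  -- The orthogonal M is a line over K, so an isotropic vector spanning it would be orthogonal to M
  -- and to v, hence to everything.
  have hMw : ∀ w ∈ M, w ≠ 0 → h w w ≠ 0 := by
    intro w hw hw0 hz
    apply hw0
    apply hnd
    intro y
    obtain ⟨⟨a, w', hw'⟩, rfl⟩ := hFbij.2 y
    have hsurj : Function.Surjective (fun a : K => (⟨i a * w, hMsm a w hw⟩ : M)) := by
      have hinj : Function.Injective (fun a : K => (⟨i a * w, hMsm a w hw⟩ : M)) := by
        intro a b hab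
        simp only [Subtype.mk.injEq] at hab
        by_contra hne
        have hu : IsUnit (i (a - b)) := (sub_ne_zero.2 hne).isUnit.map i
        apply hw0
        apply (hu.mul_right_eq_zero).1
        rw [map_sub, sub_mul, hab, sub_self]
      exact (hinj.bijective_of_nat_card_le (by rw [hcM, hK])).2
    obtain ⟨b, hb⟩ := hsurj ⟨w', hw'⟩
    simp only [Subtype.mk.injEq] at hb
    simp only [F]
    rw [hadd', hsm', ← hb, hsm', hz, ← hρh, (hM w).1 hw, map_zero, mul_zero, mul_zero, add_zero]
  have hval : ∀ a (w : M), h (F (a, w)) (F (a, w)) = i (a * τ a) * h v v + h w w := by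
    intro a w
    have h1 := (hM w).1 w.2
    have h2 : h w v = 0 := by rw [← hρh, h1, map_zero]
    simp only [F]
    rw [hadd, hadd', hadd', hsm, hsm, hsm', hsm', h1, h2, map_mul]
    ring
  have hcount : ∀ w : M, Nat.card {a : K // h (F (a, w)) (F (a, w)) = 0} =
      if w = 0 then 1 else Q + 1 := by
    intro w
    obtain ⟨l, hl⟩ := (hunit v v hv)
    have hθl : γ * θ l = l := by rw [hl]; exact hmem v v
    have hρl : ρ l = l := by rw [hl]; exact hρh v v
    -- Both values lie on the same twisted line, so their ratio is fixed by θ and comes from K.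
    obtain ⟨κ, hκ⟩ : ∃ κ, i κ * l = h w w := by
      have h1 : γ * θ (h w w) = h w w := hmem w w
      have h2 : θ (h w w * ↑l⁻¹) * θ l = θ (h w w) := by rw [← map_mul]; simp
      have : θ (h w w * ↑l⁻¹) = h w w * ↑l⁻¹ := by
        have h3 : θ (h w w * ↑l⁻¹) * l = h w w := by
          linear_combination (-θ (h w w * ↑l⁻¹)) * hθl + γ * h2 + h1
        exact (Units.eq_mul_inv_iff_mul_eq l).2 h3
      obtain ⟨κ, hκ⟩ := (hi _).1 this
      exact ⟨κ, by rw [hκ]; simp⟩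
    have hτκ : τ κ = κ := by
      apply hii
      apply l.isUnit.mul_left_injective
      simp only
      have := hρh w w
      rw [← hκ, map_mul, hρl, ← hτ] at this
      exact this
    have hκ0 : κ = 0 ↔ w = 0 := by
      constructor
      · intro h0
        by_contra hne
        refine hMw w w.2 (fun h => hne (Subtype.ext h)) ?_
        rw [← hκ, h0, map_zero, zero_mul]
      · rintro rfl
        have : h (0 : M) (0 : M) = 0 := by simp [hdef]
        rw [this] at hκ
        exact (map_eq_zero_iff i hii).1 ((l.isUnit.mul_left_eq_zero).1 hκ)
    have hiff : ∀ a, h (F (a, w)) (F (a, w)) = 0 ↔ a * τ a = -κ := by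
      intro a
      rw [hval, ← hκ, ← hl, ← add_mul, ← map_add, l.isUnit.mul_left_eq_zero,
        map_eq_zero_iff i hii, add_eq_zero_iff_eq_neg]
    rw [Nat.card_congr (Equiv.subtypeEquivRight hiff)]
    split_ifs with hw
    · rw [hκ0.2 hw, neg_zero]
      have : ∀ a, a * τ a = 0 ↔ a = 0 := by
        intro a
        rw [mul_eq_zero, map_eq_zero, or_self]
      rw [Nat.card_congr (Equiv.subtypeEquivRight this)]
      simp
    · exact card_norm_fibre hττ hβ hK (by rw [map_neg, hτκ])
        (neg_ne_zero.2 fun h => hw (hκ0.1 h))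
  have hzero : Nat.card {w : E // h w w = 0} = 1 + (Q ^ 2 - 1) * (Q + 1) := by
    let e : (Σ w : M, {a : K // h (F (a, w)) (F (a, w)) = 0}) ≃ {w : E // h w w = 0} :=
      Equiv.ofBijective (fun x => ⟨F (x.2.1, x.1), x.2.2⟩) ⟨by
        rintro ⟨w, a, ha⟩ ⟨w', a', ha'⟩ hEq
        have := hFinj (congrArg Subtype.val hEq)
        simp only [Prod.mk.injEq] at this
        obtain ⟨rfl, rfl⟩ := this
        rfl, by
        rintro ⟨y, hy⟩
        obtain ⟨⟨a, w⟩, rfl⟩ := hFbij.2 y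
        exact ⟨⟨w, a, hy⟩, rfl⟩⟩
    rw [← Nat.card_congr e, Nat.card_sigma, Finset.sum_congr rfl (fun w _ => hcount w),
      Finset.sum_ite, Finset.filter_eq' _ (0 : M)]
    simp only [Finset.mem_univ, if_true, Finset.sum_const, Finset.card_singleton, smul_eq_mul,
      mul_one]
    congr 2
    rw [← hcM, ← card_subtype_ne_zero, Nat.card_eq_fintype_card, Fintype.card_subtype]
  have hfinal : unitFormCount θ ρ γ = Nat.card {w : E // ¬ h w w = 0} := by
    refine Nat.card_congr (Equiv.subtypeEquivRight fun w => ?_)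
    rw [formVal_eq_pairingHom]
    exact ⟨fun hu => hu.ne_zero, fun hne => hunit w w hne⟩
  rw [hfinal, card_subtype_not (fun w => h w w = 0), hzero, hE]
  have hQ1 : 1 ≤ Q := by
    by_contra h0
    have : Q = 0 := by omega
    rw [this] at hK
    have := Nat.card_pos (α := K)
    simp_all
  zify [Nat.one_le_pow 2 Q hQ1, show Q ≤ Q ^ 2 by nlinarith]
  rw [Nat.cast_sub]
  · push_cast [Nat.one_le_pow 2 Q hQ1]
    ring
  · zify [Nat.one_le_pow 2 Q hQ1]
    have : (1 : ℤ) ≤ Q := by exact_mod_cast hQ1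
    nlinarith [mul_nonneg (sub_nonneg.2 this) (sub_nonneg.2 this), sq_nonneg ((Q : ℤ) ^ 2 - Q),
      mul_nonneg (mul_nonneg (sub_nonneg.2 this) (sub_nonneg.2 this)) (by positivity : (0 : ℤ) ≤ Q)]

end Hermitian

/-! ### The Frobenius of 𝔽_{p²} -/

section Frobenius

variable (p : ℕ) [Fact p.Prime]

/-- The Frobenius of the field with `p ^ 2` elements. -/
abbrev frob : Fq p →+* Fq p := frobenius (Fq p) p

variable {p}

theorem card_Fq : Nat.card (Fq p) = p ^ 2 := GaloisField.card p 2 two_ne_zero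

theorem frob_frob (a : Fq p) : frob p (frob p a) = a := by
  have := Fintype.ofFinite (Fq p)
  rw [frobenius_def, frobenius_def, ← pow_mul, ← sq, ← card_Fq, Nat.card_eq_fintype_card,
    FiniteField.pow_card]

/-- Otherwise a generator of the cyclic group of p² - 1 units would have order dividing p - 1. -/
theorem exists_frob_ne : ∃ α : Fq p, frob p α ≠ α := by
  by_contra! h
  obtain ⟨g, hg⟩ := IsCyclic.exists_generator (α := (Fq p)ˣ)
  have hp := (Fact.out : p.Prime).two_le
  have h1 : g ^ (p - 1) = 1 := by
    have h2 : g ^ p = g := by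
      ext
      simpa [frobenius_def] using h g
    have h3 : g ^ (p - 1) * g = g := by
      rw [← pow_succ, Nat.sub_add_cancel (by omega), h2]
    simpa using h3
  have h2 := orderOf_dvd_of_pow_eq_one h1
  rw [orderOf_eq_card_of_forall_mem_zpowers hg, Nat.card_units, card_Fq] at h2
  have h3 := Nat.le_of_dvd (by omega) h2
  have h4 : p + p ≤ p ^ 2 := by nlinarith
  omega

theorem ringHom_comp_algebraMap (j : Fq p →+* Fq p) :
    j.comp (algebraMap (ZMod p) (Fq p)) = algebraMap (ZMod p) (Fq p) := Subsingleton.elim _ _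

theorem map_map_algebraMap (j : Fq p →+* Fq p) (P : (ZMod p)[X]) :
    (P.map (algebraMap (ZMod p) (Fq p))).map j = P.map (algebraMap (ZMod p) (Fq p)) := by
  rw [Polynomial.map_map, ringHom_comp_algebraMap]

end Frobenius

/-! ### The rings 𝔽_{p²}[z]/(P): conjugation, reflection, projections and Chinese remainders -/

section Residue

variable {p : ℕ} [Fact p.Prime]

/-- A polynomial over the prime field, seen over the field with `p ^ 2` elements. -/
abbrev ext (P : (ZMod p)[X]) : (Fq p)[X] := P.map (algebraMap (ZMod p) (Fq p))

/-- The ring `𝔽_{p²}[z] / (P)` for `P` over the prime field. -/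
abbrev Bq (P : (ZMod p)[X]) : Type := AdjoinRoot (ext P)

/-- The image of `z` in `𝔽_{p²}[z] / (P)`. -/
abbrev zq (P : (ZMod p)[X]) : Bq P := AdjoinRoot.root (ext P)

/-- The conjugation of `𝔽_{p²}[z] / (P)` by the Frobenius of the coefficients. -/
def conj (P : (ZMod p)[X]) : Bq P →+* Bq P :=
  AdjoinRoot.map (frob p) _ _ (map_map_algebraMap (frob p) P).symm.dvd

theorem conj_of (P : (ZMod p)[X]) (a : Fq p) :
    conj P (AdjoinRoot.of _ a) = AdjoinRoot.of _ (frob p a) := AdjoinRoot.map_of ..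

theorem conj_root (P : (ZMod p)[X]) : conj P (zq P) = zq P := AdjoinRoot.map_root ..

theorem conj_conj (P : (ZMod p)[X]) (x : Bq P) : conj P (conj P x) = x := by
  have : (conj P).comp (conj P) = RingHom.id _ := by
    apply AdjoinRoot.ringHom_ext
    · ext a
      simp only [RingHom.comp_apply, conj_of, frob_frob, RingHom.id_apply]
    · simp only [RingHom.comp_apply, conj_root, RingHom.id_apply]
  exact RingHom.congr_fun this x

/-- Stability of the roots of `P` under inversion, the inverse being the `(N - 1)`-st power. -/
structure SelfRecip (N : ℕ) (P : (ZMod p)[X]) : Prop where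
  two_le : 2 ≤ N
  dvd_pow : P ∣ X ^ N - 1
  dvd_comp : P ∣ P.comp (X ^ (N - 1))

section Refl

variable {N : ℕ} {P : (ZMod p)[X]}

theorem SelfRecip.root_pow (h : SelfRecip N P) : zq P ^ N = 1 := by
  have := (AdjoinRoot.mk_eq_zero (f := ext P)).2 (Polynomial.map_dvd _ h.dvd_pow)
  simpa [sub_eq_zero] using this

theorem SelfRecip.root_mul (h : SelfRecip N P) : zq P * zq P ^ (N - 1) = 1 := by
  rw [← pow_succ', Nat.sub_add_cancel (by have := h.two_le; omega), h.root_pow]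

/-- This makes z ↦ z⁻¹ well defined: z^(N-1) is again a root, and P has coefficients in the prime
field, which no j can move. -/
theorem SelfRecip.eval₂_eq (h : SelfRecip N P) (j : Fq p →+* Fq p) :
    (ext P).eval₂ ((AdjoinRoot.of (ext P)).comp j) (zq P ^ (N - 1)) = 0 := by
  have h1 := (AdjoinRoot.mk_eq_zero (f := ext P)).2
    (Polynomial.map_dvd (algebraMap (ZMod p) (Fq p)) h.dvd_comp)
  rw [Polynomial.map_comp, Polynomial.map_pow, map_X, ← AdjoinRoot.aeval_eq, aeval_comp,
    map_pow, aeval_X] at h1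
  rw [← Polynomial.eval₂_map, map_map_algebraMap, ← h1]
  rfl

/-- The map of `𝔽_{p²}[z] / (P)` that is `j` on the coefficients and sends `z` to its inverse. -/
def refl (j : Fq p →+* Fq p) (h : SelfRecip N P) : Bq P →+* Bq P :=
  AdjoinRoot.lift ((AdjoinRoot.of _).comp j) (zq P ^ (N - 1)) (h.eval₂_eq j)

theorem refl_of (j : Fq p →+* Fq p) (h : SelfRecip N P) (a : Fq p) :
    refl j h (AdjoinRoot.of _ a) = AdjoinRoot.of _ (j a) := AdjoinRoot.lift_of _

theorem refl_root (j : Fq p →+* Fq p) (h : SelfRecip N P) :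
    refl j h (zq P) = zq P ^ (N - 1) := AdjoinRoot.lift_root _

theorem refl_refl {j : Fq p →+* Fq p} (hj : ∀ a, j (j a) = a) (h : SelfRecip N P) (x : Bq P) :
    refl j h (refl j h x) = x := by
  have : (refl j h).comp (refl j h) = RingHom.id _ := by
    apply AdjoinRoot.ringHom_ext
    · ext a
      simp only [RingHom.comp_apply, refl_of, hj, RingHom.id_apply]
    · simp only [RingHom.comp_apply, refl_root, RingHom.id_apply, map_pow]
      have h1 := h.root_mul
      have h2 : (zq P * zq P ^ (N - 1)) ^ (N - 1) = 1 := by rw [h1, one_pow]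
      rw [mul_pow] at h2
      linear_combination (-(zq P ^ (N - 1)) ^ (N - 1)) * h1 + zq P * h2
  exact RingHom.congr_fun this x

theorem conj_refl {j : Fq p →+* Fq p} (hj : ∀ a, j (frob p a) = frob p (j a))
    (h : SelfRecip N P) (x : Bq P) : conj P (refl j h x) = refl j h (conj P x) := by
  have : (conj P).comp (refl j h) = (refl j h).comp (conj P) := by
    apply AdjoinRoot.ringHom_ext
    · ext a
      simp only [RingHom.comp_apply, refl_of, conj_of, hj]
    · simp only [RingHom.comp_apply, refl_root, conj_root, map_pow]
  exact RingHom.congr_fun this x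

end Refl

section Proj

variable {F P : (ZMod p)[X]}

/-- The projection `𝔽_{p²}[z] / (P) → 𝔽_{p²}[z] / (F)` for `F ∣ P`. -/
def proj (h : F ∣ P) : Bq P →+* Bq F :=
  (AdjoinRoot.algHomOfDvd (Fq p) (ext P) (ext F) (Polynomial.map_dvd _ h)).toRingHom

theorem proj_of (h : F ∣ P) (a : Fq p) :
    proj h (AdjoinRoot.of _ a) = AdjoinRoot.of _ a :=
  (AdjoinRoot.algHomOfDvd (Fq p) (ext P) (ext F) (Polynomial.map_dvd _ h)).commutes a

theorem proj_root (h : F ∣ P) : proj h (zq P) = zq F :=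
  AdjoinRoot.algHomOfDvd_root (ext P) (ext F) (Polynomial.map_dvd _ h)

theorem proj_mk (h : F ∣ P) (q : (Fq p)[X]) :
    proj h (AdjoinRoot.mk _ q) = AdjoinRoot.mk _ q := by
  have : (proj h).comp (AdjoinRoot.mk (ext P)) = AdjoinRoot.mk (ext F) := by
    apply Polynomial.ringHom_ext
    · intro a
      exact proj_of h a
    · exact proj_root h
  exact RingHom.congr_fun this q

theorem proj_conj (h : F ∣ P) (x : Bq P) : proj h (conj P x) = conj F (proj h x) := by
  have : (proj h).comp (conj P) = (conj F).comp (proj h) := by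
    apply AdjoinRoot.ringHom_ext
    · ext a
      simp only [RingHom.comp_apply, proj_of, conj_of]
    · simp only [RingHom.comp_apply, proj_root, conj_root]
  exact RingHom.congr_fun this x

theorem proj_refl (h : F ∣ P) {N : ℕ} (j : Fq p →+* Fq p) (hP : SelfRecip N P)
    (hF : SelfRecip N F) (x : Bq P) : proj h (refl j hP x) = refl j hF (proj h x) := by
  have : (proj h).comp (refl j hP) = (refl j hF).comp (proj h) := by
    apply AdjoinRoot.ringHom_ext
    · ext a
      simp only [RingHom.comp_apply, proj_of, refl_of]
    · simp only [RingHom.comp_apply, proj_root, refl_root, map_pow]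
  exact RingHom.congr_fun this x

theorem proj_formVal (h : F ∣ P) {N : ℕ} (j : Fq p →+* Fq p) (hP : SelfRecip N P)
    (hF : SelfRecip N F) (γ w : Bq P) :
    proj h (formVal (conj P) (refl j hP) γ w) =
      formVal (conj F) (refl j hF) (proj h γ) (proj h w) := by
  simp only [formVal, map_add, map_mul, proj_conj, proj_refl h j hP hF]

end Proj

section Card

theorem finite_Bq {P : (ZMod p)[X]} (hP : P ≠ 0) : Finite (Bq P) := by
  have h : ext P ≠ 0 := (Polynomial.map_ne_zero_iff (algebraMap (ZMod p) (Fq p)).injective).2 hP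
  have := (AdjoinRoot.powerBasis h).finite
  exact Module.finite_of_finite (Fq p)

theorem card_Bq {P : (ZMod p)[X]} (hP : P ≠ 0) : Nat.card (Bq P) = (p ^ 2) ^ P.natDegree := by
  have h : ext P ≠ 0 := (Polynomial.map_ne_zero_iff (algebraMap (ZMod p) (Fq p)).injective).2 hP
  have := (AdjoinRoot.powerBasis h).finite
  rw [Module.natCard_eq_pow_finrank (K := Fq p), (AdjoinRoot.powerBasis h).finrank,
    AdjoinRoot.powerBasis_dim, natDegree_map, card_Fq]

theorem finite_adjoinRoot {P : (ZMod p)[X]} (hP : P ≠ 0) : Finite (AdjoinRoot P) := by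
  have := (AdjoinRoot.powerBasis hP).finite
  exact Module.finite_of_finite (ZMod p)

theorem card_adjoinRoot {P : (ZMod p)[X]} (hP : P ≠ 0) :
    Nat.card (AdjoinRoot P) = p ^ P.natDegree := by
  have := (AdjoinRoot.powerBasis hP).finite
  rw [Module.natCard_eq_pow_finrank (K := ZMod p), (AdjoinRoot.powerBasis hP).finrank,
    AdjoinRoot.powerBasis_dim, Nat.card_zmod]

/-- The inclusion `𝔽_p[z] / (P) → 𝔽_{p²}[z] / (P)`. -/
def incl (P : (ZMod p)[X]) : AdjoinRoot P →+* Bq P :=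
  AdjoinRoot.map (algebraMap (ZMod p) (Fq p)) _ _ dvd_rfl

theorem incl_mk (P q : (ZMod p)[X]) : incl P (AdjoinRoot.mk P q) = AdjoinRoot.mk _ (ext q) := by
  rw [incl, AdjoinRoot.map, AdjoinRoot.lift_mk, ← AdjoinRoot.aeval_eq, aeval_def, eval₂_map]
  rfl

theorem incl_injective (P : (ZMod p)[X]) : Function.Injective (incl P) := by
  rw [injective_iff_map_eq_zero]
  intro a ha
  obtain ⟨q, rfl⟩ := AdjoinRoot.mk_surjective a
  rw [incl_mk, AdjoinRoot.mk_eq_zero, Polynomial.map_dvd_map'] at ha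
  exact AdjoinRoot.mk_eq_zero.2 ha

theorem conj_incl (P : (ZMod p)[X]) (a : AdjoinRoot P) : conj P (incl P a) = incl P a := by
  have : (conj P).comp (incl P) = incl P := by
    apply AdjoinRoot.ringHom_ext
    · exact Subsingleton.elim _ _
    · simp only [RingHom.comp_apply, incl, AdjoinRoot.map_root]
      exact conj_root P
  exact RingHom.congr_fun this a

theorem exists_isUnit_sub_conj (P : (ZMod p)[X]) :
    ∃ α : Fq p, IsUnit (AdjoinRoot.of (ext P) α - conj P (AdjoinRoot.of _ α)) := by
  obtain ⟨α, hα⟩ := exists_frob_ne (p := p)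
  refine ⟨α, ?_⟩
  rw [conj_of, ← map_sub]
  exact (sub_ne_zero.2 hα.symm).isUnit.map _

theorem card_twistedFixed_conj {P : (ZMod p)[X]} (hP : P ≠ 0) {γ : Bq P}
    (hγ : γ * conj P γ = 1) : Nat.card (twistedFixed (conj P) γ) = p ^ P.natDegree := by
  obtain ⟨α, hα⟩ := exists_isUnit_sub_conj P
  have := finite_Bq hP
  have h := card_twistedFixed_sq (conj_conj P) hγ hα
  rw [card_Bq hP, ← pow_mul, mul_comm, pow_mul] at h
  exact Nat.pow_left_injective two_ne_zero h

/-- The inclusion of 𝔽_p[z]/(P) in the fixed ring is injective, and descent shows that both sides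
have p^(deg P) elements. -/
theorem conj_eq_iff {P : (ZMod p)[X]} (hP : P ≠ 0) (y : Bq P) :
    conj P y = y ↔ ∃ a, incl P a = y := by
  refine ⟨fun hy => ?_, ?_⟩
  · have := finite_Bq hP
    let f : AdjoinRoot P → twistedFixed (conj P) 1 := fun a =>
      ⟨incl P a, by rw [mem_twistedFixed, one_mul, conj_incl]⟩
    have hf : Function.Injective f := fun a b hab => incl_injective P (congrArg Subtype.val hab)
    have hb := hf.bijective_of_nat_card_le (by
      rw [card_twistedFixed_conj hP (by simp), card_adjoinRoot hP])
    obtain ⟨a, ha⟩ := hb.2 ⟨y, by rw [mem_twistedFixed, one_mul, hy]⟩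
    exact ⟨a, congrArg Subtype.val ha⟩
  · rintro ⟨a, rfl⟩
    exact conj_incl P a

theorem exists_eq_incl_add {P : (ZMod p)[X]} (hP : P ≠ 0) {α : Fq p} (hα : frob p α ≠ α)
    (y : Bq P) : ∃ a b, y = incl P a + AdjoinRoot.of _ α * incl P b := by
  have hu : IsUnit (AdjoinRoot.of (ext P) α - conj P (AdjoinRoot.of _ α)) := by
    rw [conj_of, ← map_sub]
    exact (sub_ne_zero.2 hα.symm).isUnit.map _
  set A := AdjoinRoot.of (ext P) α
  obtain ⟨c, hc⟩ := hu.exists_left_inv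
  have hτc : conj P c = -c := by
    have h1 : conj P c * (conj P A - A) = 1 := by
      have := congrArg (conj P) hc
      rwa [map_mul, map_sub, conj_conj, map_one] at this
    linear_combination (-conj P c) * hc - c * h1
  have h1 : conj P (c * (y - conj P y)) = c * (y - conj P y) := by
    simp only [map_mul, map_sub, conj_conj, hτc]
    ring
  have h2 : conj P (y - A * (c * (y - conj P y))) = y - A * (c * (y - conj P y)) := by
    rw [map_sub, map_mul (conj P) A, h1]
    linear_combination (y - conj P y) * hc
  obtain ⟨a, ha⟩ := (conj_eq_iff hP _).1 h2
  obtain ⟨b, hb⟩ := (conj_eq_iff hP _).1 h1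
  exact ⟨a, b, by rw [ha, hb]; ring⟩

end Card

section CRT

theorem isUnit_mk_iff {P : (ZMod p)[X]} (q : (Fq p)[X]) :
    IsUnit (AdjoinRoot.mk (ext P) q) ↔ IsCoprime q (ext P) := by
  constructor
  · intro h
    obtain ⟨y, hy⟩ := h.exists_right_inv
    obtain ⟨r, rfl⟩ := AdjoinRoot.mk_surjective y
    rw [← map_mul, ← map_one (AdjoinRoot.mk (ext P)), AdjoinRoot.mk_eq_mk] at hy
    obtain ⟨s, hs⟩ := hy
    exact ⟨r, -s, by linear_combination hs⟩
  · rintro ⟨r, s, h⟩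
    refine IsUnit.of_mul_eq_one (AdjoinRoot.mk _ r) ?_
    rw [← map_mul, ← map_one (AdjoinRoot.mk (ext P)), AdjoinRoot.mk_eq_mk]
    exact ⟨-s, by linear_combination h⟩

/-- A factorization `P = ∏ F ^ m` into powers of pairwise coprime polynomials. -/
structure IsCoprimeFactorization (O : Finset (ZMod p)[X]) (m : ℕ) (P : (ZMod p)[X]) : Prop where
  ne_zero : P ≠ 0
  pos : m ≠ 0
  coprime : Set.Pairwise (O : Set (ZMod p)[X]) IsCoprime
  eq_prod : P = ∏ F ∈ O, F ^ m

variable {O : Finset (ZMod p)[X]} {m : ℕ} {P : (ZMod p)[X]}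

theorem IsCoprimeFactorization.dvd (h : IsCoprimeFactorization O m P) {F : (ZMod p)[X]}
    (hF : F ∈ O) : F ∣ P := by
  rw [h.eq_prod]
  exact (dvd_pow_self F h.pos).trans (Finset.dvd_prod_of_mem _ hF)

theorem IsCoprimeFactorization.ne_zero' (h : IsCoprimeFactorization O m P) {F : (ZMod p)[X]}
    (hF : F ∈ O) : F ≠ 0 := ne_zero_of_dvd_ne_zero h.ne_zero (h.dvd hF)

theorem IsCoprimeFactorization.exists_proj_eq (h : IsCoprimeFactorization O m P)
    (w : ∀ F : O, Bq F.1) : ∃ W : Bq P, ∀ F : O, proj (h.dvd F.2) W = w F := by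
  have hq : ∀ F : O, ∃ q, AdjoinRoot.mk (ext F.1) q = w F :=
    fun F => AdjoinRoot.mk_surjective (w F)
  choose q hq using hq
  have hc : Pairwise (Function.onFun IsCoprime fun F : O => Ideal.span {ext F.1}) := by
    intro F G hFG
    have h1 : IsCoprime (ext F.1) (ext G.1) :=
      (h.coprime F.2 G.2 (fun e => hFG (Subtype.ext e))).map
        (mapRingHom (algebraMap (ZMod p) (Fq p)))
    exact (Ideal.isCoprime_span_singleton_iff _ _).2 h1
  obtain ⟨r, hr⟩ := Ideal.exists_forall_sub_mem_ideal hc q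
  refine ⟨AdjoinRoot.mk _ r, fun F => ?_⟩
  have h2 := Ideal.mem_span_singleton.1 (hr F)
  rw [proj_mk, ← hq F]
  exact AdjoinRoot.mk_eq_mk.2 h2

/-- Units are the classes coprime to P, and coprimality does not see the exponent m. Multiplicities
thus affect the counts only through fibre sizes. -/
theorem IsCoprimeFactorization.isUnit_iff (h : IsCoprimeFactorization O m P) (w : Bq P) :
    IsUnit w ↔ ∀ F : O, IsUnit (proj (h.dvd F.2) w) := by
  obtain ⟨q, rfl⟩ := AdjoinRoot.mk_surjective w
  simp only [proj_mk, isUnit_mk_iff]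
  have he : ext P = ∏ F ∈ O, ext F ^ m := by
    rw [h.eq_prod]
    simp only [Polynomial.map_prod, Polynomial.map_pow]
  rw [he, IsCoprime.prod_right_iff]
  simp only [IsCoprime.pow_right_iff (Nat.pos_of_ne_zero h.pos), Subtype.forall]

theorem IsCoprimeFactorization.pow_eq_zero (h : IsCoprimeFactorization O m P) {w : Bq P}
    (hw : ∀ F : O, proj (h.dvd F.2) w = 0) : w ^ m = 0 := by
  obtain ⟨q, rfl⟩ := AdjoinRoot.mk_surjective w
  have hq : ∀ F ∈ O, ext F ∣ q := fun F hF => by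
    have := hw ⟨F, hF⟩
    rwa [proj_mk, AdjoinRoot.mk_eq_zero] at this
  have h1 : ∏ F ∈ O, ext F ∣ q :=
    Finset.prod_dvd_of_coprime (fun F hF G hG hFG =>
      (h.coprime hF hG hFG).map (mapRingHom (algebraMap (ZMod p) (Fq p)))) hq
  have h2 : ext P ∣ q ^ m := by
    have h3 := pow_dvd_pow_of_dvd h1 m
    rw [← Finset.prod_pow] at h3
    rw [ext, h.eq_prod]
    simpa only [Polynomial.map_prod, Polynomial.map_pow] using h3
  rw [← map_pow]
  exact AdjoinRoot.mk_eq_zero.2 h2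

theorem card_preimage_mul {G H : Type*} [AddCommGroup G] [AddCommGroup H] [Finite G] [Finite H]
    {f : G →+ H} (hf : Function.Surjective f) (S : H → Prop) :
    Nat.card {g // S (f g)} * Nat.card H = Nat.card G * Nat.card {h // S h} := by
  classical
  have := Fintype.ofFinite H
  have hG : Nat.card G = Nat.card f.ker * Nat.card H := by
    rw [← card_ker_mul_card_range f, AddMonoidHom.range_eq_top.2 hf]
    simp
  have e : {g // S (f g)} ≃ {h // S h} × f.ker :=
    { toFun := fun g => (⟨f g, g.2⟩, ⟨g - (hf (f g)).choose, by
        rw [AddMonoidHom.mem_ker, map_sub, (hf (f g)).choose_spec, sub_self]⟩)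
      invFun := fun x => ⟨(hf x.1).choose + x.2, by
        rw [map_add, (hf x.1).choose_spec, x.2.2, add_zero]; exact x.1.2⟩
      left_inv := fun g => Subtype.ext (by simp)
      right_inv := by
        rintro ⟨⟨y, hy⟩, ⟨k, hk⟩⟩
        have hk' : f k = 0 := hk
        have h1 : f ((hf y).choose + k) = y := by
          rw [map_add, (hf y).choose_spec, hk', add_zero]
        simp [h1] }
  rw [Nat.card_congr e, Nat.card_prod, hG]
  ring

theorem card_pi_subtype {ι : Type*} [Fintype ι] {B : ι → Type*} (S : ∀ i, B i → Prop) :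
    Nat.card {w : ∀ i, B i // ∀ i, S i (w i)} = ∏ i, Nat.card {w : B i // S i w} := by
  rw [← Nat.card_pi]
  exact Nat.card_congr Equiv.subtypePiEquivPi

/-- The form commutes with reduction, its unit values are detected on the residue rings, and
reduction onto their product is a surjective homomorphism, so all its fibres have the same size. -/
theorem IsCoprimeFactorization.unitFormCount_mul (h : IsCoprimeFactorization O m P) {N : ℕ}
    (j : Fq p →+* Fq p) (hP : SelfRecip N P) (hO : ∀ F : O, SelfRecip N F.1) (γ : Bq P) :
    unitFormCount (conj P) (refl j hP) γ * ∏ F : O, (p ^ 2) ^ F.1.natDegree =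
      (p ^ 2) ^ P.natDegree *
        ∏ F : O, unitFormCount (conj F.1) (refl j (hO F)) (proj (h.dvd F.2) γ) := by
  have := finite_Bq h.ne_zero
  have := fun F : O => finite_Bq (h.ne_zero' F.2)
  let f : Bq P →+ ∀ F : O, Bq F.1 :=
    (RingHom.pi fun F : O => proj (h.dvd F.2)).toAddMonoidHom
  have hf : Function.Surjective f := fun w => by
    obtain ⟨W, hW⟩ := h.exists_proj_eq w
    exact ⟨W, funext hW⟩
  have key := card_preimage_mul hf (fun w => ∀ F : O, IsUnit
    (formVal (conj F.1) (refl j (hO F)) (proj (h.dvd F.2) γ) (w F)))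
  rw [card_pi_subtype (fun (F : O) (w : Bq F.1) => IsUnit
    (formVal (conj F.1) (refl j (hO F)) (proj (h.dvd F.2) γ) w)), card_Bq h.ne_zero,
    Nat.card_pi, Finset.prod_congr rfl (fun (F : O) _ => card_Bq (h.ne_zero' F.2))] at key
  rw [unitFormCount, ← show _ = Nat.card _ from Nat.card_congr
    (Equiv.subtypeEquivRight fun w => ?_)]
  · exact key
  · rw [h.isUnit_iff]
    refine forall_congr' fun F => ?_
    rw [proj_formVal (h.dvd F.2) j hP (hO F)]
    rfl

theorem exists_add_frob_eq_one : ∃ β : Fq p, β + frob p β = 1 := by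
  obtain ⟨α, hα⟩ := exists_frob_ne (p := p)
  have h1 := sub_ne_zero.2 hα
  have h2 : α - frob p α ≠ 0 := sub_ne_zero.2 hα.symm
  refine ⟨α / (α - frob p α), ?_⟩
  rw [map_div₀, map_sub, frob_frob]
  field_simp
  ring

theorem IsCoprimeFactorization.fixedUnitCount_mul (h : IsCoprimeFactorization O m P) :
    fixedUnitCount (conj P) * ∏ F : O, p ^ F.1.natDegree =
      p ^ P.natDegree * ∏ F : O, fixedUnitCount (conj F.1) := by
  have := finite_Bq h.ne_zero
  have := fun F : O => finite_Bq (h.ne_zero' F.2)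
  let f : twistedFixed (conj P) 1 →+ ∀ F : O, twistedFixed (conj F.1) 1 :=
    { toFun := fun a F => ⟨proj (h.dvd F.2) a, by
        have := a.2
        rw [mem_twistedFixed, one_mul] at this ⊢
        rw [← proj_conj, this]⟩
      map_zero' := by ext; simp
      map_add' := by intros; ext; simp }
  have hf : Function.Surjective f := fun w => by
    obtain ⟨W, hW⟩ := h.exists_proj_eq (fun F => (w F : Bq F.1))
    obtain ⟨β, hβ⟩ := exists_add_frob_eq_one (p := p)
    -- The trace of βW is fixed by conjugation. Since β + frob β = 1, it reduces to the prescribed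
    -- fixed residues.
    refine ⟨⟨AdjoinRoot.of _ β * W + conj P (AdjoinRoot.of _ β * W), ?_⟩, ?_⟩
    · rw [mem_twistedFixed, one_mul, map_add, conj_conj, add_comm]
    · ext F
      change proj (h.dvd F.2) (_ + _) = _
      have hw := (w F).2
      rw [mem_twistedFixed, one_mul] at hw
      rw [map_add, proj_conj, map_mul, hW, proj_of, map_mul, conj_of, hw, ← add_mul, ← map_add,
        hβ, map_one, one_mul]
  have key := card_preimage_mul hf (fun w => ∀ F : O, IsUnit (w F : Bq F.1))
  rw [card_pi_subtype (fun (F : O) (w : twistedFixed (conj F.1) 1) => IsUnit (w : Bq F.1)),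
    card_twistedFixed_conj h.ne_zero (by simp), Nat.card_pi, Finset.prod_congr rfl
      (fun (F : O) _ => card_twistedFixed_conj (h.ne_zero' F.2) (by simp))] at key
  have e : ∀ F : (ZMod p)[X], fixedUnitCount (conj F) =
      Nat.card {w : twistedFixed (conj F) 1 // IsUnit (w : Bq F)} := by
    intro F
    refine Nat.card_congr
      { toFun := fun a => ⟨⟨a, by rw [mem_twistedFixed, one_mul, a.2.1]⟩, a.2.2⟩
        invFun := fun a => ⟨a, by have := a.1.2; rwa [mem_twistedFixed, one_mul] at this, a.2⟩
        left_inv := fun _ => rfl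
        right_inv := fun _ => rfl }
  simp only [e]
  rw [← show _ = Nat.card {w : twistedFixed (conj P) 1 // IsUnit (w : Bq P)} from Nat.card_congr
    (Equiv.subtypeEquivRight fun w => ?_)]
  · exact key
  · rw [h.isUnit_iff]
    rfl

end CRT

end Residue

variable {p : ℕ} [Fact p.Prime]

/-! ### Local count at a self-reciprocal irreducible factor -/

section Irreducible

variable {F : (ZMod p)[X]}

theorem isUnit_of_conj_eq (hF : Irreducible F) (a : Bq F) (ha : conj F a = a) (h0 : a ≠ 0) :
    IsUnit a := by
  have : Fact (Irreducible F) := ⟨hF⟩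
  obtain ⟨b, rfl⟩ := (conj_eq_iff hF.ne_zero a).1 ha
  have : b ≠ 0 := fun h => h0 (by rw [h, map_zero])
  exact this.isUnit.map (incl F)

theorem nontrivial_Bq (hF : Irreducible F) : Nontrivial (Bq F) := by
  have : Fact (Irreducible F) := ⟨hF⟩
  exact (incl_injective F).nontrivial

theorem fixedUnitCount_irreducible (hF : Irreducible F) :
    fixedUnitCount (conj F) = p ^ F.natDegree - 1 := by
  have := finite_Bq hF.ne_zero
  have := nontrivial_Bq hF
  rw [← card_twistedFixed_conj hF.ne_zero (γ := 1) (by simp), ← card_subtype_ne_zero]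
  refine Nat.card_congr
    { toFun := fun a => ⟨⟨a, by rw [mem_twistedFixed, one_mul, a.2.1]⟩, fun h =>
        a.2.2.ne_zero (congrArg Subtype.val h)⟩
      invFun := fun a => ⟨a, by have := a.1.2; rwa [mem_twistedFixed, one_mul] at this,
        isUnit_of_conj_eq hF _ (by have := a.1.2; rwa [mem_twistedFixed, one_mul] at this)
          fun h => a.2 (Subtype.ext h)⟩
      left_inv := fun _ => rfl
      right_inv := fun _ => rfl }

theorem eq_pow_of_sq_eq {Q d : ℕ} (h : Q ^ 2 = p ^ d) : Even d ∧ Q = p ^ (d / 2) := by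
  have hp : p.Prime := Fact.out
  obtain ⟨i, _, rfl⟩ := (Nat.dvd_prime_pow hp).1 (h ▸ dvd_pow_self Q two_ne_zero)
  rw [← pow_mul] at h
  have := Nat.pow_right_injective hp.two_le h
  have h2 : d = 2 * i := by omega
  subst h2
  simp

/-- Inversion of the root is an involution τ of the residue field K of F. It is nontrivial because a
root equal to its inverse would be ±1, forcing degree one. Hence |K| is a square, the degree is
even, and the hermitian count applies with Q = p^(d/2). -/
theorem unitFormCount_selfRecip {N : ℕ} (hF : Irreducible F) (hd : 1 < F.natDegree)
    (h : SelfRecip N F) {j : Fq p →+* Fq p} (hj : ∀ a, j (j a) = a)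
    (hj' : ∀ a, j (frob p a) = frob p (j a)) {γ : Bq F} (hγ : γ * conj F γ = 1)
    (hργ : refl j h γ = γ) :
    Even F.natDegree ∧ unitFormCount (conj F) (refl j h) γ =
      (p ^ F.natDegree - 1) * (p ^ F.natDegree - p ^ (F.natDegree / 2)) := by
  have : Fact (Irreducible F) := ⟨hF⟩
  have := finite_Bq hF.ne_zero
  have := nontrivial_Bq hF
  have := finite_adjoinRoot hF.ne_zero
  obtain ⟨α, hα⟩ := exists_isUnit_sub_conj F
  have hroot : (AdjoinRoot.root F) ^ N = 1 := by
    have := (AdjoinRoot.mk_eq_zero (f := F)).2 h.dvd_pow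
    simpa [sub_eq_zero] using this
  let τ : AdjoinRoot F →+* AdjoinRoot F :=
    AdjoinRoot.lift (AdjoinRoot.of F) (AdjoinRoot.root F ^ (N - 1)) (by
      have h1 := (AdjoinRoot.mk_eq_zero (f := F)).2 h.dvd_comp
      rw [← AdjoinRoot.aeval_eq, aeval_comp, map_pow, aeval_X] at h1
      exact h1)
  have hτroot : τ (AdjoinRoot.root F) = AdjoinRoot.root F ^ (N - 1) := AdjoinRoot.lift_root _
  have hincl : incl F (AdjoinRoot.root F) = zq F := AdjoinRoot.map_root ..
  have hτ : ∀ a, incl F (τ a) = refl j h (incl F a) := by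
    intro a
    have : (incl F).comp τ = (refl j h).comp (incl F) := by
      apply AdjoinRoot.ringHom_ext
      · exact Subsingleton.elim _ _
      · simp only [RingHom.comp_apply, hτroot, map_pow, hincl, refl_root]
    exact RingHom.congr_fun this a
  have hττ : ∀ a, τ (τ a) = a := fun a =>
    incl_injective F (by rw [hτ, hτ, refl_refl hj])
  have hβ : τ (AdjoinRoot.root F) ≠ AdjoinRoot.root F := by
    intro heq
    rw [hτroot] at heq
    have h1 : AdjoinRoot.root F * AdjoinRoot.root F = 1 := by
      nth_rewrite 2 [← heq]
      rw [← pow_succ', Nat.sub_add_cancel (by have := h.two_le; omega), hroot]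
    rcases mul_self_eq_one_iff.1 h1 with h2 | h2
    · have h3 : F ∣ X - C 1 := by
        rw [← AdjoinRoot.mk_eq_zero]
        simp [h2]
      have := natDegree_le_of_dvd h3 (X_sub_C_ne_zero _)
      rw [natDegree_X_sub_C] at this
      omega
    · have h3 : F ∣ X - C (-1) := by
        rw [← AdjoinRoot.mk_eq_zero]
        simp [h2]
      have := natDegree_le_of_dvd h3 (X_sub_C_ne_zero _)
      rw [natDegree_X_sub_C] at this
      omega
  have hhalf := card_twistedFixed_sq hττ (γ := 1) (by simp)
    (sub_ne_zero.2 hβ.symm).isUnit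
  rw [card_adjoinRoot hF.ne_zero] at hhalf
  obtain ⟨he, hQ⟩ := eq_pow_of_sq_eq hhalf
  refine ⟨he, ?_⟩
  rw [hQ] at hhalf
  rw [← hhalf]
  refine unitFormCount_hermitian (conj_conj F) (refl_refl hj h) (conj_refl hj' h) hα hγ hργ
    (conj_eq_iff hF.ne_zero) hτ hβ ?_ ?_
  · rw [card_adjoinRoot hF.ne_zero, hhalf]
  · rw [card_Bq hF.ne_zero, hhalf, ← pow_mul, ← pow_mul, mul_comm]

end Irreducible

/-! ### Local count at a pair of reciprocal factors -/

section Pair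

theorem refl_mk_ext {N : ℕ} {P : (ZMod p)[X]} (j : Fq p →+* Fq p) (h : SelfRecip N P)
    (q : (ZMod p)[X]) : refl j h (AdjoinRoot.mk _ (ext q)) =
      AdjoinRoot.mk _ (ext (q.comp (X ^ (N - 1)))) := by
  have hext : ext (q.comp (X ^ (N - 1))) = (ext q).comp (X ^ (N - 1)) := by
    simp only [ext, Polynomial.map_comp, Polynomial.map_pow, map_X]
  rw [refl, AdjoinRoot.lift_mk, ← Polynomial.eval₂_map, map_map_algebraMap, hext,
    ← AdjoinRoot.aeval_eq, aeval_comp, map_pow, aeval_X]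
  rfl

variable {N : ℕ} {e e' : (ZMod p)[X]}

/-- Reflection exchanges the components at e and e'. Reducing w and its reflection modulo e is thus
the Chinese remainder theorem, written with two copies of the same ring. -/
theorem pair_bijective (he : e ≠ 0) (hcop : IsCoprime e e') (hdeg : e'.natDegree = e.natDegree)
    (hdvd : e' ∣ e.comp (X ^ (N - 1))) (he' : e' ≠ 0) (h : SelfRecip N (e * e'))
    {j : Fq p →+* Fq p} (hj : ∀ a, j (j a) = a) :
    Function.Bijective ((proj (dvd_mul_right e e')).prod
      ((proj (dvd_mul_right e e')).comp (refl j h))) := by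
  have hne : e * e' ≠ 0 := mul_ne_zero he he'
  have := finite_Bq he
  have := finite_Bq hne
  refine Function.Injective.bijective_of_nat_card_le ?_ ?_
  · rw [injective_iff_map_eq_zero]
    intro w hw
    have h1 : proj (dvd_mul_right e e') w = 0 := congrArg Prod.fst hw
    have h2 : proj (dvd_mul_right e e') (refl j h w) = 0 := congrArg Prod.snd hw
    obtain ⟨q, rfl⟩ := AdjoinRoot.mk_surjective w
    rw [proj_mk, AdjoinRoot.mk_eq_zero] at h1
    obtain ⟨r, hr⟩ := AdjoinRoot.mk_surjective (refl j h (AdjoinRoot.mk (ext (e * e')) q))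
    rw [← hr, proj_mk, AdjoinRoot.mk_eq_zero] at h2
    -- If e divides the reflection of w, then reflecting back turns e into e(z^(N-1)), which e'
    -- divides. So w vanishes modulo e'.
    have h3 : proj (dvd_mul_left e' e) (AdjoinRoot.mk (ext (e * e')) q) = 0 := by
      rw [← refl_refl hj h (AdjoinRoot.mk (ext (e * e')) q), ← hr]
      obtain ⟨s, rfl⟩ := h2
      rw [map_mul, map_mul, refl_mk_ext, map_mul, proj_mk,
        AdjoinRoot.mk_eq_zero.2 (Polynomial.map_dvd _ hdvd), zero_mul]
    rw [proj_mk, AdjoinRoot.mk_eq_zero] at h3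
    rw [AdjoinRoot.mk_eq_zero, ext, Polynomial.map_mul]
    exact IsCoprime.mul_dvd (hcop.map (mapRingHom (algebraMap (ZMod p) (Fq p)))) h1 h3
  · rw [Nat.card_prod, card_Bq he, card_Bq hne, natDegree_mul he he', hdeg, pow_add]

/-- In these coordinates w is an arbitrary pair (w₁, w₂) and wρ(w) has first component w₁w₂, so the
count is that of the bilinear pairing. -/
theorem unitFormCount_pair (he : Irreducible e) (hcop : IsCoprime e e')
    (hdeg : e'.natDegree = e.natDegree) (hdvd : e' ∣ e.comp (X ^ (N - 1))) (he' : e' ≠ 0)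
    (h : SelfRecip N (e * e')) {j : Fq p →+* Fq p} (hj : ∀ a, j (j a) = a)
    (hj' : ∀ a, j (frob p a) = frob p (j a)) {γ : Bq (e * e')}
    (hγ : γ * conj _ γ = 1) (hργ : refl j h γ = γ) :
    unitFormCount (conj _) (refl j h) γ =
      ((p ^ e.natDegree) ^ 2 - 1) * ((p ^ e.natDegree) ^ 2 - p ^ e.natDegree) := by
  have hb := pair_bijective he.ne_zero hcop hdeg hdvd he' h hj
  set φ := proj (dvd_mul_right e e') with hφ
  let Ψ := RingEquiv.ofBijective _ hb
  have hΨ : ∀ x, Ψ x = (φ x, φ (refl j h x)) := fun x => rfl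
  have := finite_Bq he.ne_zero
  have := nontrivial_Bq he
  obtain ⟨α, hα⟩ := exists_isUnit_sub_conj e
  rw [← card_isUnit_pairing (conj_conj e) hα (γ := φ γ) (by
    rw [← proj_conj, ← map_mul, hγ, map_one]) (isUnit_of_conj_eq he)
    (by rw [card_Bq he.ne_zero, ← pow_mul, ← pow_mul, mul_comm])]
  refine Nat.card_congr (Equiv.subtypeEquiv Ψ.toEquiv fun w => ?_)
  -- The value is invariant under reflection, so its two components agree and one unit condition
  -- suffices.
  have hfix : refl j h (formVal (conj _) (refl j h) γ w) = formVal (conj _) (refl j h) γ w := by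
    simp only [formVal, map_add, map_mul, hργ, refl_refl hj, ← conj_refl hj']
    ring
  rw [← isUnit_map_iff Ψ, Prod.isUnit_iff, hΨ, hfix, and_self]
  simp only [formVal, map_add, map_mul, hφ, proj_conj]
  rfl

theorem fixedUnitCount_pair (he : Irreducible e) (hcop : IsCoprime e e')
    (hdeg : e'.natDegree = e.natDegree) (hdvd : e' ∣ e.comp (X ^ (N - 1))) (he' : e' ≠ 0)
    (h : SelfRecip N (e * e')) :
    fixedUnitCount (conj (e * e')) = (p ^ e.natDegree - 1) ^ 2 := by
  have hb := pair_bijective he.ne_zero hcop hdeg hdvd he' h (j := RingHom.id _) (fun _ => rfl)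
  set φ := proj (dvd_mul_right e e') with hφ
  let Ψ := RingEquiv.ofBijective _ hb
  have hΨ : ∀ x, Ψ x = (φ x, φ (refl _ h x)) := fun x => rfl
  rw [← fixedUnitCount_irreducible he, sq, fixedUnitCount, fixedUnitCount, ← Nat.card_prod]
  refine Nat.card_congr ((Equiv.subtypeEquiv Ψ.toEquiv (q := fun y =>
    (conj e y.1 = y.1 ∧ IsUnit y.1) ∧ (conj e y.2 = y.2 ∧ IsUnit y.2)) fun w => ?_).trans
      (Equiv.subtypeProdEquivProd (p := fun y => conj e y = y ∧ IsUnit y)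
        (q := fun y => conj e y = y ∧ IsUnit y)))
  have h1 : conj (e * e') w = w ↔ conj e (Ψ w).1 = (Ψ w).1 ∧ conj e (Ψ w).2 = (Ψ w).2 := by
    rw [← Ψ.injective.eq_iff, Prod.ext_iff]
    simp only [hΨ, hφ]
    rw [← conj_refl (j := RingHom.id _) (fun _ => rfl), proj_conj, proj_conj]
  have h2 : IsUnit w ↔ IsUnit (Ψ w).1 ∧ IsUnit (Ψ w).2 := by
    rw [← isUnit_map_iff Ψ, Prod.isUnit_iff]
  rw [h1, h2]
  exact and_and_and_comm

end Pair

/-! ### Local count at the factors z - 1 and z + 1 -/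

section Linear

theorem unitFormCount_congr {E E' : Type*} [CommRing E] [CommRing E'] (φ : E ≃+* E')
    {θ ρ : E →+* E} {θ' ρ' : E' →+* E'} (hθ : ∀ x, φ (θ x) = θ' (φ x))
    (hρ : ∀ x, φ (ρ x) = ρ' (φ x)) (γ : E) :
    unitFormCount θ ρ γ = unitFormCount θ' ρ' (φ γ) := by
  refine Nat.card_congr (Equiv.subtypeEquiv φ.toEquiv fun w => ?_)
  rw [← isUnit_map_iff φ]
  simp only [formVal, map_add, map_mul, hθ, hρ]
  rfl

theorem isUnit_frob_sub : ∃ α : Fq p, IsUnit (α - frob p α) := by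
  obtain ⟨α, hα⟩ := exists_frob_ne (p := p)
  exact ⟨α, (sub_ne_zero.2 hα.symm).isUnit⟩

theorem card_twistedFixed_frob {γ : Fq p} (hγ : γ * frob p γ = 1) :
    Nat.card (twistedFixed (frob p) γ) = p := by
  obtain ⟨α, hα⟩ := isUnit_frob_sub (p := p)
  have := card_twistedFixed_sq frob_frob hγ hα
  rw [card_Fq] at this
  exact Nat.pow_left_injective two_ne_zero this

theorem eq_zero_of_mem_twistedFixed_frob {γ : Fq p} (hγ : γ * frob p γ ≠ 1) {y : Fq p}
    (hy : γ * frob p y = y) : y = 0 := by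
  have h1 := congrArg (frob p) hy
  rw [map_mul, frob_frob] at h1
  have h2 : (γ * frob p γ - 1) * y = 0 := by linear_combination γ * h1 + hy
  exact (mul_eq_zero.1 h2).resolve_left (sub_ne_zero.2 hγ)

open Classical in
-- The norm w·frob(w) is fixed by Frobenius, so the form is 1 + γ times the norm: either identically
-- zero or nonzero off the origin.
theorem unitFormCount_frob_frob (γ : Fq p) :
    unitFormCount (frob p) (frob p) γ = if 1 + γ = 0 then 0 else p ^ 2 - 1 := by
  have hval : ∀ w : Fq p, formVal (frob p) (frob p) γ w = (1 + γ) * (w * frob p w) := by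
    intro w
    rw [formVal, map_mul, frob_frob]
    ring
  rw [unitFormCount]
  split_ifs with h
  · rw [Nat.card_eq_zero]
    left
    refine ⟨fun ⟨w, hw⟩ => ?_⟩
    rw [hval, h, zero_mul] at hw
    exact not_isUnit_zero hw
  · rw [← card_Fq, ← card_subtype_ne_zero]
    refine Nat.card_congr (Equiv.subtypeEquivRight fun w => ?_)
    rw [hval, isUnit_iff_ne_zero]
    simp [h]

theorem unitFormCount_id_eq (γ : Fq p) : unitFormCount (frob p) (RingHom.id _) γ =
    p ^ 2 - Nat.card {w : Fq p // w * w + γ * frob p (w * w) = 0} := by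
  rw [← card_Fq, ← card_subtype_not]
  refine Nat.card_congr (Equiv.subtypeEquivRight fun w => ?_)
  rw [isUnit_iff_ne_zero]
  rfl

/-- In characteristic 2 the form is the square of the additive map u·frob(w) - w. The zeros of that
map form a twisted line of 2 elements out of 4. -/
theorem unitFormCount_id_two {u : Fq 2} (hu : u * frob 2 u = 1) :
    unitFormCount (frob 2) (RingHom.id _) (u * u) = 2 := by
  have h1 : ∀ w : Fq 2, w * w + u * u * frob 2 (w * w) = 0 ↔ u * frob 2 w = w := by
    intro w
    have h2 : (2 : Fq 2) = 0 := by exact_mod_cast CharP.cast_eq_zero (Fq 2) 2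
    rw [map_mul, show w * w + u * u * (frob 2 w * frob 2 w) = (u * frob 2 w - w) ^ 2 by
      linear_combination (u * frob 2 w * w) * h2, sq_eq_zero_iff, sub_eq_zero]
  rw [unitFormCount_id_eq, Nat.card_congr (Equiv.subtypeEquivRight h1)]
  have : Nat.card {w : Fq 2 // u * frob 2 w = w} = 2 := card_twistedFixed_frob hu
  rw [this]
  norm_num

open Classical in
-- With i² = -1 in 𝔽_{p²} the form factors into the semilinear maps ±iu·frob(w) - w. If iu has norm
-- 1, their kernels are two lines of p elements meeting in 0, which leaves p² - (2p - 1) = (p - 1)²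
-- vectors. Otherwise both kernels are trivial and the form is anisotropic.
theorem unitFormCount_id_odd (hp : p ≠ 2) {u η : Fq p} (hu : u * frob p u = η)
    (hη : η = 1 ∨ η = -1) :
    unitFormCount (frob p) (RingHom.id _) (u * u) =
      if (-1) ^ ((p + 1) / 2) = η then (p - 1) * (p - 1) else (p - 1) * (p + 1) := by
  have hpp : p.Prime := Fact.out
  have hodd := hpp.odd_of_ne_two hp
  have hp1 := hpp.one_lt
  have := Fintype.ofFinite (Fq p)
  have h2 : (2 : Fq p) ≠ 0 := by
    intro h
    have := (CharP.cast_eq_zero_iff (Fq p) p 2).1 (by exact_mod_cast h)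
    exact hp ((Nat.prime_dvd_prime_iff_eq hpp Nat.prime_two).1 this)
  obtain ⟨i, hi⟩ : IsSquare (-1 : Fq p) := by
    rw [FiniteField.isSquare_neg_one_iff, ← Nat.card_eq_fintype_card, card_Fq, Nat.pow_mod]
    obtain ⟨r, rfl⟩ := hodd
    have : (2 * r + 1) % 4 = 1 ∨ (2 * r + 1) % 4 = 3 := by omega
    rcases this with h | h <;> rw [h] <;> norm_num
  -- The norm of i is i^(p+1) = (i²)^((p+1)/2), which is where the sign in the final formulas comes
  -- from.
  have hfi : i * frob p i = (-1) ^ ((p + 1) / 2) := by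
    rw [frobenius_def, ← pow_succ', hi, ← sq, ← pow_mul]
    congr 1
    obtain ⟨r, rfl⟩ := hodd
    omega
  have hfac : ∀ w : Fq p, w * w + u * u * frob p (w * w) = 0 ↔
      (i * u) * frob p w = w ∨ (-(i * u)) * frob p w = w := by
    intro w
    rw [map_mul, show w * w + u * u * (frob p w * frob p w) =
      ((i * u) * frob p w - w) * ((-(i * u)) * frob p w - w) by
        linear_combination (-(u * u * (frob p w * frob p w))) * hi, mul_eq_zero, sub_eq_zero,
      sub_eq_zero]
  have hn1 : (i * u) * frob p (i * u) = (-1) ^ ((p + 1) / 2) * η := by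
    rw [← hfi, ← hu, map_mul]; ring
  have hn2 : (-(i * u)) * frob p (-(i * u)) = (-1) ^ ((p + 1) / 2) * η := by
    rw [← hn1, map_neg]; ring
  have hηη : η * η = 1 := by rcases hη with rfl | rfl <;> ring
  have hiff : (-1 : Fq p) ^ ((p + 1) / 2) * η = 1 ↔ (-1 : Fq p) ^ ((p + 1) / 2) = η := by
    constructor
    · intro h
      linear_combination η * h - (-1) ^ ((p + 1) / 2) * hηη
    · intro h
      rw [h, hηη]
  rw [unitFormCount_id_eq, Nat.card_congr (Equiv.subtypeEquivRight hfac)]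
  split_ifs with hc
  · have hc' := hiff.2 hc
    have c1 := card_twistedFixed_frob (hn1.trans hc')
    have c2 := card_twistedFixed_frob (hn2.trans hc')
    have hset : {w : Fq p | (i * u) * frob p w = w ∨ (-(i * u)) * frob p w = w} =
        (twistedFixed (frob p) (i * u) : Set (Fq p)) ∪ twistedFixed (frob p) (-(i * u)) := rfl
    have hinter : ((twistedFixed (frob p) (i * u) : Set (Fq p)) ∩
        twistedFixed (frob p) (-(i * u))) = {0} := by
      ext w
      simp only [Set.mem_inter_iff, SetLike.mem_coe, mem_twistedFixed, Set.mem_singleton_iff]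
      constructor
      · rintro ⟨e1, e2⟩
        have : 2 * w = 0 := by linear_combination -e1 - e2
        exact (mul_eq_zero.1 this).resolve_left h2
      · rintro rfl
        simp
    have h3 := Set.ncard_union_add_ncard_inter (twistedFixed (frob p) (i * u) : Set (Fq p))
      (twistedFixed (frob p) (-(i * u)))
    rw [hinter, Set.ncard_singleton, ← hset] at h3
    change _ + 1 = Nat.card (twistedFixed (frob p) (i * u)) +
      Nat.card (twistedFixed (frob p) (-(i * u))) at h3
    rw [c1, c2] at h3
    change p ^ 2 - Set.ncard {w : Fq p | (i * u) * frob p w = w ∨ (-(i * u)) * frob p w = w} = _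
    have h4 : Set.ncard {w : Fq p | (i * u) * frob p w = w ∨ (-(i * u)) * frob p w = w} =
        2 * p - 1 := by omega
    rw [h4]
    obtain ⟨r, rfl⟩ : ∃ r, p = r + 1 := ⟨p - 1, by omega⟩
    rw [Nat.add_sub_cancel]
    have : (r + 1) ^ 2 = r * r + (2 * (r + 1) - 1) := by
      rw [show 2 * (r + 1) - 1 = 2 * r + 1 by omega]; ring
    omega
  · have hc' := fun h => hc (hiff.1 h)
    have h5 : ∀ w : Fq p, ((i * u) * frob p w = w ∨ (-(i * u)) * frob p w = w) ↔ w = 0 := by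
      intro w
      constructor
      · rintro (h | h)
        · exact eq_zero_of_mem_twistedFixed_frob (by rwa [hn1]) h
        · exact eq_zero_of_mem_twistedFixed_frob (by rwa [hn2]) h
      · rintro rfl
        simp
    rw [Nat.card_congr (Equiv.subtypeEquivRight h5)]
    simp only [Nat.card_unique]
    rw [mul_comm, ← Nat.sq_sub_sq, one_pow]

theorem of_bijective_linear (η : ZMod p) :
    Function.Bijective (AdjoinRoot.of (ext (X - C η : (ZMod p)[X]))) := by
  have hne : (X - C η : (ZMod p)[X]) ≠ 0 := X_sub_C_ne_zero η
  have := finite_Bq hne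
  have : Nontrivial (Bq (X - C η : (ZMod p)[X])) := nontrivial_Bq (irreducible_X_sub_C η)
  refine (AdjoinRoot.of (ext (X - C η : (ZMod p)[X]))).injective.bijective_of_nat_card_le ?_
  rw [card_Bq hne, card_Fq, natDegree_X_sub_C, pow_one]

theorem zq_linear (η : ZMod p) : zq (X - C η : (ZMod p)[X]) =
    AdjoinRoot.of _ (algebraMap (ZMod p) (Fq p) η) := by
  have hext : ext (X - C η : (ZMod p)[X]) = X - C (algebraMap (ZMod p) (Fq p) η) := by
    simp only [ext, Polynomial.map_sub, map_X, map_C]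
  have h := (AdjoinRoot.mk_eq_zero (f := ext (X - C η : (ZMod p)[X]))).2 hext.dvd
  rwa [map_sub, AdjoinRoot.mk_X, AdjoinRoot.mk_C, sub_eq_zero] at h

theorem exists_unitFormCount_linear {N : ℕ} (η : ZMod p) (h : SelfRecip N (X - C η : (ZMod p)[X]))
    (j : Fq p →+* Fq p) (u : Bq (X - C η : (ZMod p)[X])) (hu : u * conj _ u = zq _) :
    ∃ u₀ : Fq p, u₀ * frob p u₀ = algebraMap (ZMod p) (Fq p) η ∧
      unitFormCount (conj _) (refl j h) (u * refl j h u) =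
        unitFormCount (frob p) j (u₀ * j u₀) := by
  have hb := of_bijective_linear η
  obtain ⟨u₀, rfl⟩ := hb.2 u
  refine ⟨u₀, ?_, ?_⟩
  · rw [conj_of, ← map_mul, zq_linear] at hu
    exact hb.1 hu
  · rw [unitFormCount_congr (RingEquiv.ofBijective _ hb) (θ' := conj _) (ρ' := refl j h)]
    · simp only [RingEquiv.coe_ofBijective, map_mul, refl_of]
    · intro x
      simp only [RingEquiv.coe_ofBijective, conj_of]
    · intro x
      simp only [RingEquiv.coe_ofBijective, refl_of]

end Linear

/-! ### Solving u·conj(u) = z -/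

section Norm

/-- In characteristic 2 the root has a square root in the residue field, and conjugation fixes it.
In odd characteristic take δ with conjugate -δ: then a + δb has norm a² - δ²b², and such a binary
form over a finite field represents every element. -/
theorem exists_norm_eq_root_of_irreducible {F : (ZMod p)[X]} (hF : Irreducible F) :
    ∃ y : Bq F, y * conj F y = zq F := by
  have : Fact (Irreducible F) := ⟨hF⟩
  have := finite_adjoinRoot hF.ne_zero
  have := Fintype.ofFinite (AdjoinRoot F)
  have := nontrivial_Bq hF
  have hincl : incl F (AdjoinRoot.root F) = zq F := AdjoinRoot.map_root ..
  have hpp : p.Prime := Fact.out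
  have hchar : CharP (AdjoinRoot F) p :=
    charP_of_injective_algebraMap (algebraMap (ZMod p) (AdjoinRoot F)).injective p
  by_cases hp : p = 2
  · obtain ⟨a, ha⟩ := FiniteField.isSquare_of_char_two
      (by rw [ringChar.eq (AdjoinRoot F) p, hp]) (AdjoinRoot.root F)
    exact ⟨incl F a, by rw [conj_incl, ← map_mul, ← ha, hincl]⟩
  · obtain ⟨α, hα⟩ := exists_frob_ne (p := p)
    set δ := α - frob p α
    have hδ : δ ≠ 0 := sub_ne_zero.2 hα.symm
    have hfδ : frob p δ = -δ := by
      simp only [δ, map_sub, frob_frob]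
      ring
    obtain ⟨ν, hν⟩ := (conj_eq_iff hF.ne_zero (AdjoinRoot.of _ (δ * δ))).1
      (by rw [conj_of, map_mul, hfδ]; congr 1; ring)
    have hν0 : ν ≠ 0 := by
      rintro rfl
      rw [map_zero] at hν
      exact mul_ne_zero hδ hδ ((map_eq_zero _).1 hν.symm)
    obtain ⟨a, b, hab⟩ := FiniteField.exists_root_sum_quadratic
      (f := (X ^ 2 : (AdjoinRoot F)[X]))
      (g := C (-ν) * X ^ 2 + C 0 * X + C (-AdjoinRoot.root F)) (degree_X_pow 2)
      (degree_quadratic (neg_ne_zero.2 hν0)) (by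
        rw [← Nat.card_eq_fintype_card, card_adjoinRoot hF.ne_zero, ← Nat.odd_iff]
        exact (hpp.odd_of_ne_two hp).pow)
    simp only [eval_pow, eval_X, eval_add, eval_mul, eval_C] at hab
    refine ⟨incl F a + AdjoinRoot.of _ δ * incl F b, ?_⟩
    have h1 := congrArg (incl F) hab
    simp only [map_add, map_mul, map_pow, map_neg, map_zero, hν, hincl] at h1
    simp only [map_add, map_mul, conj_incl, conj_of, hfδ, map_neg]
    linear_combination h1

/-- Newton iteration. For B of trace 1, the norm M of 1 + Br is 1 + r + B·conj(B)·r². Hence (1 +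
r)/M differs from 1 by a multiple of r², and the nilpotency exponent is halved. -/
theorem exists_norm_eq_one_add (P : (ZMod p)[X]) (n : ℕ) :
    ∀ r : Bq P, conj P r = r → r ^ 2 ^ n = 0 → ∃ v, v * conj P v = 1 + r := by
  induction n with
  | zero =>
    intro r _ h0
    rw [pow_zero, pow_one] at h0
    exact ⟨1, by simp [h0]⟩
  | succ n ih =>
    intro r hr h0
    obtain ⟨β, hβ⟩ := exists_add_frob_eq_one (p := p)
    set B := AdjoinRoot.of (ext P) β
    have hB : B + conj P B = 1 := by
      rw [conj_of, ← map_add, hβ, map_one]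
    set M := (1 + B * r) * (1 + conj P B * r) with hM
    have hM' : M = 1 + r * (1 + B * conj P B * r) := by
      linear_combination r * hB
    have hMu : IsUnit M := by
      rw [hM']
      exact IsNilpotent.isUnit_one_add (Commute.isNilpotent_mul_right (Commute.all _ _) ⟨_, h0⟩)
    obtain ⟨c, hc⟩ := hMu.exists_left_inv
    have hcM : conj P M = M := by
      simp only [hM, map_mul, map_add, map_one, hr, conj_conj]
      ring
    have hcc : conj P c = c := by
      have h1 := congrArg (conj P) hc
      rw [map_mul, hcM, map_one] at h1
      linear_combination c * h1 - conj P c * hc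
    obtain ⟨v, hv⟩ := ih (-(B * conj P B * c) * r ^ 2)
      (by simp only [map_mul, map_neg, map_pow, hr, hcc, conj_conj]; ring)
      (by rw [mul_pow, ← pow_mul r, ← pow_succ', h0, mul_zero])
    refine ⟨(1 + B * r) * v, ?_⟩
    simp only [map_mul, map_add, map_one, hr]
    linear_combination M * hv - B * conj P B * r ^ 2 * hc + hM'

theorem exists_norm_eq_root {I : Finset (ZMod p)[X]} {m : ℕ} {P : (ZMod p)[X]}
    (h : IsCoprimeFactorization I m P) (hI : ∀ F ∈ I, Irreducible F) (hz : IsUnit (zq P)) :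
    ∃ u : Bq P, u * conj P u = zq P := by
  choose y hy using fun F : I => exists_norm_eq_root_of_irreducible (hI F.1 F.2)
  obtain ⟨u₀, hu₀⟩ := h.exists_proj_eq y
  obtain ⟨c, hc⟩ := hz.exists_left_inv
  have hcc : conj P c = c := by
    have h1 := congrArg (conj P) hc
    rw [map_mul, conj_root, map_one] at h1
    linear_combination c * h1 - conj P c * hc
  have hnil : (u₀ * conj P u₀ - zq P) ^ m = 0 := by
    apply h.pow_eq_zero
    intro F
    rw [map_sub, map_mul, proj_conj, hu₀, proj_root, hy, sub_self]
  -- With c = z⁻¹, the lift u₀ of the residual solutions has u₀·conj(u₀)/z equal to 1 plus a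
  -- nilpotent. That quotient is the norm of some v, and u₀/v is the solution.
  obtain ⟨v, hv⟩ := exists_norm_eq_one_add P m (c * (u₀ * conj P u₀ - zq P))
    (by simp only [map_mul, map_sub, hcc, conj_conj, conj_root]; ring)
    (by
      rw [mul_pow, pow_eq_zero_of_le (Nat.lt_two_pow_self (n := m)).le hnil, mul_zero])
  have hvu : IsUnit v := by
    refine isUnit_of_mul_isUnit_left (y := conj P v) ?_
    rw [hv]
    exact IsNilpotent.isUnit_one_add (Commute.isNilpotent_mul_left (Commute.all _ _) ⟨m, hnil⟩)
  obtain ⟨d, hd⟩ := hvu.exists_left_inv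
  refine ⟨u₀ * d, ?_⟩
  have hd' : conj P d * conj P v = 1 := by rw [← map_mul, hd, map_one]
  have h1 : zq P * (v * conj P v) = u₀ * conj P u₀ := by
    rw [hv]
    linear_combination (u₀ * conj P u₀ - zq P) * hc
  rw [map_mul]
  linear_combination (-d * conj P d) * h1 + zq P * conj P d * conj P v * hd + zq P * hd'

end Norm

variable {p : ℕ} [Fact p.Prime]

/-! ### Reciprocal polynomials -/

section Reciprocal

theorem natDegree_reverse_of_coeff_zero_ne {f : (ZMod p)[X]} (h : f.coeff 0 ≠ 0) :
    f.reverse.natDegree = f.natDegree := by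
  rw [reverse_natDegree, natTrailingDegree_eq_zero.2 (Or.inr h), Nat.sub_zero]

theorem reverse_reverse_of_coeff_zero_ne {f : (ZMod p)[X]} (h : f.coeff 0 ≠ 0) :
    f.reverse.reverse = f := by
  ext n
  rw [coeff_reverse, coeff_reverse, natDegree_reverse_of_coeff_zero_ne h, revAt_invol]

theorem coeff_zero_monicReciprocal (f : (ZMod p)[X]) :
    (monicReciprocal f).coeff 0 = (f.coeff 0)⁻¹ * f.leadingCoeff := by
  rw [monicReciprocal, coeff_C_mul, coeff_zero_reverse]

theorem natDegree_monicReciprocal {f : (ZMod p)[X]} (h : f.coeff 0 ≠ 0) :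
    (monicReciprocal f).natDegree = f.natDegree := by
  rw [monicReciprocal, natDegree_C_mul (inv_ne_zero h), natDegree_reverse_of_coeff_zero_ne h]

theorem monic_monicReciprocal {f : (ZMod p)[X]} (h : f.coeff 0 ≠ 0) :
    (monicReciprocal f).Monic := by
  rw [Monic, monicReciprocal, leadingCoeff_mul, leadingCoeff_C, reverse_leadingCoeff,
    trailingCoeff_eq_coeff_zero h, inv_mul_cancel₀ h]

theorem monicReciprocal_monicReciprocal {f : (ZMod p)[X]} (hm : f.Monic) (h : f.coeff 0 ≠ 0) :
    monicReciprocal (monicReciprocal f) = f := by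
  rw [monicReciprocal, coeff_zero_monicReciprocal, hm.leadingCoeff, mul_one, inv_inv,
    monicReciprocal, reverse_mul_of_domain, reverse_C, reverse_reverse_of_coeff_zero_ne h,
    ← mul_assoc, ← C_mul, mul_inv_cancel₀ h, C_1, one_mul]

theorem associated_reverse {f : (ZMod p)[X]} (h : f.coeff 0 ≠ 0) :
    Associated f.reverse (monicReciprocal f) := by
  rw [monicReciprocal, mul_comm]
  exact associated_mul_unit_right _ _ (isUnit_C.2 (inv_ne_zero h).isUnit)

theorem irreducible_monicReciprocal {f : (ZMod p)[X]} (hf : Irreducible f) (h : f.coeff 0 ≠ 0) :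
    Irreducible (monicReciprocal f) := by
  rw [← (associated_reverse h).irreducible_iff]
  have key : ∀ a : (ZMod p)[X], a.coeff 0 ≠ 0 → IsUnit a.reverse → IsUnit a := by
    intro a ha hu
    have h1 := natDegree_eq_zero_of_isUnit hu
    rw [natDegree_reverse_of_coeff_zero_ne ha] at h1
    rw [eq_C_of_natDegree_eq_zero h1]
    exact isUnit_C.2 ha.isUnit
  refine ⟨fun hu => hf.not_isUnit (key f h hu), fun a b hab => ?_⟩
  have h0 : a.coeff 0 * b.coeff 0 ≠ 0 := by
    rw [← mul_coeff_zero, ← hab, coeff_zero_reverse]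
    exact leadingCoeff_ne_zero.2 hf.ne_zero
  have h1 : f = a.reverse * b.reverse := by
    rw [← reverse_mul_of_domain, ← hab, reverse_reverse_of_coeff_zero_ne h]
  exact (hf.isUnit_or_isUnit h1).imp (key a (left_ne_zero_of_mul h0))
    (key b (right_ne_zero_of_mul h0))

/-- At a root x of G, the reverse of f is f(x⁻¹) up to a power of x, and x⁻¹ = x^(N-1) because x^N =
1. -/
theorem dvd_comp_of_dvd_reverse {N : ℕ} (hN : 2 ≤ N) {G f : (ZMod p)[X]} (h1 : G ∣ X ^ N - 1)
    (h2 : G ∣ f.reverse) : G ∣ f.comp (X ^ (N - 1)) := by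
  rw [← AdjoinRoot.mk_eq_zero]
  set x := AdjoinRoot.root G
  have hx : x ^ N = 1 := by
    have := (AdjoinRoot.mk_eq_zero (f := G)).2 h1
    simpa [sub_eq_zero] using this
  have hx2 : x * x ^ (N - 1) = 1 := by
    rw [← pow_succ', Nat.sub_add_cancel (by omega), hx]
  let _ : Invertible (x ^ (N - 1)) := ⟨x, hx2, by rw [mul_comm, hx2]⟩
  have h3 := eval₂_reverse_mul_pow (AdjoinRoot.of G) (x ^ (N - 1)) f
  have h4 : eval₂ (AdjoinRoot.of G) (⅟(x ^ (N - 1))) f.reverse = 0 := by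
    have := (AdjoinRoot.mk_eq_zero (f := G)).2 h2
    rwa [← AdjoinRoot.aeval_eq] at this
  rw [h4, zero_mul] at h3
  rw [← AdjoinRoot.aeval_eq, aeval_comp, map_pow, aeval_X]
  exact h3.symm

theorem SelfRecip.of_dvd_reverse {N : ℕ} (hN : 2 ≤ N) {G : (ZMod p)[X]} (h1 : G ∣ X ^ N - 1)
    (h2 : G ∣ G.reverse) : SelfRecip N G :=
  ⟨hN, h1, dvd_comp_of_dvd_reverse hN h1 h2⟩

end Reciprocal

/-! ### Factorization of z^k - ε into orbits under reciprocity -/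

section Factorization

variable (p) in
/-- The data of the length: `k = p ^ s t` with `p ∤ t`, and a sign `ε`. -/
structure LengthData (s t k : ℕ) (ε : ZMod p) : Prop where
  not_dvd : ¬ p ∣ t
  eq_mul : k = p ^ s * t
  sign : ε = 1 ∨ ε = -1

variable {s t k : ℕ} {ε : ZMod p}

theorem LengthData.t_pos (h : LengthData p s t k ε) : 0 < t :=
  Nat.pos_of_ne_zero fun h0 => h.not_dvd (h0 ▸ dvd_zero p)

theorem LengthData.k_pos (h : LengthData p s t k ε) : 0 < k := by
  rw [h.eq_mul]
  exact Nat.mul_pos (pow_pos (Fact.out : p.Prime).pos s) h.t_pos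

theorem LengthData.sq (h : LengthData p s t k ε) : ε * ε = 1 := by
  rcases h.sign with rfl | rfl <;> ring

theorem LengthData.ne_zero (h : LengthData p s t k ε) : ε ≠ 0 := fun h0 => by
  have := h.sq
  rw [h0, zero_mul] at this
  exact zero_ne_one this

theorem LengthData.pow_eq (h : LengthData p s t k ε) :
    (X ^ k - C ε : (ZMod p)[X]) = (X ^ t - C ε) ^ p ^ s := by
  rw [sub_pow_char_pow, ← C_pow, ZMod.pow_card_pow, ← pow_mul, mul_comm, h.eq_mul]

theorem LengthData.monic (h : LengthData p s t k ε) : (X ^ t - C ε : (ZMod p)[X]).Monic :=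
  monic_X_pow_sub_C ε h.t_pos.ne'

theorem LengthData.monic_k (h : LengthData p s t k ε) : (X ^ k - C ε : (ZMod p)[X]).Monic :=
  monic_X_pow_sub_C ε h.k_pos.ne'

theorem LengthData.squarefree (h : LengthData p s t k ε) :
    Squarefree (X ^ t - C ε : (ZMod p)[X]) :=
  (separable_X_pow_sub_C' p t ε h.not_dvd h.ne_zero).squarefree

theorem LengthData.dvd_X_pow (h : LengthData p s t k ε) :
    (X ^ k - C ε : (ZMod p)[X]) ∣ X ^ (2 * k) - 1 := by
  refine ⟨X ^ k + C ε, ?_⟩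
  have : (C ε * C ε : (ZMod p)[X]) = 1 := by rw [← C_mul, h.sq, C_1]
  linear_combination this

theorem LengthData.selfRecip (h : LengthData p s t k ε) :
    SelfRecip (2 * k) (X ^ k - C ε : (ZMod p)[X]) := by
  have hk := h.k_pos
  refine ⟨by omega, h.dvd_X_pow, ?_⟩
  have h1 : (X ^ k - C ε : (ZMod p)[X]).comp (X ^ (2 * k - 1)) =
      (X ^ k) ^ (2 * k - 1) - (C ε) ^ (2 * k - 1) := by
    -- The exponent is odd and ε² = 1.
    have h2 : ε ^ (2 * k - 1) = ε := by
      obtain ⟨r, rfl⟩ : ∃ r, k = r + 1 := ⟨k - 1, by omega⟩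
      rw [show 2 * (r + 1) - 1 = 2 * r + 1 by omega, pow_succ, pow_mul, pow_two, h.sq, one_pow,
        one_mul]
    rw [← C_pow, h2, sub_comp, pow_comp, X_comp, C_comp, ← pow_mul, ← pow_mul, mul_comm]
  rw [h1]
  exact sub_dvd_pow_sub_pow _ _ _

theorem LengthData.dvd_iff (h : LengthData p s t k ε) {e : (ZMod p)[X]} (he : Irreducible e) :
    e ∣ X ^ k - C ε ↔ e ∣ X ^ t - C ε := by
  rw [h.pow_eq]
  exact ⟨he.prime.dvd_of_dvd_pow, fun h1 =>
    h1.trans (dvd_pow_self _ (pow_pos (Fact.out : p.Prime).pos s).ne')⟩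

theorem LengthData.coeff_zero_ne (h : LengthData p s t k ε) {f : (ZMod p)[X]}
    (hf : f ∣ X ^ k - C ε) : f.coeff 0 ≠ 0 := by
  intro h0
  obtain ⟨g, hg⟩ := hf
  have h1 := congrArg (fun q => coeff q 0) hg
  simp only [mul_coeff_zero, h0, zero_mul, coeff_sub, coeff_X_pow, coeff_C_zero,
    if_neg h.k_pos.ne, zero_sub] at h1
  exact h.ne_zero (neg_eq_zero.1 h1)

/-- Since ε² = 1, reversing X^k - ε only multiplies it by -ε, so reversal permutes its divisors up
to units. -/
theorem LengthData.monicReciprocal_dvd (h : LengthData p s t k ε) {f : (ZMod p)[X]}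
    (hf : f ∣ X ^ k - C ε) : monicReciprocal f ∣ X ^ k - C ε := by
  have hf0 := h.coeff_zero_ne hf
  refine (associated_reverse hf0).symm.dvd.trans ?_
  obtain ⟨g, hg⟩ := hf
  have h1 : (X ^ k - C ε : (ZMod p)[X]).reverse = 1 - C ε * X ^ k := by
    have h2 : (X ^ k - C ε : (ZMod p)[X]) = 1 * X ^ k + C (-ε) := by
      rw [C_neg]; ring
    rw [h2, reverse_add_C, reverse_mul_X_pow, natDegree_mul_X_pow _ one_ne_zero]
    · rw [natDegree_one, zero_add, ← C_1, reverse_C, C_neg]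
      ring
  have h3 : f.reverse ∣ 1 - C ε * X ^ k := by
    rw [← h1, hg, reverse_mul_of_domain]
    exact dvd_mul_right _ _
  have h4 : (X ^ k - C ε : (ZMod p)[X]) = (1 - C ε * X ^ k) * (-C ε) := by
    have : (C ε * C ε : (ZMod p)[X]) = 1 := by rw [← C_mul, h.sq, C_1]
    linear_combination (-X ^ k) * this
  rw [h4]
  exact h3.mul_right _

variable (t ε) in
open Classical in
/-- The monic irreducible factors of `X ^ t - ε`. -/
def irredFactors : Finset (ZMod p)[X] :=
  (UniqueFactorizationMonoid.normalizedFactors (X ^ t - C ε : (ZMod p)[X])).toFinset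

theorem LengthData.mem_irredFactors (h : LengthData p s t k ε) {e : (ZMod p)[X]} :
    e ∈ irredFactors t ε ↔ Irreducible e ∧ e.Monic ∧ e ∣ X ^ k - C ε := by
  classical
  rw [irredFactors, Multiset.mem_toFinset, Polynomial.mem_normalizedFactors_iff h.monic.ne_zero]
  refine and_congr_right fun he => and_congr_right fun _ => (h.dvd_iff he).symm

theorem LengthData.prod_irredFactors (h : LengthData p s t k ε) :
    ∏ e ∈ irredFactors t ε, e = (X ^ t - C ε : (ZMod p)[X]) := by
  classical
  have hnd := (UniqueFactorizationMonoid.squarefree_iff_nodup_normalizedFactors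
    h.monic.ne_zero).1 h.squarefree
  rw [irredFactors, Finset.prod_eq_multiset_prod, Multiset.map_id', Multiset.toFinset_val,
    Multiset.dedup_eq_self.2 hnd, UniqueFactorizationMonoid.prod_normalizedFactors_eq h.monic.ne_zero, h.monic.normalize_eq_self]

theorem isCoprime_of_irreducible_of_ne {e f : (ZMod p)[X]} (he : Irreducible e)
    (hf : Irreducible f) (hem : e.Monic) (hfm : f.Monic) (hne : e ≠ f) : IsCoprime e f := by
  rw [he.coprime_iff_not_dvd]
  intro hd
  exact hne (eq_of_monic_of_associated hem hfm ((he.dvd_irreducible_iff_associated hf).1 hd))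

theorem LengthData.factorization_irred (h : LengthData p s t k ε) :
    IsCoprimeFactorization (irredFactors t ε) (p ^ s) (X ^ k - C ε : (ZMod p)[X]) where
  ne_zero := h.monic_k.ne_zero
  pos := (pow_pos (Fact.out : p.Prime).pos s).ne'
  coprime := by
    intro e he f hf hne
    have he := h.mem_irredFactors.1 he
    have hf := h.mem_irredFactors.1 hf
    exact isCoprime_of_irreducible_of_ne he.1 hf.1 he.2.1 hf.2.1 hne
  eq_prod := by rw [Finset.prod_pow, h.prod_irredFactors, h.pow_eq]

theorem LengthData.monicReciprocal_mem (h : LengthData p s t k ε) {e : (ZMod p)[X]}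
    (he : e ∈ irredFactors t ε) : monicReciprocal e ∈ irredFactors t ε := by
  obtain ⟨h1, h2, h3⟩ := h.mem_irredFactors.1 he
  have h0 := h.coeff_zero_ne h3
  exact h.mem_irredFactors.2 ⟨irreducible_monicReciprocal h1 h0, monic_monicReciprocal h0,
    h.monicReciprocal_dvd h3⟩

theorem LengthData.monicReciprocal_invol (h : LengthData p s t k ε) {e : (ZMod p)[X]}
    (he : e ∈ irredFactors t ε) : monicReciprocal (monicReciprocal e) = e := by
  obtain ⟨h1, h2, h3⟩ := h.mem_irredFactors.1 he
  exact monicReciprocal_monicReciprocal h2 (h.coeff_zero_ne h3)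

open Classical in
/-- The product of the orbit of `e` under `e ↦ e♮`. -/
def orbitPoly (e : (ZMod p)[X]) : (ZMod p)[X] :=
  if e = monicReciprocal e then e else e * monicReciprocal e

variable (t ε) in
open Classical in
/-- The orbit products of the irreducible factors of `X ^ t - ε`. -/
def orbitFactors : Finset (ZMod p)[X] := (irredFactors t ε).image orbitPoly

theorem dvd_orbitPoly (e : (ZMod p)[X]) : e ∣ orbitPoly e := by
  rw [orbitPoly]
  split_ifs
  · exact dvd_rfl
  · exact dvd_mul_right _ _

theorem orbitPoly_dvd (e : (ZMod p)[X]) : orbitPoly e ∣ e * monicReciprocal e := by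
  rw [orbitPoly]
  split_ifs
  · exact dvd_mul_right _ _
  · exact dvd_rfl

theorem LengthData.orbitPoly_eq_iff (h : LengthData p s t k ε) {e f : (ZMod p)[X]}
    (he : e ∈ irredFactors t ε) (hf : f ∈ irredFactors t ε) :
    orbitPoly e = orbitPoly f ↔ e = f ∨ e = monicReciprocal f := by
  obtain ⟨he1, he2, he3⟩ := h.mem_irredFactors.1 he
  obtain ⟨hf1, hf2, hf3⟩ := h.mem_irredFactors.1 hf
  obtain ⟨hg1, hg2, hg3⟩ := h.mem_irredFactors.1 (h.monicReciprocal_mem hf)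
  constructor
  · intro heq
    have hd : e ∣ f * monicReciprocal f :=
      (dvd_orbitPoly e).trans (heq ▸ orbitPoly_dvd f)
    refine (he1.prime.dvd_or_dvd hd).imp (fun hd => ?_) (fun hd => ?_)
    · exact eq_of_monic_of_associated he2 hf2 ((he1.dvd_irreducible_iff_associated hf1).1 hd)
    · exact eq_of_monic_of_associated he2 hg2 ((he1.dvd_irreducible_iff_associated hg1).1 hd)
  · rintro (rfl | rfl)
    · rfl
    · rw [orbitPoly, orbitPoly, h.monicReciprocal_invol hf]
      by_cases hc : f = monicReciprocal f
      · rw [if_pos hc.symm, if_pos hc, ← hc]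
      · rw [if_neg (fun h => hc h.symm), if_neg hc, mul_comm]

theorem LengthData.isCoprime_orbit (h : LengthData p s t k ε) {e f : (ZMod p)[X]}
    (he : e ∈ irredFactors t ε) (hf : f ∈ irredFactors t ε) (hne : orbitPoly e ≠ orbitPoly f) :
    IsCoprime (orbitPoly e) (orbitPoly f) := by
  have key : ∀ a ∈ irredFactors t ε, ∀ b ∈ irredFactors t ε, orbitPoly a ≠ orbitPoly b →
      IsCoprime a b := by
    intro a ha b hb hab
    obtain ⟨ha1, ha2, _⟩ := h.mem_irredFactors.1 ha
    obtain ⟨hb1, hb2, _⟩ := h.mem_irredFactors.1 hb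
    exact isCoprime_of_irreducible_of_ne ha1 hb1 ha2 hb2 (fun h => hab (by rw [h]))
  have he' := h.monicReciprocal_mem he
  have hf' := h.monicReciprocal_mem hf
  have e1 := (h.orbitPoly_eq_iff he' he).2 (Or.inr rfl)
  have f1 := (h.orbitPoly_eq_iff hf' hf).2 (Or.inr rfl)
  refine IsCoprime.of_isCoprime_of_dvd_left (IsCoprime.of_isCoprime_of_dvd_right
    (IsCoprime.mul_left (IsCoprime.mul_right ?_ ?_) (IsCoprime.mul_right ?_ ?_))
    (orbitPoly_dvd f)) (orbitPoly_dvd e)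
  · exact key _ he _ hf hne
  · exact key _ he _ hf' (by rwa [f1])
  · exact key _ he' _ hf (by rwa [e1])
  · exact key _ he' _ hf' (by rwa [e1, f1])

theorem LengthData.prod_orbitFactors (h : LengthData p s t k ε) :
    ∏ F ∈ orbitFactors t ε, F = (X ^ t - C ε : (ZMod p)[X]) := by
  classical
  rw [← h.prod_irredFactors]
  refine Eq.trans (Finset.prod_congr rfl fun F hF => ?_) (Finset.prod_fiberwise_of_maps_to
    (t := orbitFactors t ε) (g := orbitPoly) (fun e he => Finset.mem_image_of_mem orbitPoly he) _)
  obtain ⟨e, he, rfl⟩ := Finset.mem_image.1 hF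
  have hfil : (irredFactors t ε).filter (fun f => orbitPoly f = orbitPoly e) =
      {e, monicReciprocal e} := by
    ext f
    rw [Finset.mem_filter, Finset.mem_insert, Finset.mem_singleton]
    constructor
    · rintro ⟨hf, hfe⟩
      exact (h.orbitPoly_eq_iff hf he).1 hfe
    · intro hfe
      have hf : f ∈ irredFactors t ε := by
        rcases hfe with rfl | rfl
        · exact he
        · exact h.monicReciprocal_mem he
      exact ⟨hf, (h.orbitPoly_eq_iff hf he).2 hfe⟩
  rw [hfil]
  by_cases hc : e = monicReciprocal e
  · rw [← hc, orbitPoly, if_pos hc]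
    simp
  · rw [Finset.prod_pair hc, orbitPoly, if_neg hc]

/-- Reflection does not act on the residue ring of e alone unless e = e♮. The form can only be
reduced modulo orbit products, which is why the counting uses this coarser factorization. -/
theorem LengthData.factorization_orbit (h : LengthData p s t k ε) :
    IsCoprimeFactorization (orbitFactors t ε) (p ^ s) (X ^ k - C ε : (ZMod p)[X]) where
  ne_zero := h.monic_k.ne_zero
  pos := (pow_pos (Fact.out : p.Prime).pos s).ne'
  coprime := by
    classical
    intro E hE F hF hne
    obtain ⟨e, he, rfl⟩ := Finset.mem_image.1 (Finset.mem_coe.1 hE)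
    obtain ⟨f, hf, rfl⟩ := Finset.mem_image.1 (Finset.mem_coe.1 hF)
    exact h.isCoprime_orbit he hf hne
  eq_prod := by rw [Finset.prod_pow, h.prod_orbitFactors, h.pow_eq]

theorem LengthData.selfRecip_orbit (h : LengthData p s t k ε) {F : (ZMod p)[X]}
    (hF : F ∈ orbitFactors t ε) : SelfRecip (2 * k) F := by
  classical
  have hk := h.k_pos
  have hd := (h.factorization_orbit.dvd hF).trans h.dvd_X_pow
  refine SelfRecip.of_dvd_reverse (by omega) hd ?_
  obtain ⟨e, he, rfl⟩ := Finset.mem_image.1 hF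
  obtain ⟨he1, he2, he3⟩ := h.mem_irredFactors.1 he
  have h0 := h.coeff_zero_ne he3
  have h0' := h.coeff_zero_ne (h.monicReciprocal_dvd he3)
  have hi := h.monicReciprocal_invol he
  have hr : monicReciprocal e ∣ e.reverse := (associated_reverse h0).symm.dvd
  have hr' : e ∣ (monicReciprocal e).reverse := by
    nth_rewrite 1 [← hi]
    exact (associated_reverse h0').symm.dvd
  rw [orbitPoly]
  split_ifs with hc
  · rwa [← hc] at hr
  · rw [reverse_mul_of_domain, mul_comm]
    exact mul_dvd_mul hr hr'

theorem monicReciprocal_X_sub_C {η : ZMod p} (hη : η = 1 ∨ η = -1) :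
    monicReciprocal (X - C η : (ZMod p)[X]) = X - C η := by
  have hηη : η * η = 1 := by rcases hη with rfl | rfl <;> ring
  have hη0 : η ≠ 0 := left_ne_zero_of_mul_eq_one hηη
  have h1 : (X - C η : (ZMod p)[X]).reverse = 1 - C η * X := by
    have h2 : (X - C η : (ZMod p)[X]) = 1 * X ^ 1 + C (-η) := by
      rw [C_neg]; ring
    rw [h2, reverse_add_C, reverse_mul_X_pow, natDegree_mul_X_pow _ one_ne_zero]
    · rw [natDegree_one, zero_add, ← C_1, reverse_C, C_neg]
      ring
  rw [monicReciprocal, h1]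
  have h3 : (X - C η : (ZMod p)[X]).coeff 0 = -η := by simp
  have h4 : (-η)⁻¹ = -η := inv_eq_of_mul_eq_one_left (by rw [neg_mul_neg, hηη])
  rw [h3, h4, C_neg]
  have : (C η * C η : (ZMod p)[X]) = 1 := by rw [← C_mul, hηη, C_1]
  linear_combination X * this

theorem X_sub_C_dvd_iff (η : ZMod p) :
    (X - C η : (ZMod p)[X]) ∣ X ^ k - C ε ↔ η ^ k = ε := by
  rw [dvd_iff_isRoot, IsRoot.def, eval_sub, eval_pow, eval_X, eval_C, sub_eq_zero]

variable (k ε) in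
open Classical in
/-- The self-inverse roots of `X ^ k - ε`. -/
def signRoots : Finset (ZMod p) := ({1, -1} : Finset (ZMod p)).filter fun η => η ^ k = ε

theorem mem_signRoots {η : ZMod p} : η ∈ signRoots k ε ↔ (η = 1 ∨ η = -1) ∧ η ^ k = ε := by
  classical
  rw [signRoots, Finset.mem_filter, Finset.mem_insert, Finset.mem_singleton]

/-- The trichotomy of local types. A self-reciprocal monic linear factor has a constant term equal
to its own inverse, so it is z - 1 or z + 1. -/
theorem LengthData.mem_orbitFactors (h : LengthData p s t k ε) {F : (ZMod p)[X]} :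
    F ∈ orbitFactors t ε ↔ (∃ η ∈ signRoots k ε, F = X - C η) ∨
      F ∈ Fir p ∩ monicDivisors (X ^ k - C ε) ∨ F ∈ Fred p ∩ monicDivisors (X ^ k - C ε) := by
  classical
  constructor
  · intro hF
    have hFd := h.factorization_orbit.dvd hF
    obtain ⟨e, he, rfl⟩ := Finset.mem_image.1 hF
    obtain ⟨he1, he2, he3⟩ := h.mem_irredFactors.1 he
    by_cases hc : e = monicReciprocal e
    · have ho : orbitPoly e = e := by rw [orbitPoly, if_pos hc]
      rw [ho]
      by_cases hd : 1 < e.natDegree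
      · exact Or.inr (Or.inl ⟨⟨hc, he1, hd⟩, he2, he3⟩)
      · left
        have hd1 : e.natDegree = 1 := le_antisymm (not_lt.1 hd) he1.natDegree_pos
        have heq : e = X - C (-e.coeff 0) := by
          rw [C_neg, sub_neg_eq_add]
          exact he2.eq_X_add_C hd1
        refine ⟨-e.coeff 0, ?_, heq⟩
        have h0 := h.coeff_zero_ne he3
        have h1 := congrArg (fun q => coeff q 0) hc
        simp only [coeff_zero_monicReciprocal, he2.leadingCoeff, mul_one] at h1
        have h2 : e.coeff 0 * e.coeff 0 = 1 := by
          nth_rewrite 1 [h1]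
          exact inv_mul_cancel₀ h0
        refine mem_signRoots.2 ⟨?_, ?_⟩
        · rcases mul_self_eq_one_iff.1 h2 with h3 | h3
          · right; rw [h3]
          · left; rw [h3, neg_neg]
        · rw [heq] at he3
          exact (X_sub_C_dvd_iff _).1 he3
    · right; right
      have ho : orbitPoly e = e * monicReciprocal e := by rw [orbitPoly, if_neg hc]
      refine ⟨⟨e, he2, he1, hc, ho⟩, ?_, hFd⟩
      rw [ho]
      exact he2.mul (monic_monicReciprocal (h.coeff_zero_ne he3))
  · rintro (⟨η, hη, rfl⟩ | ⟨⟨h1, h2, h3⟩, h4, h5⟩ | ⟨⟨e, h1, h2, h3, rfl⟩, h4, h5⟩)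
    · obtain ⟨h1, h2⟩ := mem_signRoots.1 hη
      refine Finset.mem_image.2 ⟨X - C η, h.mem_irredFactors.2 ⟨irreducible_X_sub_C η,
        monic_X_sub_C η, (X_sub_C_dvd_iff η).2 h2⟩, ?_⟩
      rw [orbitPoly, if_pos (monicReciprocal_X_sub_C h1).symm]
    · exact Finset.mem_image.2 ⟨F, h.mem_irredFactors.2 ⟨h2, h4, h5⟩, by
        rw [orbitPoly, if_pos h1]⟩
    · exact Finset.mem_image.2 ⟨e, h.mem_irredFactors.2 ⟨h2, h1,
        (dvd_mul_right _ _).trans h5⟩, by rw [orbitPoly, if_neg h3]⟩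

/-- The three types are disjoint: the degree separates the linear factors from the other irreducible
ones, and products ee♮ are reducible. -/
theorem LengthData.prod_orbitFactors_eq (h : LengthData p s t k ε) {M : Type*} [CommMonoid M]
    (g : (ZMod p)[X] → M) :
    ∏ F ∈ orbitFactors t ε, g F = (∏ η ∈ signRoots k ε, g (X - C η)) *
      (∏ᶠ F ∈ Fir p ∩ monicDivisors (X ^ k - C ε), g F) *
      (∏ᶠ F ∈ Fred p ∩ monicDivisors (X ^ k - C ε), g F) := by
  classical
  set A := (signRoots k ε).image fun η => (X - C η : (ZMod p)[X]) with hA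
  set B := (orbitFactors t ε).filter (· ∈ Fir p ∩ monicDivisors (X ^ k - C ε)) with hB
  set D := (orbitFactors t ε).filter (· ∈ Fred p ∩ monicDivisors (X ^ k - C ε)) with hD
  have hBset : Fir p ∩ monicDivisors (X ^ k - C ε) = (B : Set (ZMod p)[X]) := by
    ext F
    rw [hB, Finset.coe_filter]
    exact ⟨fun hF => ⟨h.mem_orbitFactors.2 (Or.inr (Or.inl hF)), hF⟩, fun hF => hF.2⟩
  have hDset : Fred p ∩ monicDivisors (X ^ k - C ε) = (D : Set (ZMod p)[X]) := by
    ext F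
    rw [hD, Finset.coe_filter]
    exact ⟨fun hF => ⟨h.mem_orbitFactors.2 (Or.inr (Or.inr hF)), hF⟩, fun hF => hF.2⟩
  have hunion : orbitFactors t ε = (A ∪ B) ∪ D := by
    ext F
    rw [Finset.mem_union, Finset.mem_union, h.mem_orbitFactors, or_assoc, ← Finset.mem_coe (s := B),
      ← hBset, ← Finset.mem_coe (s := D), ← hDset, hA, Finset.mem_image]
    simp only [eq_comm]
  have hred : ∀ F ∈ D, ¬ Irreducible F := by
    intro F hF hirr
    rw [← Finset.mem_coe, ← hDset] at hF
    obtain ⟨⟨e, h1, h2, h3, rfl⟩, h4, h5⟩ := hF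
    have he := (dvd_mul_right e _).trans h5
    have h6 := irreducible_monicReciprocal h2 (h.coeff_zero_ne he)
    exact (hirr.isUnit_or_isUnit rfl).elim h2.not_isUnit h6.not_isUnit
  have hd1 : Disjoint A B := by
    rw [Finset.disjoint_left]
    intro F hFA hFB
    obtain ⟨η, _, rfl⟩ := Finset.mem_image.1 hFA
    rw [← Finset.mem_coe, ← hBset] at hFB
    have := hFB.1.2.2
    rw [natDegree_X_sub_C] at this
    exact lt_irrefl _ this
  have hd2 : Disjoint (A ∪ B) D := by
    rw [Finset.disjoint_left]
    intro F hF hFD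
    refine hred F hFD ?_
    rcases Finset.mem_union.1 hF with hF | hF
    · obtain ⟨η, _, rfl⟩ := Finset.mem_image.1 hF
      exact irreducible_X_sub_C η
    · rw [← Finset.mem_coe, ← hBset] at hF
      exact hF.1.2.1
  rw [hBset, hDset, finprod_mem_coe_finset, finprod_mem_coe_finset, hunion,
    Finset.prod_union hd2, Finset.prod_union hd1, hA, Finset.prod_image]
  intro a _ b _ hab
  simpa using hab

end Factorization

/-! ### Assembling the local counts modulo z^k - ε -/

variable {p : ℕ} [Fact p.Prime] {s t k : ℕ} {ε : ZMod p}

open Classical in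
/-- The contribution of a linear factor `z - η` to the number of Euclidean LCD codes. -/
def linearEuclidean (η : ZMod p) : ℕ :=
  if p = 2 then 2 else if (-1) ^ ((p + 1) / 2) = η then p - 1 else p + 1

open Classical in
/-- The contribution of a linear factor `z - η` to the number of Hermitian LCD codes. -/
def linearHermitian (η : ZMod p) : ℕ := if 1 + η = 0 then 0 else p + 1

/-- The norm of uρ(u) is the norm of u times its image under ρ, that is z·z⁻¹. -/
theorem conj_unit_of_norm {P : (ZMod p)[X]} {N : ℕ} (h : SelfRecip N P) {j : Fq p →+* Fq p}
    (hj' : ∀ a, j (frob p a) = frob p (j a)) {u : Bq P} (hu : u * conj P u = zq P) :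
    (u * refl j h u) * conj P (u * refl j h u) = 1 := by
  have h1 := congrArg (refl j h) hu
  rw [map_mul, refl_root, ← conj_refl hj'] at h1
  have h2 := h.root_mul
  rw [map_mul]
  linear_combination (refl j h u * conj P (refl j h u)) * hu + zq P * h1 + h2

/-- The number of LCD codes contributed by the linear factor `z - η` for `j`. -/
structure IsLinearCount (j : Fq p →+* Fq p) (lin : ZMod p → ℕ) : Prop where
  invol : ∀ a, j (j a) = a
  comm : ∀ a, j (frob p a) = frob p (j a)
  count : ∀ η : ZMod p, (η = 1 ∨ η = -1) → ∀ u : Fq p,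
    u * frob p u = algebraMap (ZMod p) (Fq p) η →
      unitFormCount (frob p) j (u * j u) = (p - 1) * lin η

theorem isLinearCount_euclidean : IsLinearCount (RingHom.id (Fq p)) linearEuclidean where
  invol _ := rfl
  comm _ := rfl
  count := by
    intro η hη u hu
    rw [RingHom.id_apply, linearEuclidean]
    split_ifs with h2 hc
    · subst h2
      have : η = 1 := by
        rcases hη with rfl | rfl
        · rfl
        · exact CharTwo.neg_eq 1
      subst this
      rw [map_one] at hu
      rw [unitFormCount_id_two hu]
    · have hη' : algebraMap (ZMod p) (Fq p) η = 1 ∨ algebraMap (ZMod p) (Fq p) η = -1 := by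
        rcases hη with rfl | rfl <;> simp
      rw [unitFormCount_id_odd h2 hu hη', if_pos]
      rw [← hc]; simp
    · have hη' : algebraMap (ZMod p) (Fq p) η = 1 ∨ algebraMap (ZMod p) (Fq p) η = -1 := by
        rcases hη with rfl | rfl <;> simp
      rw [unitFormCount_id_odd h2 hu hη', if_neg]
      intro h
      apply hc
      apply (algebraMap (ZMod p) (Fq p)).injective
      rw [← h]; simp

theorem isLinearCount_hermitian : IsLinearCount (frob p) linearHermitian where
  invol := frob_frob
  comm _ := rfl
  count := by
    intro η hη u hu
    rw [hu, unitFormCount_frob_frob, linearHermitian]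
    have : 1 + algebraMap (ZMod p) (Fq p) η = 0 ↔ 1 + η = 0 := by
      rw [← map_one (algebraMap (ZMod p) (Fq p)), ← map_add,
        map_eq_zero_iff _ (algebraMap (ZMod p) (Fq p)).injective]
    simp only [this]
    split_ifs
    · rw [mul_zero]
    · rw [mul_comm, ← Nat.sq_sub_sq, one_pow]

/-- The quotient n of the local count by the number of fixed units is the contribution of F before
nilpotents are accounted for. -/
theorem LengthData.exists_orbit_count (h : LengthData p s t k ε) {j : Fq p →+* Fq p}
    {lin : ZMod p → ℕ} (hl : IsLinearCount j lin) {F : (ZMod p)[X]} (hF : F ∈ orbitFactors t ε)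
    (hS : SelfRecip (2 * k) F) {u : Bq F} (hu : u * conj F u = zq F) :
    ∃ n : ℕ, 0 < fixedUnitCount (conj F) ∧
      unitFormCount (conj F) (refl j hS) (u * refl j hS u) = fixedUnitCount (conj F) * n ∧
      (∀ η, F = X - C η → n = lin η) ∧
      (F ∈ Fir p → (n : ℤ) = (p : ℤ) ^ F.natDegree - (p : ℤ) ^ (F.natDegree / 2)) ∧
      (F ∈ Fred p → F.natDegree = 2 * (F.natDegree / 2) ∧
        (n : ℤ) = (1 + (p : ℤ) ^ (F.natDegree / 2)) * (p : ℤ) ^ (F.natDegree / 2)) := by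
  have hp1 : 1 < p := (Fact.out : p.Prime).one_lt
  have hγ := conj_unit_of_norm hS hl.comm hu
  have hργ : refl j hS (u * refl j hS u) = u * refl j hS u := by
    rw [map_mul, refl_refl hl.invol, mul_comm]
  rcases h.mem_orbitFactors.1 hF with ⟨η, hη, rfl⟩ | ⟨⟨h1, h2, h3⟩, h4, h5⟩ |
    ⟨⟨e, h1, h2, h3, rfl⟩, h4, h5⟩
  · obtain ⟨u₀, hu₀, hcount⟩ := exists_unitFormCount_linear η hS j u hu
    refine ⟨lin η, ?_, ?_, ?_, ?_, ?_⟩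
    · rw [fixedUnitCount_irreducible (irreducible_X_sub_C η), natDegree_X_sub_C, pow_one]
      omega
    · rw [hcount, hl.count η (mem_signRoots.1 hη).1 u₀ hu₀,
        fixedUnitCount_irreducible (irreducible_X_sub_C η), natDegree_X_sub_C, pow_one]
    · intro η' he
      have : η = η' := by simpa using he
      rw [this]
    · intro hc
      have := hc.2.2
      rw [natDegree_X_sub_C] at this
      omega
    · rintro ⟨e, h1, h2, h3, h4⟩
      exfalso
      have h0 : e.coeff 0 ≠ 0 := fun h0 => by
        rw [monicReciprocal, h0, inv_zero, C_0, zero_mul, mul_zero] at h4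
        exact X_sub_C_ne_zero η h4
      exact ((irreducible_X_sub_C η).isUnit_or_isUnit h4).elim h2.not_isUnit
        (irreducible_monicReciprocal h2 h0).not_isUnit
  · obtain ⟨he, hcount⟩ := unitFormCount_selfRecip h2 h3 hS hl.invol hl.comm hγ hργ
    refine ⟨p ^ F.natDegree - p ^ (F.natDegree / 2), ?_, ?_, ?_, ?_, ?_⟩
    · rw [fixedUnitCount_irreducible h2]
      exact Nat.sub_pos_of_lt (Nat.one_lt_pow (by omega) hp1)
    · rw [hcount, fixedUnitCount_irreducible h2]
    · rintro η rfl
      rw [natDegree_X_sub_C] at h3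
      omega
    · intro _
      rw [Nat.cast_sub (Nat.pow_le_pow_right hp1.le (Nat.div_le_self _ _))]
      push_cast
      ring
    · rintro ⟨e, g1, g2, g3, rfl⟩
      exfalso
      have h0 := h.coeff_zero_ne ((dvd_mul_right e _).trans h5)
      exact (h2.isUnit_or_isUnit rfl).elim g2.not_isUnit
        (irreducible_monicReciprocal g2 h0).not_isUnit
  · have hed := (dvd_mul_right e _).trans h5
    have h0 := h.coeff_zero_ne hed
    have hi := irreducible_monicReciprocal h2 h0
    have hm := monic_monicReciprocal h0
    have hdeg := natDegree_monicReciprocal h0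
    have hcop := isCoprime_of_irreducible_of_ne h2 hi h1 hm h3
    have hdvd : monicReciprocal e ∣ e.comp (X ^ (2 * k - 1)) :=
      dvd_comp_of_dvd_reverse hS.two_le ((dvd_mul_left _ _).trans hS.dvd_pow)
        (associated_reverse h0).symm.dvd
    have hnd : (e * monicReciprocal e).natDegree = 2 * e.natDegree := by
      rw [natDegree_mul h2.ne_zero hi.ne_zero, hdeg]; ring
    have hhalf : (e * monicReciprocal e).natDegree / 2 = e.natDegree := by omega
    have hQ : 1 < p ^ e.natDegree := Nat.one_lt_pow h2.natDegree_pos.ne' hp1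
    refine ⟨(1 + p ^ e.natDegree) * p ^ e.natDegree, ?_, ?_, ?_, ?_, ?_⟩
    · rw [fixedUnitCount_pair h2 hcop hdeg hdvd hi.ne_zero hS]
      exact pow_pos (by omega) 2
    · rw [unitFormCount_pair h2 hcop hdeg hdvd hi.ne_zero hS hl.invol hl.comm hγ hργ,
        fixedUnitCount_pair h2 hcop hdeg hdvd hi.ne_zero hS]
      obtain ⟨r, hr⟩ : ∃ r, p ^ e.natDegree = r + 1 := ⟨p ^ e.natDegree - 1, by omega⟩
      rw [hr]
      have e1 : (r + 1) ^ 2 - 1 = r * (r + 2) := by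
        rw [show (r + 1) ^ 2 = r * (r + 2) + 1 by ring, Nat.add_sub_cancel]
      have e2 : (r + 1) ^ 2 - (r + 1) = (r + 1) * r := by
        rw [show (r + 1) ^ 2 = (r + 1) * r + (r + 1) by ring, Nat.add_sub_cancel]
      rw [e1, e2, Nat.add_sub_cancel]
      ring
    · intro η hη
      exfalso
      have h6 := irreducible_X_sub_C η
      rw [← hη] at h6
      exact (h6.isUnit_or_isUnit rfl).elim h2.not_isUnit hi.not_isUnit
    · intro hc
      exact ((hc.2.1.isUnit_or_isUnit rfl).elim h2.not_isUnit hi.not_isUnit).elim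
    · intro _
      rw [hhalf]
      exact ⟨hnd, by push_cast; ring⟩

/-- Bookkeeping of fibre sizes. Here a is the order of the product of the residual fixed rings, and
b is that of the kernel of the fixed ring onto it. There are bU fixed units, while the kernel on all
of B has b² elements; the quotient keeps a single b. -/
theorem eq_mul_of_mul_eq_sq_mul {a b U c n : ℕ} (ha : 0 < a) (hb : 0 < b) (hU : 0 < U)
    (h : c * (b * U) * a ^ 2 = (a * b) ^ 2 * (U * n)) : c = b * n := by
  have h0 : 0 < b * U * a ^ 2 := Nat.mul_pos (Nat.mul_pos hb hU) (pow_pos ha 2)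
  refine Nat.eq_of_mul_eq_mul_right h0 ?_
  calc c * (b * U * a ^ 2) = c * (b * U) * a ^ 2 := by ring
    _ = _ := h
    _ = _ := by ring

theorem LengthData.count_eq (h : LengthData p s t k ε) {j : Fq p →+* Fq p}
    {lin : ZMod p → ℕ} (hl : IsLinearCount j lin) {u : Bq (X ^ k - C ε : (ZMod p)[X])}
    (hu : u * conj _ u = zq _) {c : ℕ}
    (hc : c * fixedUnitCount (conj (X ^ k - C ε : (ZMod p)[X])) =
      unitFormCount (conj _) (refl j h.selfRecip) (u * refl j h.selfRecip u)) :
    (c : ℤ) = (∏ η ∈ signRoots k ε, (p : ℤ) ^ (p ^ s - 1) * lin η) *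
      (∏ᶠ f ∈ Fir p ∩ monicDivisors (X ^ k - C ε),
          ((p : ℤ) ^ f.natDegree - (p : ℤ) ^ (f.natDegree / 2))
            * (p : ℤ) ^ (f.natDegree * (p ^ s - 1))) *
      (∏ᶠ f ∈ Fred p ∩ monicDivisors (X ^ k - C ε),
          (1 + (p : ℤ) ^ (f.natDegree / 2))
            * (p : ℤ) ^ ((2 * p ^ s - 1) * (f.natDegree / 2))) := by
  classical
  have hp0 : 0 < p := (Fact.out : p.Prime).pos
  have hfac := h.factorization_orbit
  have hm : 0 < p ^ s := pow_pos hp0 s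
  have hsr := fun F : orbitFactors t ε => h.selfRecip_orbit F.2
  have hu' : ∀ F : orbitFactors t ε,
      proj (hfac.dvd F.2) u * conj F.1 (proj (hfac.dvd F.2) u) = zq F.1 := by
    intro F
    rw [← proj_conj, ← map_mul, hu, proj_root]
  have hn : ∀ F : orbitFactors t ε, ∃ n : ℕ, _ := fun F =>
    h.exists_orbit_count hl F.2 (hsr F) (hu' F)
  choose n hU hW hlin hir hred using hn
  have h1 := hfac.unitFormCount_mul j h.selfRecip hsr (u * refl j h.selfRecip u)
  have h2 := hfac.fixedUnitCount_mul
  have hγ : ∀ F : orbitFactors t ε, proj (hfac.dvd F.2) (u * refl j h.selfRecip u) =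
      proj (hfac.dvd F.2) u * refl j (hsr F) (proj (hfac.dvd F.2) u) := fun F => by
    rw [map_mul, proj_refl _ j h.selfRecip (hsr F)]
  simp only [hγ, hW, Finset.prod_mul_distrib, ← hc] at h1
  have hdeg : (X ^ k - C ε : (ZMod p)[X]).natDegree =
      ∑ F : orbitFactors t ε, (F.1.natDegree + (p ^ s - 1) * F.1.natDegree) := by
    rw [h.pow_eq, natDegree_pow, ← h.prod_orbitFactors, natDegree_prod _ _
      (fun F hF => hfac.ne_zero' hF), Finset.mul_sum, ← Finset.sum_coe_sort]
    refine Finset.sum_congr rfl fun F _ => ?_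
    obtain ⟨r, hr⟩ : ∃ r, p ^ s = r + 1 := ⟨p ^ s - 1, by omega⟩
    rw [hr, Nat.add_sub_cancel]
    ring
  have hA : p ^ (X ^ k - C ε : (ZMod p)[X]).natDegree = (∏ F : orbitFactors t ε,
      p ^ F.1.natDegree) * ∏ F : orbitFactors t ε, p ^ ((p ^ s - 1) * F.1.natDegree) := by
    rw [hdeg, ← Finset.prod_pow_eq_pow_sum, ← Finset.prod_mul_distrib]
    exact Finset.prod_congr rfl fun F _ => pow_add _ _ _
  have hB : ∏ F : orbitFactors t ε, (p ^ 2) ^ F.1.natDegree =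
      (∏ F : orbitFactors t ε, p ^ F.1.natDegree) ^ 2 := by
    rw [← Finset.prod_pow]
    exact Finset.prod_congr rfl fun F _ => by rw [← pow_mul, ← pow_mul, mul_comm]
  rw [hB, ← pow_mul, mul_comm 2, pow_mul, hA] at h1
  rw [hA] at h2
  set a := ∏ F : orbitFactors t ε, p ^ F.1.natDegree
  set b := ∏ F : orbitFactors t ε, p ^ ((p ^ s - 1) * F.1.natDegree)
  set U := ∏ F : orbitFactors t ε, fixedUnitCount (conj F.1)
  have ha : 0 < a := Finset.prod_pos fun F _ => pow_pos hp0 _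
  have hb : 0 < b := Finset.prod_pos fun F _ => pow_pos hp0 _
  have hU0 : 0 < U := Finset.prod_pos fun F _ => hU F
  have h3 : fixedUnitCount (conj (X ^ k - C ε : (ZMod p)[X])) = b * U := by
    refine Nat.eq_of_mul_eq_mul_right ha ?_
    rw [h2]; ring
  have h4 : c = b * ∏ F : orbitFactors t ε, n F := by
    rw [h3] at h1
    exact eq_mul_of_mul_eq_sq_mul ha hb hU0 h1
  -- The numbers n exist only on orbit factors. The value 1 elsewhere never enters a product.
  let g : (ZMod p)[X] → ℤ := fun F =>
    if hF : F ∈ orbitFactors t ε then (p : ℤ) ^ ((p ^ s - 1) * F.natDegree) * n ⟨F, hF⟩ else 1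
  have h5 : (c : ℤ) = ∏ F ∈ orbitFactors t ε, g F := by
    rw [h4, ← Finset.prod_coe_sort (orbitFactors t ε) g, ← Finset.prod_mul_distrib]
    push_cast
    refine Finset.prod_congr rfl fun F _ => ?_
    simp only [g, dif_pos F.2]
  rw [h5, h.prod_orbitFactors_eq g]
  congr 1
  · congr 1
    · refine Finset.prod_congr rfl fun η hη => ?_
      have hF := h.mem_orbitFactors.2 (Or.inl ⟨η, hη, rfl⟩)
      simp only [g, dif_pos hF]
      rw [hlin ⟨X - C η, hF⟩ η rfl, natDegree_X_sub_C, mul_one]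
    · refine finprod_mem_congr rfl fun F hF => ?_
      have hF' := h.mem_orbitFactors.2 (Or.inr (Or.inl hF))
      simp only [g, dif_pos hF']
      rw [hir ⟨F, hF'⟩ hF.1]
      ring
  · refine finprod_mem_congr rfl fun F hF => ?_
    have hF' := h.mem_orbitFactors.2 (Or.inr (Or.inr hF))
    simp only [g, dif_pos hF']
    obtain ⟨e1, e2⟩ := hred ⟨F, hF'⟩ hF.1
    simp only at e1 e2
    rw [e2]
    -- The exponent combines the nilpotent part (p^s - 1)d with the factor Q = p^(d/2) of the local
    -- count.
    have e3 : (2 * p ^ s - 1) * (F.natDegree / 2) =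
        (p ^ s - 1) * F.natDegree + F.natDegree / 2 := by
      obtain ⟨r, hr⟩ : ∃ r, p ^ s = r + 1 := ⟨p ^ s - 1, by omega⟩
      generalize F.natDegree / 2 = d at e1
      rw [e1, hr, Nat.add_sub_cancel, show 2 * (r + 1) - 1 = 2 * r + 1 by omega]
      ring
    rw [e3, pow_add]
    ring

/-! ### Coefficients, degrees and left division in 𝔽_{p²}[x; θ] -/

section SkewPolynomials

variable {p : ℕ} [Fact p.Prime]

theorem ofAdd_smul (i : ℕ) (a : Fq p) : Multiplicative.ofAdd i • a = (frob p)^[i] a :=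
  congrFun (coe_iterateFrobenius ..) a

theorem phi_iterate (i : ℕ) (a : Fq p) :
    (SkewPolynomial.φ (R := Fq p))^[i] a = (frob p)^[i] a := by
  rw [SkewPolynomial.φ_iterate_apply, ofAdd_smul]

theorem monomial_mul_monomial (n m : ℕ) (r s : Fq p) :
    SkewPolynomial.monomial n r * SkewPolynomial.monomial m s =
      SkewPolynomial.monomial (n + m) (r * (frob p)^[n] s) := by
  rw [SkewPolynomial.monomial_mul_monomial, phi_iterate]

theorem skewPoly_induction {motive : SkewPoly p → Prop} (a : SkewPoly p)
    (add : ∀ a b, motive a → motive b → motive (a + b))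
    (monomial : ∀ n r, motive (SkewPolynomial.monomial n r)) : motive a := by
  induction a using SkewPolynomial.induction with
  | h0 => simpa using monomial 0 0
  | ha n r a _ _ ha => exact add _ _ (monomial n r) ha

theorem coeff_monomial_mul (i : ℕ) (r : Fq p) (g : SkewPoly p) (m : ℕ) :
    SkewPolynomial.coeff (SkewPolynomial.monomial i r * g) m =
      if i ≤ m then r * (frob p)^[i] (SkewPolynomial.coeff g (m - i)) else 0 := by
  induction g using skewPoly_induction with
  | add a b ha hb =>
    rw [mul_add, SkewPolynomial.coeff_add, ha, hb, SkewPolynomial.coeff_add]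
    split_ifs
    · rw [iterate_map_add, mul_add]
    · rw [add_zero]
  | monomial n a =>
    rw [monomial_mul_monomial, SkewPolynomial.coeff_monomial, SkewPolynomial.coeff_monomial]
    by_cases h : i ≤ m
    · rw [if_pos h]
      by_cases h2 : n = m - i
      · rw [if_pos h2, if_pos (by omega)]
      · rw [if_neg h2, if_neg (by omega), iterate_map_zero, mul_zero]
    · rw [if_neg h, if_neg (by omega)]

theorem coeff_mul (a g : SkewPoly p) (m : ℕ) :
    SkewPolynomial.coeff (a * g) m = ∑ i ∈ Finset.range (m + 1),
      SkewPolynomial.coeff a i * (frob p)^[i] (SkewPolynomial.coeff g (m - i)) := by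
  induction a using skewPoly_induction with
  | add a b ha hb =>
    simp only [add_mul, SkewPolynomial.coeff_add, ha, hb, Finset.sum_add_distrib]
  | monomial n r =>
    simp only [coeff_monomial_mul, SkewPolynomial.coeff_monomial, ite_mul, zero_mul,
      Finset.sum_ite_eq, Finset.mem_range, Nat.lt_succ_iff]

theorem coeff_mul_C (a : SkewPoly p) (r : Fq p) (m : ℕ) :
    SkewPolynomial.coeff (a * SkewPolynomial.C r) m =
      SkewPolynomial.coeff a m * (frob p)^[m] r := by
  rw [coeff_mul, Finset.sum_eq_single m]
  · simp
  · intro i hi him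
    rw [Finset.mem_range] at hi
    rw [SkewPolynomial.coeff_C_ne_zero (by omega), iterate_map_zero, mul_zero]
  · simp

theorem coeff_C_mul (a : SkewPoly p) (r : Fq p) (m : ℕ) :
    SkewPolynomial.coeff (SkewPolynomial.C r * a) m = r * SkewPolynomial.coeff a m := by
  rw [← SkewPolynomial.monomial_zero_left, coeff_monomial_mul]
  simp

theorem coeff_X_mul (a : SkewPoly p) (m : ℕ) :
    SkewPolynomial.coeff (SkewPolynomial.X * a) (m + 1) = frob p (SkewPolynomial.coeff a m) := by
  rw [← SkewPolynomial.monomial_one_one_eq_X, coeff_monomial_mul]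
  simp

theorem coeff_X_mul_zero (a : SkewPoly p) :
    SkewPolynomial.coeff (SkewPolynomial.X * a) 0 = 0 := by
  rw [← SkewPolynomial.monomial_one_one_eq_X, coeff_monomial_mul]
  simp

theorem coeff_mul_X (a : SkewPoly p) (m : ℕ) :
    SkewPolynomial.coeff (a * SkewPolynomial.X) (m + 1) = SkewPolynomial.coeff a m := by
  rw [coeff_mul, Finset.sum_eq_single m]
  · simp
  · intro i hi him
    rw [Finset.mem_range] at hi
    rw [SkewPolynomial.coeff_X_of_ne_one (by omega), iterate_map_zero, mul_zero]
  · simp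

theorem coeff_mul_X_zero (a : SkewPoly p) :
    SkewPolynomial.coeff (a * SkewPolynomial.X) 0 = 0 := by
  simp [coeff_mul]

/-- `a` has degree `d`. -/
def HasDeg (a : SkewPoly p) (d : ℕ) : Prop :=
  SkewPolynomial.coeff a d ≠ 0 ∧ ∀ m, d < m → SkewPolynomial.coeff a m = 0

theorem HasDeg.unique {a : SkewPoly p} {d e : ℕ} (h : HasDeg a d) (h' : HasDeg a e) : d = e := by
  by_contra hne
  rcases Nat.lt_or_gt_of_ne hne with hlt | hlt
  · exact h'.1 (h.2 _ hlt)
  · exact h.1 (h'.2 _ hlt)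

theorem exists_hasDeg {a : SkewPoly p} (ha : a ≠ 0) : ∃ d, HasDeg a d := by
  have hne : a.support.Nonempty := by
    rw [Finset.nonempty_iff_ne_empty]
    exact fun h => ha (SkewPolynomial.support_eq_empty.1 h)
  refine ⟨a.support.max' hne, SkewPolynomial.mem_support_iff.1 (Finset.max'_mem _ _), ?_⟩
  intro m hm
  by_contra h
  exact absurd (Finset.le_max' _ _ (SkewPolynomial.mem_support_iff.2 h)) (not_le.2 hm)

theorem exists_coeff_eq_zero (a : SkewPoly p) :
    ∃ N, ∀ m, N ≤ m → SkewPolynomial.coeff a m = 0 := by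
  by_cases h : a = 0
  · exact ⟨0, fun m _ => by rw [h, SkewPolynomial.coeff_zero]⟩
  · obtain ⟨d, hd⟩ := exists_hasDeg h
    exact ⟨d + 1, fun m hm => hd.2 m (by omega)⟩

theorem HasDeg.mul {a b : SkewPoly p} {d e : ℕ} (ha : HasDeg a d) (hb : HasDeg b e) :
    HasDeg (a * b) (d + e) := by
  constructor
  · rw [coeff_mul, Finset.sum_eq_single d]
    · rw [Nat.add_sub_cancel_left]
      refine mul_ne_zero ha.1 ?_
      rw [← coe_iterateFrobenius, _root_.map_ne_zero]
      exact hb.1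
    · intro i _ hid
      rcases Nat.lt_or_gt_of_ne hid with hlt | hlt
      · rw [hb.2 _ (by omega), iterate_map_zero, mul_zero]
      · rw [ha.2 _ hlt, zero_mul]
    · intro h
      exact absurd (Finset.mem_range.2 (by omega)) h
  · intro m hm
    rw [coeff_mul]
    refine Finset.sum_eq_zero fun i _ => ?_
    by_cases hi : d < i
    · rw [ha.2 _ hi, zero_mul]
    · rw [hb.2 _ (by omega), iterate_map_zero, mul_zero]

/-- A monic element of least degree generates a left ideal. -/
theorem exists_monic_generator (J : Submodule (SkewPoly p) (SkewPoly p)) (hJ : J ≠ ⊥) :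
    ∃ g, IsMonicSkew g ∧ ∀ a, a ∈ J ↔ ∃ b, a = b * g := by
  classical
  obtain ⟨a₀, ha₀, hne⟩ := (Submodule.ne_bot_iff J).1 hJ
  have hex : ∃ d, ∃ a ∈ J, HasDeg a d := by
    obtain ⟨d, hd⟩ := exists_hasDeg hne
    exact ⟨d, a₀, ha₀, hd⟩
  set d := Nat.find hex with hd
  obtain ⟨a, haJ, had⟩ := Nat.find_spec hex
  rw [← hd] at had
  set g := SkewPolynomial.C (SkewPolynomial.coeff a d)⁻¹ * a with hg
  have hgJ : g ∈ J := J.smul_mem _ haJ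
  have hg1 : SkewPolynomial.coeff g d = 1 := by
    rw [hg, coeff_C_mul, inv_mul_cancel₀ had.1]
  have hg0 : ∀ m, d < m → SkewPolynomial.coeff g m = 0 := fun m hm => by
    rw [hg, coeff_C_mul, had.2 m hm, mul_zero]
  refine ⟨g, ⟨d, hg1, hg0⟩, fun b => ⟨fun hb => ?_, ?_⟩⟩
  · obtain ⟨N, hN⟩ := exists_coeff_eq_zero b
    induction N generalizing b with
    | zero =>
      refine ⟨0, ?_⟩
      rw [zero_mul]
      exact SkewPolynomial.ext fun m => hN m (Nat.zero_le m)
    | succ N ih =>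
      by_cases h0 : SkewPolynomial.coeff b N = 0
      · refine ih b hb fun m hm => ?_
        rcases eq_or_lt_of_le hm with rfl | hlt
        · exact h0
        · exact hN m hlt
      · have hdN : d ≤ N := Nat.find_min' hex ⟨b, hb, h0, fun m hm => hN m hm⟩
        -- Left division by the monic g: a left monomial multiple shifts g and keeps its leading
        -- coefficient 1 up to the scalar, so the top term of b cancels.
        obtain ⟨q, hq⟩ := ih
          (b - SkewPolynomial.monomial (N - d) (SkewPolynomial.coeff b N) * g)
          (J.sub_mem hb (J.smul_mem _ hgJ)) (by
            intro m hm
            rw [SkewPolynomial.coeff_sub, coeff_monomial_mul, if_pos (by omega)]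
            rcases eq_or_lt_of_le hm with rfl | hlt
            · rw [Nat.sub_sub_self hdN, hg1, iterate_map_one, mul_one, sub_self]
            · rw [hg0 _ (by omega), hN m hlt, iterate_map_zero, mul_zero, sub_zero])
        refine ⟨q + SkewPolynomial.monomial (N - d) (SkewPolynomial.coeff b N), ?_⟩
        rw [add_mul, ← hq, sub_add_cancel]
  · rintro ⟨b, rfl⟩
    exact J.smul_mem _ hgJ

end SkewPolynomials

/-! ### Words as skew polynomials -/

section Words

variable {p : ℕ} [Fact p.Prime] {n : ℕ}

theorem coeff_wordPoly (c : Fin n → Fq p) (m : ℕ) :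
    SkewPolynomial.coeff (wordPoly c) m = if h : m < n then c ⟨m, h⟩ else 0 := by
  have h1 : SkewPolynomial.coeff (wordPoly c) m =
      ∑ i : Fin n, SkewPolynomial.coeff (SkewPolynomial.monomial i.val (c i)) m :=
    map_sum (⟨⟨fun s => SkewPolynomial.coeff s m, rfl⟩, fun a b =>
      SkewPolynomial.coeff_add a b m⟩ : SkewPoly p →+ Fq p) _ _
  rw [h1]
  simp only [SkewPolynomial.coeff_monomial]
  split_ifs with h
  · rw [Finset.sum_eq_single ⟨m, h⟩]
    · simp
    · intro i _ hi
      rw [if_neg fun e => hi (Fin.ext e)]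
    · simp
  · refine Finset.sum_eq_zero fun i _ => if_neg ?_
    have := i.isLt
    omega

theorem exists_wordPoly_eq {a : SkewPoly p} (ha : ∀ m, n ≤ m → SkewPolynomial.coeff a m = 0) :
    ∃ c : Fin n → Fq p, wordPoly c = a := by
  refine ⟨fun i => SkewPolynomial.coeff a i, SkewPolynomial.ext fun m => ?_⟩
  rw [coeff_wordPoly]
  split_ifs with h
  · rfl
  · exact (ha m (not_lt.1 h)).symm

theorem wordPoly_add (c c' : Fin n → Fq p) : wordPoly (c + c') = wordPoly c + wordPoly c' := by
  simp only [wordPoly, Pi.add_apply, map_add, Finset.sum_add_distrib]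

theorem wordPoly_smul (r : Fq p) (c : Fin n → Fq p) :
    wordPoly (r • c) = SkewPolynomial.C r * wordPoly c := by
  simp only [wordPoly, Pi.smul_apply, smul_eq_mul, Finset.mul_sum, SkewPolynomial.C_mul_monomial]

/-- Multiplication by x creates one overflow term in x^n. Replacing x^n by l puts it in degree 0,
which is the wrap-around of the shift. -/
theorem X_mul_wordPoly (hn : 0 < n) (l : Fq p) (c : Fin n → Fq p) :
    SkewPolynomial.X * wordPoly c = wordPoly (skewShift (frob p) l c) +
      SkewPolynomial.C (frob p (c ⟨n - 1, by omega⟩)) *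
        (SkewPolynomial.X ^ n - SkewPolynomial.C l) := by
  refine SkewPolynomial.ext fun m => ?_
  rw [SkewPolynomial.coeff_add, coeff_C_mul, SkewPolynomial.coeff_sub,
    ← SkewPolynomial.monomial_one_right_eq_X_pow, SkewPolynomial.coeff_monomial, coeff_wordPoly]
  rcases m with _ | m
  · rw [coeff_X_mul_zero, SkewPolynomial.coeff_C_zero, dif_pos hn, if_neg (by omega), skewShift,
      if_pos rfl]
    ring
  · rw [coeff_X_mul, coeff_wordPoly, SkewPolynomial.coeff_C_succ]
    rcases lt_trichotomy (m + 1) n with h | h | h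
    · rw [dif_pos h, dif_pos (by omega), if_neg (by omega), skewShift, if_neg (by simp)]
      simp
    · subst h
      rw [dif_pos (by omega), dif_neg (by omega), if_pos rfl]
      simp
    · rw [dif_neg (by omega), dif_neg (by omega), if_neg (by omega)]
      simp

end Words

/-! ### The centre and the action on pairs of even and odd parts -/

section Action

variable {p : ℕ} [Fact p.Prime]

/-- A polynomial in `x ^ 2`. -/
def evenPoly : (Fq p)[X] →+* SkewPoly p :=
  eval₂RingHom' SkewPolynomial.CRingHom (SkewPolynomial.X ^ 2) (fun a => by
    change SkewPolynomial.C a * SkewPolynomial.X ^ 2 = SkewPolynomial.X ^ 2 * SkewPolynomial.C a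
    rw [← SkewPolynomial.monomial_one_right_eq_X_pow, ← SkewPolynomial.monomial_zero_left,
      monomial_mul_monomial, monomial_mul_monomial]
    simp only [Function.iterate_succ, Function.iterate_zero, Function.comp_apply, frob_frob, id,
      mul_one, one_mul, zero_add, add_zero])

theorem evenPoly_monomial (i : ℕ) (a : Fq p) :
    evenPoly (Polynomial.monomial i a) = SkewPolynomial.monomial (2 * i) a := by
  change eval₂ SkewPolynomial.CRingHom (SkewPolynomial.X ^ 2) (Polynomial.monomial i a) = _
  rw [eval₂_monomial, ← pow_mul]
  change SkewPolynomial.C a * SkewPolynomial.X ^ (2 * i) = _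
  rw [SkewPolynomial.C_mul_X_pow_eq_monomial]

theorem evenPoly_C (a : Fq p) : evenPoly (Polynomial.C a) = SkewPolynomial.C a :=
  evenPoly_monomial 0 a

theorem evenPoly_X_pow (i : ℕ) :
    evenPoly ((Polynomial.X : (Fq p)[X]) ^ i) = SkewPolynomial.X ^ (2 * i) := by
  rw [← SkewPolynomial.monomial_one_right_eq_X_pow, ← evenPoly_monomial,
    Polynomial.X_pow_eq_monomial]

theorem coeff_evenPoly (q : (Fq p)[X]) (m : ℕ) :
    SkewPolynomial.coeff (evenPoly q) m = if Even m then q.coeff (m / 2) else 0 := by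
  induction q using Polynomial.induction_on' with
  | add a b ha hb =>
    rw [map_add, SkewPolynomial.coeff_add, ha, hb, Polynomial.coeff_add]
    split_ifs <;> simp
  | monomial i a =>
    rw [evenPoly_monomial, SkewPolynomial.coeff_monomial, Polynomial.coeff_monomial]
    by_cases h : Even m
    · rw [if_pos h]
      obtain ⟨r, hr⟩ := h
      exact if_congr (by omega) rfl rfl
    · rw [if_neg h, if_neg]
      rintro rfl
      exact h (even_two_mul i)

theorem exists_even_odd (a : SkewPoly p) :
    ∃ E O : (Fq p)[X], a = evenPoly E + evenPoly O * SkewPolynomial.X := by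
  induction a using skewPoly_induction with
  | add a b ha hb =>
    obtain ⟨E, O, rfl⟩ := ha
    obtain ⟨E', O', rfl⟩ := hb
    exact ⟨E + E', O + O', by rw [map_add, map_add, add_mul]; abel⟩
  | monomial n r =>
    rcases Nat.even_or_odd' n with ⟨i, rfl | rfl⟩
    · exact ⟨Polynomial.monomial i r, 0, by rw [evenPoly_monomial, map_zero, zero_mul, add_zero]⟩
    · exact ⟨0, Polynomial.monomial i r, by
        rw [evenPoly_monomial, map_zero, zero_add, SkewPolynomial.monomial_mul_X]⟩

theorem mem_center_iff (a : SkewPoly p) : a ∈ Subring.center (SkewPoly p) ↔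
    (∀ r, SkewPolynomial.C r * a = a * SkewPolynomial.C r) ∧
      SkewPolynomial.X * a = a * SkewPolynomial.X := by
  rw [Subring.mem_center_iff]
  refine ⟨fun h => ⟨fun r => h _, h _⟩, fun h b => ?_⟩
  induction b using skewPoly_induction with
  | add b c hb hc => rw [add_mul, mul_add, hb, hc]
  | monomial n r =>
    rw [← SkewPolynomial.C_mul_X_pow_eq_monomial]
    have h1 : Commute (SkewPolynomial.C r) a := h.1 r
    have h2 : Commute SkewPolynomial.X a := h.2
    exact (h1.mul_left (h2.pow_left n)).eq

theorem evenPoly_ext_mem_center (f : (ZMod p)[X]) :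
    evenPoly (ext f) ∈ Subring.center (SkewPoly p) := by
  rw [mem_center_iff]
  have hf : ∀ i, frob p ((ext f).coeff i) = (ext f).coeff i := fun i => by
    have := congrArg (fun q => Polynomial.coeff q i) (map_map_algebraMap (frob p) f)
    simpa only [Polynomial.coeff_map] using this
  have hit : ∀ (i : ℕ) (r : Fq p), (frob p)^[i + i] r = r := fun i r => by
    rw [← two_mul, Function.iterate_mul]
    exact Function.iterate_fixed (frob_frob r) i
  constructor
  · intro r
    refine SkewPolynomial.ext fun m => ?_
    rw [coeff_C_mul, coeff_mul_C, coeff_evenPoly]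
    split_ifs with h
    · obtain ⟨i, rfl⟩ := h
      rw [hit, mul_comm]
    · simp
  · refine SkewPolynomial.ext fun m => ?_
    rcases m with _ | m
    · rw [coeff_X_mul_zero, coeff_mul_X_zero]
    · rw [coeff_X_mul, coeff_mul_X, coeff_evenPoly]
      split_ifs
      · exact hf _
      · simp

/-- Commuting with a scalar moved by Frobenius kills the odd coefficients, and commuting with x
makes the even ones fixed by Frobenius. -/
theorem exists_eq_evenPoly_of_mem_center {a : SkewPoly p} (ha : a ∈ Subring.center (SkewPoly p)) :
    ∃ E : (Fq p)[X], a = evenPoly E ∧ E.map (frob p) = E := by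
  obtain ⟨E, O, rfl⟩ := exists_even_odd a
  rw [mem_center_iff] at ha
  have hO : O = 0 := by
    obtain ⟨α, hα⟩ := exists_frob_ne (p := p)
    refine Polynomial.ext fun i => ?_
    have h1 := congrArg (fun s => SkewPolynomial.coeff s (2 * i + 1)) (ha.1 α)
    have h2 : (frob p)^[2 * i + 1] α = frob p α := by
      rw [Function.iterate_succ_apply, Function.iterate_mul]
      exact Function.iterate_fixed (frob_frob _) i
    simp only [coeff_C_mul, coeff_mul_C, SkewPolynomial.coeff_add, coeff_mul_X, coeff_evenPoly,
      h2, if_neg (show ¬ Even (2 * i + 1) by simp), if_pos (even_two_mul i), zero_add] at h1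
    rw [show 2 * i / 2 = i by omega] at h1
    have h3 : (α - frob p α) * O.coeff i = 0 := by linear_combination h1
    rw [Polynomial.coeff_zero]
    exact (mul_eq_zero.1 h3).resolve_left (sub_ne_zero.2 hα.symm)
  subst hO
  refine ⟨E, by simp, Polynomial.ext fun i => ?_⟩
  have h1 := congrArg (fun s => SkewPolynomial.coeff s (2 * i + 1)) ha.2
  simp only [map_zero, zero_mul, add_zero, coeff_X_mul, coeff_mul_X, coeff_evenPoly,
    if_pos (even_two_mul i)] at h1
  rw [show 2 * i / 2 = i by omega] at h1
  rw [Polynomial.coeff_map, h1]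

/-- Left multiplication by `x` on `𝔽_{p²}[x; θ] / (P(x²))`, written as pairs of even and odd
parts. -/
def xact (P : (ZMod p)[X]) : AddMonoid.End (Bq P × Bq P) where
  toFun v := (zq P * conj P v.2, conj P v.1)
  map_zero' := by simp
  map_add' a b := by
    ext <;> simp [mul_add]

theorem xact_apply (P : (ZMod p)[X]) (v : Bq P × Bq P) :
    xact P v = (zq P * conj P v.2, conj P v.1) := rfl

/-- Multiplication by scalars of `𝔽_{p²}` on pairs. -/
def scalarAct (P : (ZMod p)[X]) : Fq p →+* AddMonoid.End (Bq P × Bq P) :=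
  (Module.toAddMonoidEnd (Bq P) (Bq P × Bq P)).comp (AdjoinRoot.of (ext P))

theorem xact_mul_scalarAct (P : (ZMod p)[X]) (a : Fq p) :
    scalarAct P (frob p a) * xact P = xact P * scalarAct P a := by
  refine AddMonoidHom.ext fun v => ?_
  change AdjoinRoot.of (ext P) (frob p a) • xact P v = xact P (AdjoinRoot.of (ext P) a • v)
  rw [xact_apply, xact_apply]
  ext
  · simp only [Prod.smul_fst, Prod.smul_snd, smul_eq_mul, map_mul, conj_of]
    ring
  · simp only [Prod.smul_fst, Prod.smul_snd, smul_eq_mul, map_mul, conj_of]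

/-- The action of the skew polynomial ring on `𝔽_{p²}[x; θ] / (P(x²))`. -/
def polyAct (P : (ZMod p)[X]) : SkewPoly p →+* AddMonoid.End (Bq P × Bq P) :=
  SkewMonoidAlgebra.liftNCRingHom (scalarAct P) (powersHom _ (xact P)) (by
    intro a i
    induction i using Multiplicative.rec with | _ i => ?_
    rw [ofAdd_smul]
    change scalarAct P ((frob p)^[i] a) * xact P ^ i = xact P ^ i * scalarAct P a
    induction i with
    | zero => simp
    | succ i ih =>
      rw [Function.iterate_succ_apply', pow_succ', ← mul_assoc, xact_mul_scalarAct, mul_assoc, ih,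
        mul_assoc])

theorem polyAct_monomial (P : (ZMod p)[X]) (i : ℕ) (a : Fq p) :
    polyAct P (SkewPolynomial.monomial i a) = scalarAct P a * xact P ^ i :=
  SkewMonoidAlgebra.liftNC_single ..

theorem polyAct_X (P : (ZMod p)[X]) : polyAct P SkewPolynomial.X = xact P := by
  rw [← SkewPolynomial.monomial_one_one_eq_X, polyAct_monomial, map_one, one_mul, pow_one]

theorem polyAct_C (P : (ZMod p)[X]) (a : Fq p) :
    polyAct P (SkewPolynomial.C a) = scalarAct P a := by
  rw [← SkewPolynomial.monomial_zero_left, polyAct_monomial, pow_zero, mul_one]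

theorem xact_xact (P : (ZMod p)[X]) (v : Bq P × Bq P) : xact P (xact P v) = zq P • v := by
  rw [xact_apply, xact_apply]
  ext
  · simp only [conj_conj, Prod.smul_fst, smul_eq_mul]
  · simp only [map_mul, conj_conj, conj_root, Prod.smul_snd, smul_eq_mul]

theorem xact_pow_two_mul (P : (ZMod p)[X]) (i : ℕ) (v : Bq P × Bq P) :
    (xact P ^ (2 * i)) v = zq P ^ i • v := by
  induction i generalizing v with
  | zero => simp
  | succ i ih =>
    rw [mul_add, pow_add]
    change (xact P ^ (2 * i)) (xact P (xact P v)) = _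
    rw [xact_xact, ih, smul_smul, ← pow_succ]

theorem polyAct_evenPoly (P : (ZMod p)[X]) (E : (Fq p)[X]) (v : Bq P × Bq P) :
    polyAct P (evenPoly E) v = AdjoinRoot.mk (ext P) E • v := by
  induction E using Polynomial.induction_on' with
  | add a b ha hb => 
    rw [map_add, map_add, map_add, add_smul, ← ha, ← hb]
    rfl
  | monomial i a =>
    rw [evenPoly_monomial, polyAct_monomial, ← Polynomial.C_mul_X_pow_eq_monomial, map_mul,
      map_pow, AdjoinRoot.mk_X, AdjoinRoot.mk_C, mul_smul, ← xact_pow_two_mul]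
    rfl

/-- The class of a skew polynomial modulo `P(x²)`. -/
def residue (P : (ZMod p)[X]) : SkewPoly p →+ Bq P × Bq P where
  toFun a := polyAct P a (1, 0)
  map_zero' := by simp
  map_add' a b := by
    rw [map_add]
    rfl

theorem residue_mul (P : (ZMod p)[X]) (a b : SkewPoly p) :
    residue P (a * b) = polyAct P a (residue P b) := by
  change polyAct P (a * b) (1, 0) = polyAct P a (polyAct P b (1, 0))
  rw [map_mul]
  rfl

theorem residue_even_odd (P : (ZMod p)[X]) (E O : (Fq p)[X]) :
    residue P (evenPoly E + evenPoly O * SkewPolynomial.X) =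
      (AdjoinRoot.mk _ E, AdjoinRoot.mk _ O) := by
  rw [map_add, residue_mul]
  change polyAct P _ (1, 0) + polyAct P _ (polyAct P SkewPolynomial.X (1, 0)) = _
  rw [polyAct_X, polyAct_evenPoly, polyAct_evenPoly, xact_apply]
  ext <;> simp

end Action

/-! ### Skew constacyclic codes as x-stable submodules modulo P(x²) -/

section Modulus

variable {p : ℕ} [Fact p.Prime]

/-- `P = z ^ k - l` with `k > 0`. -/
structure IsModulus (k : ℕ) (l : Fq p) (P : (ZMod p)[X]) : Prop where
  pos : 0 < k
  eq : ext P = X ^ k - Polynomial.C l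

variable {k : ℕ} {l : Fq p} {P : (ZMod p)[X]}

theorem IsModulus.monic (h : IsModulus k l P) : (ext P).Monic := by
  rw [h.eq]
  exact monic_X_pow_sub_C l h.pos.ne'

theorem IsModulus.ne_zero (h : IsModulus k l P) : P ≠ 0 := fun h0 =>
  h.monic.ne_zero (by simp [h0])

theorem IsModulus.natDegree (h : IsModulus k l P) : P.natDegree = k := by
  have h1 := congrArg Polynomial.natDegree h.eq
  rwa [natDegree_map, natDegree_X_pow_sub_C] at h1

theorem IsModulus.root_pow (h : IsModulus k l P) : zq P ^ k = AdjoinRoot.of _ l := by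
  have h1 := AdjoinRoot.mk_self (f := ext P)
  have h2 : AdjoinRoot.mk (ext P) (X ^ k - Polynomial.C l) = 0 := by rw [← h.eq, h1]
  rwa [map_sub, map_pow, AdjoinRoot.mk_X, AdjoinRoot.mk_C, sub_eq_zero] at h2

theorem IsModulus.evenPoly_eq (h : IsModulus k l P) :
    evenPoly (ext P) = SkewPolynomial.X ^ (2 * k) - SkewPolynomial.C l := by
  simp only [h.eq, map_sub, evenPoly_X_pow, evenPoly_C]

theorem polyAct_mul_apply (P : (ZMod p)[X]) (a b : SkewPoly p) (v : Bq P × Bq P) :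
    polyAct P (a * b) v = polyAct P a (polyAct P b v) := by
  rw [map_mul]
  rfl

theorem polyAct_add_apply (P : (ZMod p)[X]) (a b : SkewPoly p) (v : Bq P × Bq P) :
    polyAct P (a + b) v = polyAct P a v + polyAct P b v := by
  rw [map_add]
  rfl

theorem polyAct_zero_apply (P : (ZMod p)[X]) (v : Bq P × Bq P) : polyAct P 0 v = 0 := by
  rw [map_zero]
  rfl

theorem polyAct_one_apply (P : (ZMod p)[X]) (v : Bq P × Bq P) : polyAct P 1 v = v := by
  rw [map_one]
  rfl

theorem polyAct_even_odd (P : (ZMod p)[X]) (E O : (Fq p)[X]) (v : Bq P × Bq P) :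
    polyAct P (evenPoly E + evenPoly O * SkewPolynomial.X) v =
      AdjoinRoot.mk (ext P) E • v + AdjoinRoot.mk (ext P) O • xact P v := by
  rw [polyAct_add_apply, polyAct_mul_apply, polyAct_X, polyAct_evenPoly, polyAct_evenPoly]

/-- P(x²) is central, so its left multiples are the polynomials whose even and odd parts are both
divisible by P. -/
theorem residue_eq_zero_iff (P : (ZMod p)[X]) (a : SkewPoly p) :
    residue P a = 0 ↔ ∃ b, a = b * evenPoly (ext P) := by
  have hc := (Subring.mem_center_iff.1 (evenPoly_ext_mem_center P))
  constructor
  · intro ha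
    obtain ⟨E, O, rfl⟩ := exists_even_odd a
    rw [residue_even_odd, Prod.mk_eq_zero, AdjoinRoot.mk_eq_zero, AdjoinRoot.mk_eq_zero] at ha
    obtain ⟨⟨E', hE⟩, ⟨O', hO⟩⟩ := ha
    refine ⟨evenPoly E' + evenPoly O' * SkewPolynomial.X, ?_⟩
    rw [hc, hE, hO, map_mul, map_mul, mul_add, mul_assoc]
  · rintro ⟨b, rfl⟩
    rw [hc, residue_mul, polyAct_evenPoly, AdjoinRoot.mk_self, zero_smul]

/-- The class of a word modulo `P(x²)`. -/
def toPair (P : (ZMod p)[X]) (k : ℕ) : (Fin (2 * k) → Fq p) →ₗ[Fq p] Bq P × Bq P where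
  toFun c := residue P (wordPoly c)
  map_add' c c' := by rw [wordPoly_add, map_add]
  map_smul' r c := by
    rw [wordPoly_smul, residue_mul, polyAct_C]
    change AdjoinRoot.of (ext P) r • residue P (wordPoly c) = r • residue P (wordPoly c)
    exact algebraMap_smul (Bq P) r (residue P (wordPoly c))

theorem IsModulus.toPair_surjective (h : IsModulus k l P) :
    Function.Surjective (toPair P k) := by
  rintro ⟨b, c⟩
  have hlt : ∀ b : Bq P, ∃ E : (Fq p)[X], AdjoinRoot.mk _ E = b ∧ ∀ i, k ≤ i → E.coeff i = 0 := by
    intro b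
    obtain ⟨E, rfl⟩ := AdjoinRoot.mk_surjective b
    refine ⟨E %ₘ ext P, ?_, fun i hi => ?_⟩
    · rw [AdjoinRoot.mk_eq_mk, modByMonic_eq_sub_mul_div]
      exact ⟨-(E /ₘ ext P), by ring⟩
    · refine coeff_eq_zero_of_degree_lt ((degree_modByMonic_lt _ h.monic).trans_le ?_)
      rw [h.eq, degree_X_pow_sub_C h.pos]
      exact_mod_cast hi
  obtain ⟨E, rfl, hE⟩ := hlt b
  obtain ⟨O, rfl, hO⟩ := hlt c
  obtain ⟨w, hw⟩ := exists_wordPoly_eq (n := 2 * k)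
    (a := evenPoly E + evenPoly O * SkewPolynomial.X) (by
      intro m hm
      rw [SkewPolynomial.coeff_add, coeff_evenPoly]
      have h1 : ∀ m, 2 * k ≤ m → (if Even m then E.coeff (m / 2) else 0) = 0 := fun m hm => by
        split_ifs
        · exact hE _ (by omega)
        · rfl
      rw [h1 m hm, zero_add]
      obtain ⟨r, rfl⟩ : ∃ r, m = r + 1 := ⟨m - 1, by have := h.pos; omega⟩
      rw [coeff_mul_X, coeff_evenPoly]
      split_ifs with he
      · obtain ⟨i, rfl⟩ := he
        exact hO _ (by omega)
      · rfl)
  refine ⟨w, ?_⟩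
  change residue P (wordPoly w) = _
  rw [hw, residue_even_odd]

theorem IsModulus.toPair_bijective (h : IsModulus k l P) : Function.Bijective (toPair P k) := by
  have := finite_Bq h.ne_zero
  refine h.toPair_surjective.bijective_of_nat_card_le ?_
  rw [Nat.card_prod, card_Bq h.ne_zero, h.natDegree, Nat.card_fun, card_Fq, Nat.card_fin, two_mul,
    pow_add]

theorem IsModulus.toPair_skewShift (h : IsModulus k l P) (c : Fin (2 * k) → Fq p) :
    toPair P k (skewShift (frob p) l c) = xact P (toPair P k c) := by
  have h1 := congrArg (residue P) (X_mul_wordPoly (by have := h.pos; omega) l c)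
  rw [← h.evenPoly_eq, map_add, (residue_eq_zero_iff P (_ * evenPoly (ext P))).2 ⟨_, rfl⟩,
    add_zero, residue_mul, polyAct_X] at h1
  exact h1.symm

/-- The code of the words whose class lies in `N`. -/
def code (k : ℕ) (N : Submodule (Bq P) (Bq P × Bq P)) :
    Submodule (Fq p) (Fin (2 * k) → Fq p) :=
  (N.restrictScalars (Fq p)).comap (toPair P k)

theorem mem_code {N : Submodule (Bq P) (Bq P × Bq P)} {c : Fin (2 * k) → Fq p} :
    c ∈ code k N ↔ toPair P k c ∈ N := Iff.rfl

theorem IsModulus.code_injective (h : IsModulus k l P) :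
    Function.Injective (code (P := P) k) := by
  intro N N' hN
  refine Submodule.ext fun v => ?_
  obtain ⟨c, rfl⟩ := h.toPair_surjective v
  rw [← mem_code, hN, mem_code]

theorem IsModulus.card_code (h : IsModulus k l P) (N : Submodule (Bq P) (Bq P × Bq P)) :
    Nat.card (code k N) = Nat.card N :=
  Nat.card_congr ((Equiv.ofBijective _ h.toPair_bijective).subtypeEquiv fun _ => Iff.rfl)

theorem IsModulus.finrank_code_eq_iff (h : IsModulus k l P)
    (N : Submodule (Bq P) (Bq P × Bq P)) :
    Module.finrank (Fq p) (code k N) = k ↔ Nat.card N = Nat.card (Bq P) := by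
  rw [← h.card_code, card_Bq h.ne_zero, h.natDegree, Module.natCard_eq_pow_finrank (K := Fq p),
    card_Fq]
  refine ⟨fun e => by rw [e], fun e => Nat.pow_right_injective ?_ e⟩
  have := (Fact.out : p.Prime).two_le
  nlinarith

/-- The submodule generated by the class of a skew polynomial. -/
def leftIdeal (P : (ZMod p)[X]) (g : SkewPoly p) : Submodule (Bq P) (Bq P × Bq P) where
  carrier := {v | ∃ b, polyAct P b (residue P g) = v}
  zero_mem' := ⟨0, polyAct_zero_apply P _⟩
  add_mem' := by
    rintro _ _ ⟨a, rfl⟩ ⟨b, rfl⟩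
    exact ⟨a + b, polyAct_add_apply P a b _⟩
  smul_mem' := by
    rintro y _ ⟨a, rfl⟩
    obtain ⟨E, rfl⟩ := AdjoinRoot.mk_surjective y
    exact ⟨evenPoly E * a, by rw [polyAct_mul_apply, polyAct_evenPoly]⟩

theorem mem_leftIdeal {g : SkewPoly p} {v : Bq P × Bq P} :
    v ∈ leftIdeal P g ↔ ∃ b, polyAct P b (residue P g) = v := Iff.rfl

theorem xact_mem_leftIdeal {g : SkewPoly p} {v : Bq P × Bq P} (hv : v ∈ leftIdeal P g) :
    xact P v ∈ leftIdeal P g := by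
  obtain ⟨b, rfl⟩ := hv
  exact ⟨SkewPolynomial.X * b, by rw [polyAct_mul_apply, polyAct_X]⟩

theorem IsModulus.eq_code_of_isSkewGenerator (h : IsModulus k l P)
    {D : Submodule (Fq p) (Fin (2 * k) → Fq p)} {g : SkewPoly p} (hg : IsSkewGenerator l D g) :
    D = code k (leftIdeal P g) := by
  obtain ⟨-, ⟨q, hq⟩, hD⟩ := hg
  refine Submodule.ext fun c => ?_
  rw [hD, mem_code, mem_leftIdeal]
  constructor
  · rintro ⟨b, hb⟩
    refine ⟨b, ?_⟩
    rw [← residue_mul, ← hb]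
    rfl
  · rintro ⟨b, hb⟩
    have h1 : residue P (wordPoly c - b * g) = 0 := by
      rw [map_sub, residue_mul, hb, sub_eq_zero]
      rfl
    obtain ⟨r, hr⟩ := (residue_eq_zero_iff P _).1 h1
    -- The error is a multiple of P(x²) = x^(2k) - l, which is itself a left multiple of g and can
    -- be absorbed.
    refine ⟨b + r * q, ?_⟩
    rw [add_mul, mul_assoc, hq, ← h.evenPoly_eq, ← hr]
    abel

theorem polyAct_mem {N : Submodule (Bq P) (Bq P × Bq P)} (hN : ∀ v ∈ N, xact P v ∈ N)
    (a : SkewPoly p) {v : Bq P × Bq P} (hv : v ∈ N) : polyAct P a v ∈ N := by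
  obtain ⟨E, O, rfl⟩ := exists_even_odd a
  rw [polyAct_even_odd]
  exact N.add_mem (N.smul_mem _ hv) (N.smul_mem _ (hN v hv))

/-- The preimage of N in the skew polynomial ring is a left ideal containing P(x²) ≠ 0. Its monic
generator right-divides x^(2k) - l. -/
theorem IsModulus.exists_isSkewGenerator (h : IsModulus k l P)
    {N : Submodule (Bq P) (Bq P × Bq P)} (hN : ∀ v ∈ N, xact P v ∈ N) :
    ∃ g, IsSkewGenerator l (code k N) g ∧ ∀ a, residue P a ∈ N ↔ ∃ b, a = b * g := by
  let J : Submodule (SkewPoly p) (SkewPoly p) :=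
    { carrier := {a | residue P a ∈ N}
      zero_mem' := by
        change residue P 0 ∈ N
        rw [map_zero]
        exact N.zero_mem
      add_mem' := by
        intro a b ha hb
        change residue P (a + b) ∈ N
        rw [map_add]
        exact N.add_mem ha hb
      smul_mem' := by
        intro a b hb
        change residue P (a * b) ∈ N
        rw [residue_mul]
        exact polyAct_mem hN a hb }
  have h0 : evenPoly (ext P) ∈ J := by
    change residue P _ ∈ N
    rw [(residue_eq_zero_iff P _).2 ⟨1, (one_mul _).symm⟩]
    exact N.zero_mem
  have hJ : J ≠ ⊥ := by
    intro e
    rw [e, Submodule.mem_bot] at h0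
    have h1 := congrArg (fun a => SkewPolynomial.coeff a (2 * k)) h0
    have h2 := h.monic.coeff_natDegree
    rw [natDegree_map, h.natDegree] at h2
    simp only [coeff_evenPoly, if_pos (even_two_mul k), SkewPolynomial.coeff_zero] at h1
    rw [show 2 * k / 2 = k by omega, h2] at h1
    exact one_ne_zero h1
  obtain ⟨g, hg, hgJ⟩ := exists_monic_generator J hJ
  obtain ⟨q, hq⟩ := (hgJ _).1 h0
  exact ⟨g, ⟨hg, ⟨q, by rw [← hq, h.evenPoly_eq]⟩, fun c => hgJ _⟩, hgJ⟩

theorem residue_surjective (P : (ZMod p)[X]) : Function.Surjective (residue P) := by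
  rintro ⟨b, c⟩
  obtain ⟨E, rfl⟩ := AdjoinRoot.mk_surjective b
  obtain ⟨O, rfl⟩ := AdjoinRoot.mk_surjective c
  exact ⟨_, residue_even_odd P E O⟩

end Modulus

/-! ### Admissible codes as lines spanned by eigenvectors of x -/

section GeneratorPair

variable {p : ℕ} [Fact p.Prime] {k : ℕ} {l : Fq p} {P : (ZMod p)[X]} {u : Bq P}

/-- The pair generating the class of a code of dimension `k`, where `u * conj u = z`. -/
def genPair (u w : Bq P) : Bq P × Bq P := (u * conj P w, -w)

/-- The shape of `genPair` is chosen for this: x(uw̄ - wx) = ūwx - zw̄ = -ū(uw̄ - wx), so its span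
over 𝔽_{p²}[z]/(P) is stable under x. -/
theorem xact_smul_genPair (hu : u * conj P u = zq P) (y w : Bq P) :
    xact P (y • genPair u w) = (-(conj P y * conj P u)) • genPair u w := by
  rw [xact_apply]
  ext
  · simp only [genPair, Prod.smul_fst, Prod.smul_snd, smul_eq_mul, map_mul, map_neg]
    linear_combination (conj P y * conj P w) * hu
  · simp only [genPair, Prod.smul_fst, Prod.smul_snd, smul_eq_mul, map_mul, conj_conj]
    ring

theorem xact_mem_span_genPair (hu : u * conj P u = zq P) (w : Bq P) :
    ∀ v ∈ Submodule.span (Bq P) {genPair u w},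
      xact P v ∈ Submodule.span (Bq P) {genPair u w} := by
  intro v hv
  obtain ⟨y, rfl⟩ := Submodule.mem_span_singleton.1 hv
  rw [xact_smul_genPair hu]
  exact Submodule.smul_mem _ _ (Submodule.mem_span_singleton_self _)

theorem isUnit_of_mul_conj_eq (hz : IsUnit (zq P)) (hu : u * conj P u = zq P) : IsUnit u :=
  isUnit_of_mul_isUnit_left (by rwa [hu])

theorem eq_zero_of_mul_eq_zero {y w : Bq P} (hw : IsCoprime w (conj P w)) (h1 : y * w = 0)
    (h2 : y * conj P w = 0) : y = 0 := by
  obtain ⟨a, b, hab⟩ := hw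
  linear_combination a * h1 + b * h2 - y * hab

theorem eq_zero_of_smul_genPair (hu : IsUnit u) {y w : Bq P} (hw : IsCoprime w (conj P w))
    (h : y • genPair u w = 0) : y = 0 := by
  rw [genPair, Prod.smul_mk, Prod.mk_eq_zero, smul_eq_mul, smul_eq_mul] at h
  refine eq_zero_of_mul_eq_zero hw (by linear_combination -h.2) (hu.mul_left_cancel ?_)
  linear_combination h.1

theorem card_span_genPair (hu : IsUnit u) {w : Bq P} (hw : IsCoprime w (conj P w)) :
    Nat.card (Submodule.span (Bq P) {genPair u w}) = Nat.card (Bq P) := by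
  refine (Nat.card_congr (Equiv.ofBijective (fun y : Bq P =>
    (⟨y • genPair u w, Submodule.mem_span_singleton.2 ⟨y, rfl⟩⟩ :
      Submodule.span (Bq P) {genPair u w})) ⟨?_, ?_⟩)).symm
  · intro y y' h
    have h1 : y • genPair u w = y' • genPair u w := congrArg Subtype.val h
    rw [← sub_eq_zero, ← sub_smul] at h1
    exact sub_eq_zero.1 (eq_zero_of_smul_genPair hu hw h1)
  · rintro ⟨v, hv⟩
    obtain ⟨y, rfl⟩ := Submodule.mem_span_singleton.1 hv
    exact ⟨y, rfl⟩

/-- A central divisor f of g is a polynomial in x² whose class φ is fixed by conjugation and divides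
both w and its conjugate, so φ is a unit. Then the cofactor g' already lies in the ideal, hence is a
left multiple of g = fg', and comparing degrees makes f constant. -/
theorem not_hasCentralDivisor {w : Bq P}
    (hw : IsCoprime w (conj P w)) {g : SkewPoly p} (hg0 : g ≠ 0)
    (hg : ∀ a, residue P a ∈ Submodule.span (Bq P) {genPair u w} ↔ ∃ b, a = b * g) :
    ¬ HasCentralDivisor g := by
  rintro ⟨f, hf, hfC, g', rfl⟩
  have hc := Subring.mem_center_iff.1 hf
  obtain ⟨E, rfl, hE⟩ := exists_eq_evenPoly_of_mem_center hf
  set φ := AdjoinRoot.mk (ext P) E with hφ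
  have hφc : conj P φ = φ := by
    rw [hφ, conj, AdjoinRoot.map, AdjoinRoot.lift_mk, ← eval₂_map, hE]
    exact AdjoinRoot.aeval_eq E
  obtain ⟨a, ha⟩ := residue_surjective P (genPair u w)
  obtain ⟨b, hb⟩ := (hg a).1 (by rw [ha]; exact Submodule.mem_span_singleton_self _)
  have h1 : genPair u w = φ • residue P (b * g') := by
    rw [← ha, hb, ← mul_assoc, hc, mul_assoc, residue_mul, polyAct_evenPoly]
  have hd1 : φ ∣ w := by
    have := congrArg Prod.snd h1
    exact ⟨-(residue P (b * g')).2, by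
      rw [genPair, Prod.smul_snd, smul_eq_mul] at this
      linear_combination -this⟩
  have hd2 : φ ∣ conj P w := by
    have := map_dvd (conj P) hd1
    rwa [hφc] at this
  have hφu : IsUnit φ := hw.isUnit_of_dvd' hd1 hd2
  have h2 : residue P g' ∈ Submodule.span (Bq P) {genPair u w} := by
    have h3 := (hg (evenPoly E * g')).2 ⟨1, (one_mul _).symm⟩
    rw [residue_mul, polyAct_evenPoly] at h3
    obtain ⟨ψ, hψ⟩ := hφu.exists_left_inv
    have h4 := Submodule.smul_mem _ ψ h3
    rwa [smul_smul, hψ, one_smul] at h4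
  obtain ⟨c, hc'⟩ := (hg g').1 h2
  have hE0 : evenPoly E ≠ 0 := fun e => hg0 (by rw [e, zero_mul])
  have hg'0 : g' ≠ 0 := fun e => hg0 (by rw [e, mul_zero])
  have hc0 : c ≠ 0 := fun e => hg'0 (by rw [hc', e, zero_mul])
  obtain ⟨d, hd⟩ := exists_hasDeg hE0
  obtain ⟨d', hd'⟩ := exists_hasDeg hg'0
  obtain ⟨e, he⟩ := exists_hasDeg hc0
  have h5 := he.mul (hd.mul hd')
  rw [← hc'] at h5
  have h6 := h5.unique hd'
  have h7 : d = 0 := by omega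
  refine hfC ⟨SkewPolynomial.coeff (evenPoly E) 0, SkewPolynomial.ext fun m => ?_⟩
  rcases m with _ | m
  · rw [SkewPolynomial.coeff_C_zero]
  · rw [SkewPolynomial.coeff_C_succ, hd.2 _ (by omega)]

theorem IsModulus.isAdmissible_code (h : IsModulus k l P) (hz : IsUnit (zq P))
    (hu : u * conj P u = zq P) {w : Bq P} (hw : IsCoprime w (conj P w)) :
    IsAdmissible k l (code k (Submodule.span (Bq P) {genPair u w})) := by
  refine ⟨(h.finrank_code_eq_iff _).2 (card_span_genPair (isUnit_of_mul_conj_eq hz hu) hw), ?_⟩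
  obtain ⟨g, hg, hgN⟩ := h.exists_isSkewGenerator (xact_mem_span_genPair hu w)
  refine ⟨g, hg, not_hasCentralDivisor hw ?_ hgN⟩
  rintro rfl
  obtain ⟨⟨d, hd, -⟩, -⟩ := hg
  exact zero_ne_one hd

theorem hasCentralDivisor_of_proj_eq_zero {f : (ZMod p)[X]} (hf : Irreducible f) (hfP : f ∣ P)
    {g : SkewPoly p} (h1 : proj hfP (residue P g).1 = 0) (h2 : proj hfP (residue P g).2 = 0) :
    HasCentralDivisor g := by
  refine ⟨evenPoly (ext f), evenPoly_ext_mem_center f, ?_, ?_⟩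
  · rintro ⟨a, ha⟩
    have h3 := congrArg (fun s => SkewPolynomial.coeff s (2 * f.natDegree)) ha
    simp only [coeff_evenPoly, if_pos (even_two_mul f.natDegree)] at h3
    rw [SkewPolynomial.coeff_C_ne_zero (by have := hf.natDegree_pos; omega),
      show 2 * f.natDegree / 2 = f.natDegree by omega, coeff_map, coeff_natDegree] at h3
    exact hf.ne_zero (leadingCoeff_eq_zero.1
      ((map_eq_zero_iff _ (algebraMap (ZMod p) (Fq p)).injective).1 h3.symm))
  · obtain ⟨E, O, rfl⟩ := exists_even_odd g
    rw [residue_even_odd, proj_mk, AdjoinRoot.mk_eq_zero] at h1 h2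
    obtain ⟨E', rfl⟩ := h1
    obtain ⟨O', rfl⟩ := h2
    exact ⟨evenPoly E' + evenPoly O' * SkewPolynomial.X, by
      rw [map_mul, map_mul, mul_add, mul_assoc]⟩

/-- Adding to a multiple of v a suitable multiple of xv produces an eigenvector of the required
shape, so every x-stable submodule containing v contains these pairs. -/
theorem genPair_eq (hu : u * conj P u = zq P) (v : Bq P × Bq P) (y : Bq P) :
    genPair u (u * conj P y * v.2 - y * conj P v.1) =
      (-(u * conj P y)) • v + y • xact P v := by
  rw [xact_apply]
  ext
  · simp only [genPair, map_sub, map_mul, conj_conj, Prod.fst_add, Prod.smul_fst, smul_eq_mul]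
    linear_combination (y * conj P v.2) * hu
  · simp only [genPair, Prod.snd_add, Prod.smul_snd, smul_eq_mul]
    ring

theorem smul_genPair {a : Bq P} (ha : conj P a = a) (w : Bq P) :
    a • genPair u w = genPair u (a * w) := by
  rw [genPair, genPair, Prod.smul_mk, map_mul, ha, smul_eq_mul, smul_eq_mul]
  congr 1 <;> ring

theorem genPair_add (w w' : Bq P) : genPair u (w + w') = genPair u w + genPair u w' := by
  rw [genPair, genPair, genPair, map_add, Prod.mk_add_mk]
  congr 1 <;> ring

/-- Some pair of the form `genPair u w` survives modulo `f`, unless `f` divides everything. -/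
theorem exists_genPair_mem (hz : IsUnit (zq P)) (hu : u * conj P u = zq P) {f : (ZMod p)[X]}
    (hf : f ∣ P) {N : Submodule (Bq P) (Bq P × Bq P)} (hN : ∀ v ∈ N, xact P v ∈ N)
    {v : Bq P × Bq P} (hv : v ∈ N) (hne : ¬ (proj hf v.1 = 0 ∧ proj hf v.2 = 0)) :
    ∃ w, genPair u w ∈ N ∧ proj hf w ≠ 0 := by
  by_contra! hcon
  have key : ∀ y : Bq P, proj hf (u * conj P y * v.2 - y * conj P v.1) = 0 := fun y =>
    hcon _ (by
      rw [genPair_eq hu]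
      exact N.add_mem (N.smul_mem _ hv) (N.smul_mem _ (hN v hv)))
  obtain ⟨α, hα⟩ := exists_isUnit_sub_conj P
  set A := AdjoinRoot.of (ext P) α
  -- Scalars y = 1 and y = α, with α moved by conjugation, separate the two components of v.
  have h1 := key 1
  have h2 := key A
  simp only [map_sub, map_mul, map_one, one_mul, mul_one] at h1 h2
  have h3 : proj hf ((A - conj P A) * u) * proj hf v.2 = 0 := by
    rw [map_mul, map_sub]
    linear_combination proj hf A * h1 - h2
  have h4 : proj hf v.2 = 0 :=
    (((hα.mul (isUnit_of_mul_conj_eq hz hu)).map (proj hf)).mul_right_eq_zero).1 h3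
  have h5 : proj hf (conj P v.1) = 0 := by
    rw [h4] at h1
    linear_combination -h1
  refine hne ⟨?_, h4⟩
  rw [proj_conj] at h5
  rw [← conj_conj f (proj hf v.1), h5, map_zero]

/-- Write w = a + αb over the residue field. If b ≠ 0, the difference of w and its conjugate is the
unit (α - frob α)b; otherwise w = a is itself a unit. -/
theorem isCoprime_conj_of_irreducible {f : (ZMod p)[X]} (hf : Irreducible f) {w : Bq f}
    (hw : w ≠ 0) : ∃ x y, x * w + y * conj f w = 1 := by
  have : Fact (Irreducible f) := ⟨hf⟩
  obtain ⟨α, hα⟩ := exists_frob_ne (p := p)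
  obtain ⟨a, b, rfl⟩ := exists_eq_incl_add hf.ne_zero hα w
  have h1 : IsUnit (AdjoinRoot.of (ext f) α - AdjoinRoot.of (ext f) (frob p α)) := by
    rw [← map_sub]
    exact (sub_ne_zero.2 hα.symm).isUnit.map _
  by_cases hb : b = 0
  · subst hb
    have ha : a ≠ 0 := by
      rintro rfl
      simp at hw
    obtain ⟨x, hx⟩ := (ha.isUnit.map (incl f)).exists_left_inv
    exact ⟨x, 0, by rw [map_zero, mul_zero, add_zero, hx, zero_mul, add_zero]⟩
  · obtain ⟨x, hx⟩ := (h1.mul (((Ne.isUnit hb)).map (incl f))).exists_left_inv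
    refine ⟨x, -x, ?_⟩
    rw [map_add, map_mul, conj_of, conj_incl, conj_incl]
    linear_combination hx

variable {I : Finset (ZMod p)[X]} {m : ℕ}

theorem IsCoprimeFactorization.isCoprime_conj (hI : IsCoprimeFactorization I m P)
    (hirr : ∀ F ∈ I, Irreducible F) {w : Bq P} (hw : ∀ F : I, proj (hI.dvd F.2) w ≠ 0) :
    IsCoprime w (conj P w) := by
  choose x y hxy using fun F : I => isCoprime_conj_of_irreducible (hirr F F.2) (hw F)
  obtain ⟨X, hX⟩ := hI.exists_proj_eq x
  obtain ⟨Y, hY⟩ := hI.exists_proj_eq y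
  have h1 : IsUnit (X * w + Y * conj P w) := by
    rw [hI.isUnit_iff]
    intro F
    rw [map_add, map_mul, map_mul, hX, hY, proj_conj, hxy]
    exact isUnit_one
  obtain ⟨c, hc⟩ := h1.exists_left_inv
  exact ⟨c * X, c * Y, by linear_combination hc⟩

/-- The local choices of w are glued with elements that are 1 at one factor and 0 at the others.
These are made conjugation-invariant by a trace, because `genPair` is linear only over the fixed
ring. -/
theorem IsCoprimeFactorization.exists_genPair_mem (hI : IsCoprimeFactorization I m P)
    {N : Submodule (Bq P) (Bq P × Bq P)}
    (hex : ∀ F : I, ∃ w, genPair u w ∈ N ∧ proj (hI.dvd F.2) w ≠ 0) :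
    ∃ w, genPair u w ∈ N ∧ ∀ F : I, proj (hI.dvd F.2) w ≠ 0 := by
  classical
  choose w hw hne using hex
  choose W hW using fun F : I => hI.exists_proj_eq (fun G : I => if G = F then 1 else 0)
  obtain ⟨β, hβ⟩ := exists_add_frob_eq_one (p := p)
  let e : I → Bq P := fun F => AdjoinRoot.of _ β * W F + conj P (AdjoinRoot.of _ β * W F)
  have he : ∀ F, conj P (e F) = e F := fun F => by
    simp only [e, map_add, conj_conj, add_comm]
  have hpe : ∀ F G : I, proj (hI.dvd G.2) (e F) = if G = F then 1 else 0 := fun F G => by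
    simp only [e, map_add, map_mul, proj_conj, proj_of, hW, conj_of]
    split_ifs
    · rw [map_one, mul_one, mul_one, ← map_add, hβ, map_one]
    · rw [map_zero, mul_zero, mul_zero, add_zero]
  refine ⟨∑ F, e F * w F, ?_, fun G => ?_⟩
  · have h1 : genPair u (∑ F, e F * w F) = ∑ F, e F • genPair u (w F) := by
      let φ : Bq P →+ Bq P × Bq P := AddMonoidHom.mk' (genPair u) genPair_add
      refine (map_sum φ _ _).trans (Finset.sum_congr rfl fun F _ => ?_)
      exact (smul_genPair (he F) _).symm
    rw [h1]
    exact N.sum_mem fun F _ => N.smul_mem _ (hw F)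
  · rw [map_sum, Finset.sum_eq_single G]
    · rw [map_mul, hpe, if_pos rfl, one_mul]
      exact hne G
    · intro F _ hF
      rw [map_mul, hpe, if_neg (Ne.symm hF), zero_mul]
    · simp

/-- Absence of central divisors means that g survives modulo every irreducible factor, which yields
a w coprime to its conjugate with its line inside the ideal. Dimension k says that the ideal has no
more elements than the line. -/
theorem IsModulus.isAdmissible_iff (h : IsModulus k l P) (hI : IsCoprimeFactorization I m P)
    (hirr : ∀ F ∈ I, Irreducible F) (hz : IsUnit (zq P)) (hu : u * conj P u = zq P)
    (D : Submodule (Fq p) (Fin (2 * k) → Fq p)) :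
    IsAdmissible k l D ↔
      ∃ w, IsCoprime w (conj P w) ∧ D = code k (Submodule.span (Bq P) {genPair u w}) := by
  constructor
  · rintro ⟨hk, g, hg, hcen⟩
    obtain rfl := h.eq_code_of_isSkewGenerator hg
    have hN : ∀ v ∈ leftIdeal P g, xact P v ∈ leftIdeal P g := fun v => xact_mem_leftIdeal
    have hgN : residue P g ∈ leftIdeal P g := ⟨1, polyAct_one_apply P _⟩
    obtain ⟨w, hwN, hw⟩ := hI.exists_genPair_mem (u := u) (N := leftIdeal P g) fun F =>
      SkewLCD.exists_genPair_mem hz hu (hI.dvd F.2) hN hgN fun h0 =>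
        hcen (hasCentralDivisor_of_proj_eq_zero (hirr F F.2) _ h0.1 h0.2)
    have hcop := hI.isCoprime_conj hirr hw
    refine ⟨w, hcop, ?_⟩
    have := finite_Bq h.ne_zero
    have hle : Submodule.span (Bq P) {genPair u w} ≤ leftIdeal P g :=
      (Submodule.span_singleton_le_iff_mem _ _).2 hwN
    have hcard : Nat.card (leftIdeal P g) =
        Nat.card (Submodule.span (Bq P) {genPair u w}) := by
      rw [(h.finrank_code_eq_iff _).1 hk, card_span_genPair (isUnit_of_mul_conj_eq hz hu) hcop]
    have heq : Submodule.span (Bq P) {genPair u w} = leftIdeal P g :=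
      SetLike.coe_injective (Set.eq_of_subset_of_ncard_le hle
        (by exact hcard.le) (Set.toFinite _))
    rw [heq]
  · rintro ⟨w, hw, rfl⟩
    exact h.isAdmissible_code hz hu hw

end GeneratorPair

/-! ### The LCD condition as invertibility of a form value -/

section LCD

variable {p : ℕ} [Fact p.Prime] {k : ℕ} {l : Fq p} {P : (ZMod p)[X]} {u : Bq P}

/-- The coefficient of `1` of the reduced representative. -/
def IsModulus.constCoeff (h : IsModulus k l P) : Bq P →ₗ[Fq p] Fq p :=
  (lcoeff (Fq p) 0).comp (AdjoinRoot.modByMonicHom h.monic)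

theorem IsModulus.constCoeff_of_mul (h : IsModulus k l P) (a : Fq p) (x : Bq P) :
    h.constCoeff (AdjoinRoot.of _ a * x) = a * h.constCoeff x := by
  rw [← AdjoinRoot.algebraMap_eq, ← Algebra.smul_def, map_smul, smul_eq_mul]

theorem IsModulus.constCoeff_root_pow (h : IsModulus k l P) {i : ℕ} (hi : i < k) :
    h.constCoeff (zq P ^ i) = if i = 0 then 1 else 0 := by
  have h1 : zq P ^ i = AdjoinRoot.mk (ext P) (X ^ i) := by rw [map_pow, AdjoinRoot.mk_X]
  rw [h1, IsModulus.constCoeff, LinearMap.comp_apply,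
    AdjoinRoot.modByMonicHom_mk, (modByMonic_eq_self_iff h.monic).2, lcoeff_apply, coeff_X_pow]
  · exact if_congr eq_comm rfl rfl
  · rw [degree_X_pow, h.eq, degree_X_pow_sub_C h.pos]
    exact_mod_cast hi

theorem IsModulus.constCoeff_root_pow_mul (h : IsModulus k l P) (hs : SelfRecip (2 * k) P)
    {i j : ℕ} (hi : i < k) (hj : j < k) :
    h.constCoeff (zq P ^ i * (zq P ^ (2 * k - 1)) ^ j) = if i = j then 1 else 0 := by
  have h1 : (zq P ^ (2 * k - 1)) ^ j * zq P ^ j = 1 := by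
    rw [← mul_pow, mul_comm, hs.root_mul, one_pow]
  by_cases hij : j ≤ i
  · have h2 : zq P ^ i * (zq P ^ (2 * k - 1)) ^ j = zq P ^ (i - j) := by
      obtain ⟨r, rfl⟩ := Nat.exists_eq_add_of_le hij
      rw [Nat.add_sub_cancel_left, pow_add]
      linear_combination zq P ^ r * h1
    rw [h2, h.constCoeff_root_pow (by omega)]
    exact if_congr (by omega) rfl rfl
  -- For i < j the exponent i - j is negative. Since z^k = l and l² = 1, the product is l·z^(k+i-j)
  -- with 0 < k + i - j < k, so its constant coefficient vanishes.
  · have h2 : zq P ^ i * (zq P ^ (2 * k - 1)) ^ j = AdjoinRoot.of _ l * zq P ^ (k + i - j) := by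
      have h3 : zq P ^ (k + i - j) * zq P ^ j = AdjoinRoot.of _ l * zq P ^ i := by
        rw [← pow_add, Nat.sub_add_cancel (by omega), pow_add, h.root_pow]
      have h4 : AdjoinRoot.of (ext P) l * AdjoinRoot.of (ext P) l = 1 := by
        rw [← h.root_pow, ← pow_add, ← two_mul, hs.root_pow]
      linear_combination (-zq P ^ i * (zq P ^ (2 * k - 1)) ^ j) * h4 -
        AdjoinRoot.of (ext P) l * (zq P ^ (2 * k - 1)) ^ j * h3 +
        AdjoinRoot.of (ext P) l * zq P ^ (k + i - j) * h1
    rw [h2, h.constCoeff_of_mul, h.constCoeff_root_pow (by omega), if_neg (by omega), mul_zero,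
      if_neg (by omega)]

/-- The class of `x ^ i`. -/
def monomialPair (P : (ZMod p)[X]) (i : ℕ) : Bq P × Bq P := (xact P ^ i) (1, 0)

theorem monomialPair_two_mul (P : (ZMod p)[X]) (i : ℕ) :
    monomialPair P (2 * i) = (zq P ^ i, 0) := by
  rw [monomialPair, xact_pow_two_mul, Prod.smul_mk, smul_eq_mul, mul_one, smul_zero]

theorem monomialPair_two_mul_add_one (P : (ZMod p)[X]) (i : ℕ) :
    monomialPair P (2 * i + 1) = (0, zq P ^ i) := by
  have h1 : monomialPair P (2 * i + 1) = (xact P ^ (2 * i)) (xact P (1, 0)) := by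
    rw [monomialPair, pow_succ]
    rfl
  rw [h1, xact_pow_two_mul, xact_apply, Prod.smul_mk, map_one, map_zero, mul_zero, smul_zero,
    smul_eq_mul, mul_one]

theorem toPair_eq_sum (P : (ZMod p)[X]) (c : Fin (2 * k) → Fq p) :
    toPair P k c = ∑ i, AdjoinRoot.of (ext P) (c i) • monomialPair P i := by
  change residue P (∑ i, _) = _
  rw [map_sum]
  refine Finset.sum_congr rfl fun i _ => ?_
  change polyAct P (SkewPolynomial.monomial i.val (c i)) (1, 0) = _
  rw [polyAct_monomial]
  rfl

variable {j : Fq p →+* Fq p}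

/-- The form on pairs that corresponds to the form on words. -/
def pairForm (ρ : Bq P →+* Bq P) (v w : Bq P × Bq P) : Bq P := v.1 * ρ w.1 + v.2 * ρ w.2

theorem pairForm_smul_left (ρ : Bq P →+* Bq P) (y : Bq P) (v w : Bq P × Bq P) :
    pairForm ρ (y • v) w = y * pairForm ρ v w := by
  simp only [pairForm, Prod.smul_fst, Prod.smul_snd, smul_eq_mul]
  ring

theorem pairForm_smul_right (ρ : Bq P →+* Bq P) (y : Bq P) (v w : Bq P × Bq P) :
    pairForm ρ v (y • w) = ρ y * pairForm ρ v w := by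
  simp only [pairForm, Prod.smul_fst, Prod.smul_snd, smul_eq_mul, map_mul]
  ring

theorem pairForm_sum_left (ρ : Bq P →+* Bq P) {ι : Type*} (S : Finset ι) (v : ι → Bq P × Bq P)
    (w : Bq P × Bq P) : pairForm ρ (∑ i ∈ S, v i) w = ∑ i ∈ S, pairForm ρ (v i) w := by
  simp only [pairForm, Prod.fst_sum, Prod.snd_sum, Finset.sum_mul, Finset.sum_add_distrib]

theorem pairForm_sum_right (ρ : Bq P →+* Bq P) {ι : Type*} (S : Finset ι) (v : ι → Bq P × Bq P)
    (w : Bq P × Bq P) : pairForm ρ w (∑ i ∈ S, v i) = ∑ i ∈ S, pairForm ρ w (v i) := by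
  simp only [pairForm, Prod.fst_sum, Prod.snd_sum, map_sum, Finset.mul_sum,
    Finset.sum_add_distrib]

/-- The powers of x are orthonormal for the constant coefficient of the pair form. This identifies
it with the coordinate form on words. -/
theorem IsModulus.constCoeff_pairForm_monomialPair (h : IsModulus k l P)
    (hs : SelfRecip (2 * k) P) (a b : Fin (2 * k)) :
    h.constCoeff (pairForm (refl j hs) (monomialPair P a) (monomialPair P b)) =
      if a = b then 1 else 0 := by
  have ha := a.isLt
  have hb := b.isLt
  rcases Nat.even_or_odd' a with ⟨i, hi | hi⟩ <;> rcases Nat.even_or_odd' b with ⟨i', hi' | hi'⟩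
    <;> rw [hi, hi'] <;>
    simp only [monomialPair_two_mul, monomialPair_two_mul_add_one, pairForm, map_zero, mul_zero,
      zero_mul, add_zero, zero_add, map_pow, refl_root]
  · rw [h.constCoeff_root_pow_mul hs (by omega) (by omega)]
    exact if_congr (by rw [Fin.ext_iff]; omega) rfl rfl
  · rw [if_neg (by rw [Fin.ext_iff]; omega)]
  · rw [if_neg (by rw [Fin.ext_iff]; omega)]
  · rw [h.constCoeff_root_pow_mul hs (by omega) (by omega)]
    exact if_congr (by rw [Fin.ext_iff]; omega) rfl rfl

theorem IsModulus.constCoeff_pairForm (h : IsModulus k l P) (hs : SelfRecip (2 * k) P)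
    (c c' : Fin (2 * k) → Fq p) :
    h.constCoeff (pairForm (refl j hs) (toPair P k c) (toPair P k c')) =
      ∑ i, c i * j (c' i) := by
  rw [toPair_eq_sum, toPair_eq_sum, pairForm_sum_left, map_sum]
  refine Finset.sum_congr rfl fun a _ => ?_
  rw [pairForm_smul_left, h.constCoeff_of_mul, pairForm_sum_right, map_sum]
  congr 1
  simp only [pairForm_smul_right, refl_of, h.constCoeff_of_mul,
    h.constCoeff_pairForm_monomialPair, mul_ite, mul_one, mul_zero, Finset.sum_ite_eq,
    Finset.mem_univ, if_true]

/-- Pairing the word of (x, 0) with the unit vectors reads off its coordinates, and each of these is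
a constant coefficient of a multiple of x. -/
theorem IsModulus.eq_zero_of_constCoeff (h : IsModulus k l P) (hs : SelfRecip (2 * k) P)
    {x : Bq P} (hx : ∀ y, h.constCoeff (y * x) = 0) : x = 0 := by
  obtain ⟨c, hc⟩ := h.toPair_surjective (x, 0)
  have h1 : c = 0 := by
    funext i
    have h2 := h.constCoeff_pairForm (j := RingHom.id (Fq p)) hs c (Pi.single i 1)
    rw [hc] at h2
    simp only [pairForm, zero_mul, add_zero] at h2
    rw [mul_comm, hx, Finset.sum_eq_single i] at h2
    · simpa using h2.symm
    · intro b _ hb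
      rw [Pi.single_eq_of_ne hb, map_zero, mul_zero]
    · simp
  rw [h1, map_zero] at hc
  exact (congrArg Prod.fst hc).symm

theorem pairForm_genPair {ρ : Bq P →+* Bq P} (hρ : ∀ x, conj P (ρ x) = ρ (conj P x))
    (w : Bq P) : pairForm ρ (genPair u w) (genPair u w) = formVal (conj P) ρ (u * ρ u) w := by
  simp only [pairForm, genPair, formVal, map_mul, map_neg, hρ]
  ring

theorem isUnit_of_forall_mul_eq_zero {A : Type*} [CommRing A] [Finite A] {x : A}
    (hx : ∀ y, y * x = 0 → y = 0) : IsUnit x := by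
  have h1 : Function.Injective fun y => y * x := by
    intro y y' h
    have h2 : (y - y') * x = 0 := by rw [sub_mul, sub_eq_zero]; exact h
    exact sub_eq_zero.1 (hx _ h2)
  obtain ⟨y, hy⟩ := (Finite.injective_iff_surjective.1 h1) 1
  exact IsUnit.of_mul_eq_one_right y hy

/-- The line is stable under scalars, so orthogonality for the constant coefficient is orthogonality
for the ring-valued form. The hull of the line therefore consists of its multiples by the
annihilator of the form value, and in a finite ring a zero annihilator means a unit. -/
theorem IsModulus.code_lcd_iff (h : IsModulus k l P) (hs : SelfRecip (2 * k) P)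
    (hj : ∀ a, j (j a) = a) (hj' : ∀ a, j (frob p a) = frob p (j a)) (hu : IsUnit u)
    {w : Bq P} (hw : IsCoprime w (conj P w)) :
    code k (Submodule.span (Bq P) {genPair u w}) ⊓
        dualCode j (code k (Submodule.span (Bq P) {genPair u w})) = ⊥ ↔
      IsUnit (formVal (conj P) (refl j hs) (u * refl j hs u) w) := by
  have := finite_Bq h.ne_zero
  have hform := pairForm_genPair (u := u) (conj_refl hj' hs) w
  rw [Submodule.eq_bot_iff]
  constructor
  · intro hbot
    refine isUnit_of_forall_mul_eq_zero fun y hy => ?_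
    obtain ⟨c, hc⟩ := h.toPair_surjective (y • genPair u w)
    have hc0 : c = 0 := by
      refine hbot c ⟨?_, fun c' hc' => ?_⟩
      · refine mem_code.2 ?_
        rw [hc]
        exact Submodule.mem_span_singleton.2 ⟨y, rfl⟩
      · obtain ⟨y', hy'⟩ := Submodule.mem_span_singleton.1 (mem_code.1 hc')
        rw [← h.constCoeff_pairForm hs, hc, ← hy', pairForm_smul_right, pairForm_smul_left, hform,
          hy, mul_zero, map_zero]
    rw [hc0, map_zero] at hc
    exact eq_zero_of_smul_genPair hu hw hc.symm
  · rintro hunit c ⟨hc, hcd⟩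
    obtain ⟨y, hy⟩ := Submodule.mem_span_singleton.1 (mem_code.1 hc)
    have h1 : pairForm (refl j hs) (toPair P k c) (genPair u w) = 0 := by
      refine h.eq_zero_of_constCoeff hs fun x => ?_
      -- The form is semilinear on the right, so scaling by the reflection of x tests the value
      -- against x itself.
      obtain ⟨c', hc'⟩ := h.toPair_surjective (refl j hs x • genPair u w)
      have h2 := hcd c' (mem_code.2 (by
        rw [hc']; exact Submodule.mem_span_singleton.2 ⟨_, rfl⟩))
      rwa [← h.constCoeff_pairForm hs, hc', pairForm_smul_right, refl_refl hj hs] at h2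
    rw [← hy, pairForm_smul_left, hform] at h1
    have h3 : y = 0 := (hunit.mul_left_eq_zero).1 h1
    rw [h3, zero_smul] at hy
    exact h.toPair_bijective.1 (by rw [← hy, map_zero])

theorem isCoprime_of_isUnit_formVal {ρ : Bq P →+* Bq P} {γ w : Bq P}
    (hw : IsUnit (formVal (conj P) ρ γ w)) : IsCoprime w (conj P w) := by
  obtain ⟨c, hc⟩ := hw.exists_left_inv
  refine ⟨c * ρ w, c * γ * conj P (ρ w), ?_⟩
  rw [← hc, formVal, map_mul]
  ring

/-- Equal lines differ by a unit y. Comparing the two coordinates shows that conj(y) - y kills w and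
its conjugate, which generate the unit ideal, so y is fixed. -/
theorem exists_mul_eq_of_span_eq (hu : IsUnit u) {w w' : Bq P} (hw : IsCoprime w (conj P w))
    (hspan : Submodule.span (Bq P) {genPair u w} = Submodule.span (Bq P) {genPair u w'}) :
    ∃ a, (conj P a = a ∧ IsUnit a) ∧ a * w = w' := by
  have h1 : genPair u w' ∈ Submodule.span (Bq P) {genPair u w} := by
    rw [hspan]
    exact Submodule.mem_span_singleton_self _
  have h2 : genPair u w ∈ Submodule.span (Bq P) {genPair u w'} := by
    rw [← hspan]
    exact Submodule.mem_span_singleton_self _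
  obtain ⟨y, hy⟩ := Submodule.mem_span_singleton.1 h1
  obtain ⟨y', hy'⟩ := Submodule.mem_span_singleton.1 h2
  have h3 : (y' * y - 1) • genPair u w = 0 := by
    rw [sub_smul, mul_smul, hy, hy', one_smul, sub_self]
  have h4 : y' * y = 1 := sub_eq_zero.1 (eq_zero_of_smul_genPair hu hw h3)
  rw [genPair, genPair, Prod.smul_mk, Prod.mk.injEq, smul_eq_mul, smul_eq_mul] at hy
  obtain ⟨e1, e2⟩ := hy
  have e3 : y * w = w' := by linear_combination -e2
  have e4 : (conj P y - y) * conj P w = 0 := by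
    refine hu.mul_left_cancel ?_
    rw [← e3, map_mul] at e1
    linear_combination -e1
  have e5 : (conj P y - y) * w = 0 := by
    have := congrArg (conj P) e4
    rw [map_mul, map_sub, conj_conj, conj_conj, map_zero] at this
    linear_combination -this
  exact ⟨y, ⟨sub_eq_zero.1 (eq_zero_of_mul_eq_zero hw e5 e4), IsUnit.of_mul_eq_one_right y' h4⟩,
    e3⟩

theorem span_genPair_mul {a : Bq P} (ha : conj P a = a) (hu : IsUnit a) (w : Bq P) :
    Submodule.span (Bq P) {genPair u (a * w)} = Submodule.span (Bq P) {genPair u w} := by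
  rw [← smul_genPair ha]
  exact Submodule.span_singleton_smul_eq hu _

variable {I : Finset (ZMod p)[X]} {m : ℕ}

/-- The LCD codes are the orbits of the conjugation-fixed units acting freely on the w with unit
form value. -/
theorem IsModulus.ncard_mul_fixedUnitCount (h : IsModulus k l P) (hs : SelfRecip (2 * k) P)
    (hI : IsCoprimeFactorization I m P) (hirr : ∀ F ∈ I, Irreducible F)
    (hj : ∀ a, j (j a) = a) (hj' : ∀ a, j (frob p a) = frob p (j a))
    (hu : u * conj P u = zq P) :
    {D : Submodule (Fq p) (Fin (2 * k) → Fq p) |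
        IsAdmissible k l D ∧ D ⊓ dualCode j D = ⊥}.ncard * fixedUnitCount (conj P) =
      unitFormCount (conj P) (refl j hs) (u * refl j hs u) := by
  have hz : IsUnit (zq P) := IsUnit.of_mul_eq_one _ hs.root_mul
  have hu' := isUnit_of_mul_conj_eq hz hu
  set S := {D : Submodule (Fq p) (Fin (2 * k) → Fq p) | IsAdmissible k l D ∧
    D ⊓ dualCode j D = ⊥}
  have hS : ∀ D : S, ∃ w, IsCoprime w (conj P w) ∧
      D.1 = code k (Submodule.span (Bq P) {genPair u w}) := fun D =>
    (h.isAdmissible_iff hI hirr hz hu D.1).1 D.2.1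
  choose w hw hD using hS
  have hW : ∀ D : S, IsUnit (formVal (conj P) (refl j hs) (u * refl j hs u) (w D)) := fun D => by
    rw [← h.code_lcd_iff hs hj hj' hu' (hw D), ← hD]
    exact D.2.2
  have hmul : ∀ (a : Bq P) (D : S), conj P a = a → IsUnit a →
      IsCoprime (a * w D) (conj P (a * w D)) := by
    intro a D ha hau
    rw [map_mul, ha, isCoprime_mul_unit_left hau]
    exact hw D
  rw [← Nat.card_coe_set_eq, fixedUnitCount, unitFormCount, ← Nat.card_prod]
  refine Nat.card_congr (Equiv.ofBijective
    (fun x : S × {a : Bq P // conj P a = a ∧ IsUnit a} =>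
      (⟨x.2.1 * w x.1, ?_⟩ : {w : Bq P // IsUnit _})) ⟨?_, ?_⟩)
  · rw [← h.code_lcd_iff hs hj hj' hu' (hmul _ _ x.2.2.1 x.2.2.2),
      span_genPair_mul x.2.2.1 x.2.2.2, ← hD]
    exact x.1.2.2
  · rintro ⟨D, a, ha, hau⟩ ⟨D', a', ha', hau'⟩ heq
    have h1 : a * w D = a' * w D' := congrArg Subtype.val heq
    obtain rfl : D = D' := by
      refine Subtype.ext ?_
      rw [hD, hD, ← span_genPair_mul ha hau, h1, span_genPair_mul ha' hau']
    have h2 : (a - a') * w D = 0 := by linear_combination h1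
    have h3 : (a - a') * conj P (w D) = 0 := by
      have := congrArg (conj P) h2
      rwa [map_mul, map_sub, ha, ha', map_zero] at this
    obtain rfl : a = a' := sub_eq_zero.1 (eq_zero_of_mul_eq_zero (hw D) h2 h3)
    rfl
  · rintro ⟨w', hw'⟩
    have hc := isCoprime_of_isUnit_formVal hw'
    let D : S := ⟨code k (Submodule.span (Bq P) {genPair u w'}),
      (h.isAdmissible_iff hI hirr hz hu _).2 ⟨w', hc, rfl⟩,
      (h.code_lcd_iff hs hj hj' hu' hc).2 hw'⟩
    obtain ⟨a, ha, haw⟩ := exists_mul_eq_of_span_eq hu' (hw D) (h.code_injective (hD D).symm)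
    exact ⟨⟨D, a, ha⟩, Subtype.ext haw⟩

end LCD

/-! ### Codes over R as pairs of codes over 𝔽_{p²} -/

section Gluing

variable {p : ℕ} [Fact p.Prime] {n : ℕ}

/-- The specialization `v ↦ 1`. -/
def specOne : Rv p →+* Fq p where
  toFun z := z.re + z.im
  map_zero' := by simp
  map_one' := add_zero 1
  map_add' x y := by simp only [QuadraticAlgebra.re_add, QuadraticAlgebra.im_add]; ring
  map_mul' x y := by simp only [QuadraticAlgebra.re_mul, QuadraticAlgebra.im_mul]; ring

/-- The specialization `v ↦ 0`. -/
def specZero : Rv p →+* Fq p where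
  toFun z := z.re
  map_zero' := by simp
  map_one' := rfl
  map_add' x y := by simp only [QuadraticAlgebra.re_add]
  map_mul' x y := by simp only [QuadraticAlgebra.re_mul]; ring

theorem specOne_apply (z : Rv p) : specOne z = z.re + z.im := rfl

theorem specZero_apply (z : Rv p) : specZero z = z.re := rfl

theorem eq_zero_of_spec {z : Rv p} (h1 : specOne z = 0) (h0 : specZero z = 0) : z = 0 := by
  rw [specOne_apply] at h1
  rw [specZero_apply] at h0
  rw [h0, zero_add] at h1
  exact QuadraticAlgebra.ext h0 h1

theorem specOne_v : specOne (v p) = 1 := zero_add 1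

theorem specZero_v : specZero (v p) = 0 := rfl

theorem specOne_algebraMap (a : Fq p) : specOne (algebraMap (Fq p) (Rv p) a) = a := by
  simp [specOne_apply]

theorem specZero_algebraMap (a : Fq p) : specZero (algebraMap (Fq p) (Rv p) a) = a := by
  simp [specZero_apply]

theorem specOne_glue (x y : Fin n → Fq p) (i : Fin n) : specOne (glue x y i) = x i := by
  simp only [glue, map_add, map_mul, map_sub, map_one, specOne_v, specOne_algebraMap]
  ring

theorem specZero_glue (x y : Fin n → Fq p) (i : Fin n) : specZero (glue x y i) = y i := by
  simp only [glue, map_add, map_mul, map_sub, map_one, specZero_v, specZero_algebraMap]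
  ring

theorem specOne_theta (z : Rv p) : specOne (theta p z) = frob p (specOne z) := by
  rw [specOne_apply, specOne_apply, map_add]
  rfl

theorem specZero_theta (z : Rv p) : specZero (theta p z) = frob p (specZero z) := rfl

theorem glue_spec (c : Fin n → Rv p) : glue (specOne ∘ c) (specZero ∘ c) = c := by
  funext i
  rw [← sub_eq_zero]
  apply eq_zero_of_spec
  · rw [map_sub, specOne_glue, Function.comp_apply, sub_self]
  · rw [map_sub, specZero_glue, Function.comp_apply, sub_self]

/-- The code `v C₁ ⊕ (1 - v) C₂`. -/
def gluedCode (C₁ C₂ : Submodule (Fq p) (Fin n → Fq p)) : Submodule (Rv p) (Fin n → Rv p) where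
  carrier := {c | specOne ∘ c ∈ C₁ ∧ specZero ∘ c ∈ C₂}
  zero_mem' := by
    constructor
    · convert C₁.zero_mem
      funext i
      exact map_zero specOne
    · convert C₂.zero_mem
      funext i
      exact map_zero specZero
  add_mem' := by
    rintro a b ⟨ha, ha'⟩ ⟨hb, hb'⟩
    constructor
    · convert C₁.add_mem ha hb
      funext i
      exact map_add specOne _ _
    · convert C₂.add_mem ha' hb'
      funext i
      exact map_add specZero _ _
  smul_mem' := by
    rintro r a ⟨ha, ha'⟩
    constructor
    · convert C₁.smul_mem (specOne r) ha
      funext i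
      exact map_mul specOne _ _
    · convert C₂.smul_mem (specZero r) ha'
      funext i
      exact map_mul specZero _ _

theorem mem_gluedCode {C₁ C₂ : Submodule (Fq p) (Fin n → Fq p)} {c : Fin n → Rv p} :
    c ∈ gluedCode C₁ C₂ ↔ specOne ∘ c ∈ C₁ ∧ specZero ∘ c ∈ C₂ := Iff.rfl

theorem glue_mem_gluedCode {C₁ C₂ : Submodule (Fq p) (Fin n → Fq p)} {x y : Fin n → Fq p} :
    glue x y ∈ gluedCode C₁ C₂ ↔ x ∈ C₁ ∧ y ∈ C₂ := by
  rw [mem_gluedCode, show specOne ∘ glue x y = x from funext (specOne_glue x y),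
    show specZero ∘ glue x y = y from funext (specZero_glue x y)]

theorem component₁_gluedCode (C₁ C₂ : Submodule (Fq p) (Fin n → Fq p)) :
    component₁ (gluedCode C₁ C₂) = C₁ := by
  refine Submodule.ext fun x => ?_
  change (∃ y, glue x y ∈ gluedCode C₁ C₂) ↔ _
  simp only [glue_mem_gluedCode]
  exact ⟨fun ⟨_, h, _⟩ => h, fun h => ⟨0, h, C₂.zero_mem⟩⟩

theorem component₂_gluedCode (C₁ C₂ : Submodule (Fq p) (Fin n → Fq p)) :
    component₂ (gluedCode C₁ C₂) = C₂ := by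
  refine Submodule.ext fun y => ?_
  change (∃ x, glue x y ∈ gluedCode C₁ C₂) ↔ _
  simp only [glue_mem_gluedCode]
  exact ⟨fun ⟨_, _, h⟩ => h, fun h => ⟨0, C₁.zero_mem, h⟩⟩

theorem gluedCode_component (C : Submodule (Rv p) (Fin n → Rv p)) :
    gluedCode (component₁ C) (component₂ C) = C := by
  refine Submodule.ext fun c => ?_
  rw [mem_gluedCode]
  constructor
  · rintro ⟨⟨y, hy⟩, ⟨x, hx⟩⟩
    -- The idempotents v and 1 - v erase the arbitrary companions y and x.
    have h1 : c = v p • glue (specOne ∘ c) y + (1 - v p) • glue x (specZero ∘ c) := by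
      funext i
      rw [← sub_eq_zero]
      apply eq_zero_of_spec
      · simp only [map_sub, Pi.add_apply, Pi.smul_apply, smul_eq_mul, map_add, map_mul,
          specOne_glue, specOne_v, map_one, Function.comp_apply]
        ring
      · simp only [map_sub, Pi.add_apply, Pi.smul_apply, smul_eq_mul, map_add, map_mul,
          specZero_glue, specZero_v, map_one, Function.comp_apply]
        ring
    rw [h1]
    exact C.add_mem (C.smul_mem _ hy) (C.smul_mem _ hx)
  · intro hc
    rw [← glue_spec c] at hc
    exact ⟨⟨_, hc⟩, ⟨_, hc⟩⟩

theorem gluedCode_injective {C₁ C₂ D₁ D₂ : Submodule (Fq p) (Fin n → Fq p)}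
    (h : gluedCode C₁ C₂ = gluedCode D₁ D₂) : C₁ = D₁ ∧ C₂ = D₂ :=
  ⟨by rw [← component₁_gluedCode C₁ C₂, h, component₁_gluedCode],
    by rw [← component₂_gluedCode C₁ C₂, h, component₂_gluedCode]⟩

theorem gluedCode_eq_bot_iff {C₁ C₂ : Submodule (Fq p) (Fin n → Fq p)} :
    gluedCode C₁ C₂ = ⊥ ↔ C₁ = ⊥ ∧ C₂ = ⊥ := by
  have h0 : gluedCode (⊥ : Submodule (Fq p) (Fin n → Fq p)) ⊥ = ⊥ := by
    rw [Submodule.eq_bot_iff]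
    rintro c ⟨h1, h2⟩
    funext i
    exact eq_zero_of_spec (congrFun ((Submodule.mem_bot (Fq p)).1 h1) i)
      (congrFun ((Submodule.mem_bot (Fq p)).1 h2) i)
  constructor
  · intro h
    exact gluedCode_injective (h.trans h0.symm)
  · rintro ⟨rfl, rfl⟩
    exact h0

theorem isSkewConstacyclic_gluedCode {C₁ C₂ : Submodule (Fq p) (Fin n → Fq p)} {l : Rv p}
    (h1 : IsSkewConstacyclic (frob p) (specOne l) C₁)
    (h2 : IsSkewConstacyclic (frob p) (specZero l) C₂) :
    IsSkewConstacyclic (theta p) l (gluedCode C₁ C₂) := by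
  rintro c ⟨hc1, hc2⟩
  constructor
  · convert h1 _ hc1
    funext i
    simp only [skewShift, Function.comp_apply]
    split_ifs
    · rw [map_mul, specOne_theta]
    · rw [specOne_theta]
  · convert h2 _ hc2
    funext i
    simp only [skewShift, Function.comp_apply]
    split_ifs
    · rw [map_mul, specZero_theta]
    · rw [specZero_theta]

theorem dualCode_gluedCode {σ : Rv p →+* Rv p} {j : Fq p →+* Fq p}
    (h1 : ∀ z, specOne (σ z) = j (specOne z)) (h0 : ∀ z, specZero (σ z) = j (specZero z))
    (C₁ C₂ : Submodule (Fq p) (Fin n → Fq p)) :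
    dualCode σ (gluedCode C₁ C₂) = gluedCode (dualCode j C₁) (dualCode j C₂) := by
  have hs1 : ∀ a b : Fin n → Rv p, specOne (∑ i, a i * σ (b i)) =
      ∑ i, (specOne ∘ a) i * j ((specOne ∘ b) i) := fun a b => by
    simp only [map_sum, map_mul, h1, Function.comp_apply]
  have hs0 : ∀ a b : Fin n → Rv p, specZero (∑ i, a i * σ (b i)) =
      ∑ i, (specZero ∘ a) i * j ((specZero ∘ b) i) := fun a b => by
    simp only [map_sum, map_mul, h0, Function.comp_apply]
  refine Submodule.ext fun c => ?_
  constructor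
  · intro hc
    constructor
    · intro x hx
      have h2 := congrArg specOne (hc _ (glue_mem_gluedCode.2 ⟨hx, C₂.zero_mem⟩))
      rw [hs1, map_zero] at h2
      simpa only [Function.comp_apply, specOne_glue] using h2
    · intro y hy
      have h2 := congrArg specZero (hc _ (glue_mem_gluedCode.2 ⟨C₁.zero_mem, hy⟩))
      rw [hs0, map_zero] at h2
      simpa only [Function.comp_apply, specZero_glue] using h2
  · rintro ⟨hc1, hc2⟩ d ⟨hd1, hd2⟩
    apply eq_zero_of_spec
    · rw [hs1]
      exact hc1 _ hd1
    · rw [hs0]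
      exact hc2 _ hd2

theorem gluedCode_lcd_iff {σ : Rv p →+* Rv p} {j : Fq p →+* Fq p}
    (h1 : ∀ z, specOne (σ z) = j (specOne z)) (h0 : ∀ z, specZero (σ z) = j (specZero z))
    (C₁ C₂ : Submodule (Fq p) (Fin n → Fq p)) :
    gluedCode C₁ C₂ ⊓ dualCode σ (gluedCode C₁ C₂) = ⊥ ↔
      C₁ ⊓ dualCode j C₁ = ⊥ ∧ C₂ ⊓ dualCode j C₂ = ⊥ := by
  have h2 : gluedCode C₁ C₂ ⊓ gluedCode (dualCode j C₁) (dualCode j C₂) =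
      gluedCode (C₁ ⊓ dualCode j C₁) (C₂ ⊓ dualCode j C₂) :=
    Submodule.ext fun c => ⟨fun h => ⟨⟨h.1.1, h.2.1⟩, h.1.2, h.2.2⟩,
      fun h => ⟨⟨h.1.1, h.2.1⟩, h.1.2, h.2.2⟩⟩
  rw [dualCode_gluedCode h1 h0, h2, gluedCode_eq_bot_iff]

/-- The admissible codes over the field that are LCD for the form twisted by `j`. -/
def lcdCodes (k : ℕ) (j : Fq p →+* Fq p) (l : Fq p) :
    Set (Submodule (Fq p) (Fin (2 * k) → Fq p)) :=
  {D | IsAdmissible k l D ∧ D ⊓ dualCode j D = ⊥}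

theorem IsModulus.isSkewConstacyclic {k : ℕ} {l : Fq p} {P : (ZMod p)[X]} (h : IsModulus k l P)
    {D : Submodule (Fq p) (Fin (2 * k) → Fq p)} (hD : IsAdmissible k l D) :
    IsSkewConstacyclic (frob p) l D := by
  obtain ⟨-, g, hg, -⟩ := hD
  obtain rfl := h.eq_code_of_isSkewGenerator hg
  intro c hc
  rw [mem_code] at hc ⊢
  rw [h.toPair_skewShift]
  exact xact_mem_leftIdeal hc

/-- Stability under the skew shift imposes nothing extra on the glued code, since a component with a
skew generator is already a left ideal. -/
theorem ncard_lcd_eq_mul {k : ℕ} {l : Rv p} {P₁ P₀ : (ZMod p)[X]}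
    (hP₁ : IsModulus k (specOne l) P₁) (hP₀ : IsModulus k (specZero l) P₀)
    {σ : Rv p →+* Rv p} {j : Fq p →+* Fq p}
    (h1 : ∀ z, specOne (σ z) = j (specOne z)) (h0 : ∀ z, specZero (σ z) = j (specZero z)) :
    {C ∈ admissibleCodes p k l | C ⊓ dualCode σ C = ⊥}.ncard =
      (lcdCodes k j (specOne l)).ncard * (lcdCodes k j (specZero l)).ncard := by
  rw [← Set.ncard_prod, ← Set.ncard_image_of_injective (lcdCodes k j (specOne l) ×ˢ _)
    (f := fun D => gluedCode D.1 D.2) (by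
      rintro ⟨a, b⟩ ⟨c, d⟩ h
      obtain ⟨rfl, rfl⟩ := gluedCode_injective h
      rfl)]
  congr 1
  ext C
  constructor
  · rintro ⟨⟨-, ha1, ha2⟩, hC⟩
    rw [← gluedCode_component C, gluedCode_lcd_iff h1 h0] at hC
    exact ⟨(component₁ C, component₂ C), ⟨⟨ha1, hC.1⟩, ⟨ha2, hC.2⟩⟩, gluedCode_component C⟩
  · rintro ⟨⟨D₁, D₂⟩, ⟨⟨ha1, hl1⟩, ⟨ha2, hl2⟩⟩, rfl⟩
    refine ⟨⟨isSkewConstacyclic_gluedCode (hP₁.isSkewConstacyclic ha1)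
      (hP₀.isSkewConstacyclic ha2), ?_, ?_⟩, (gluedCode_lcd_iff h1 h0 D₁ D₂).2 ⟨hl1, hl2⟩⟩
    · rw [component₁_gluedCode]
      exact ha1
    · rw [component₂_gluedCode]
      exact ha2

end Gluing

/-! ### Counts over the field and evaluation of the linear factors -/

section Counting

variable {p : ℕ} [Fact p.Prime] {s t k : ℕ} {ε : ZMod p}

theorem LengthData.isModulus (h : LengthData p s t k ε) :
    IsModulus k (algebraMap (ZMod p) (Fq p) ε) (X ^ k - C ε : (ZMod p)[X]) where
  pos := h.k_pos
  eq := by simp only [ext, Polynomial.map_sub, Polynomial.map_pow, map_X, map_C]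

/-- The product over the self-reciprocal irreducible factors of degree greater than one. -/
def irredProd (p s : ℕ) (F : (ZMod p)[X]) [Fact p.Prime] : ℤ :=
  ∏ᶠ f ∈ Fir p ∩ monicDivisors F,
    ((p : ℤ) ^ f.natDegree - (p : ℤ) ^ (f.natDegree / 2)) * (p : ℤ) ^ (f.natDegree * (p ^ s - 1))

/-- The product over the pairs of reciprocal factors. -/
def redProd (p s : ℕ) (F : (ZMod p)[X]) [Fact p.Prime] : ℤ :=
  ∏ᶠ f ∈ Fred p ∩ monicDivisors F,
    (1 + (p : ℤ) ^ (f.natDegree / 2)) * (p : ℤ) ^ ((2 * p ^ s - 1) * (f.natDegree / 2))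

theorem LengthData.ncard_lcdCodes (h : LengthData p s t k ε) {j : Fq p →+* Fq p}
    {lin : ZMod p → ℕ} (hl : IsLinearCount j lin) :
    ((lcdCodes k j (algebraMap (ZMod p) (Fq p) ε)).ncard : ℤ) =
      (∏ η ∈ signRoots k ε, (p : ℤ) ^ (p ^ s - 1) * lin η) * irredProd p s (X ^ k - C ε) *
        redProd p s (X ^ k - C ε) := by
  have hirr : ∀ F ∈ irredFactors t ε, Irreducible F := fun F hF => (h.mem_irredFactors.1 hF).1
  have hz : IsUnit (zq (X ^ k - C ε : (ZMod p)[X])) := IsUnit.of_mul_eq_one _ h.selfRecip.root_mul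
  obtain ⟨u, hu⟩ := exists_norm_eq_root h.factorization_irred hirr hz
  exact h.count_eq hl hu (h.isModulus.ncard_mul_fixedUnitCount h.selfRecip h.factorization_irred
    hirr hl.invol hl.comm hu)

theorem LengthData.finite_inter (h : LengthData p s t k ε) :
    (Fir p ∩ monicDivisors (X ^ k - C ε)).Finite ∧
      (Fred p ∩ monicDivisors (X ^ k - C ε)).Finite :=
  ⟨(orbitFactors t ε).finite_toSet.subset fun _ hF => h.mem_orbitFactors.2 (Or.inr (Or.inl hF)),
    (orbitFactors t ε).finite_toSet.subset fun _ hF => h.mem_orbitFactors.2 (Or.inr (Or.inr hF))⟩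

theorem LengthData.irredProd_sq (h : LengthData p s t k ε) :
    irredProd p s (X ^ k - C ε) ^ 2 = ∏ᶠ f ∈ Fir p ∩ monicDivisors (X ^ k - C ε),
      ((p : ℤ) ^ f.natDegree - (p : ℤ) ^ (f.natDegree / 2)) ^ 2
        * (p : ℤ) ^ (2 * f.natDegree * (p ^ s - 1)) := by
  rw [irredProd, pow_two]
  refine (finprod_mem_mul_distrib h.finite_inter.1).symm.trans
    (finprod_mem_congr rfl fun f _ => ?_)
  rw [mul_assoc 2, two_mul, pow_add]
  ring

theorem LengthData.redProd_sq (h : LengthData p s t k ε) :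
    redProd p s (X ^ k - C ε) ^ 2 = ∏ᶠ f ∈ Fred p ∩ monicDivisors (X ^ k - C ε),
      (1 + (p : ℤ) ^ (f.natDegree / 2)) ^ 2 * (p : ℤ) ^ ((2 * p ^ s - 1) * f.natDegree) := by
  rw [redProd, pow_two]
  refine (finprod_mem_mul_distrib h.finite_inter.2).symm.trans
    (finprod_mem_congr rfl fun f hf => ?_)
  -- The degree of ee♮ is even, so the truncating division by 2 is exact and squaring the power
  -- doubles d/2 to d.
  obtain ⟨⟨e, he, hei, -, rfl⟩, -, hd⟩ := hf
  have h0 := h.coeff_zero_ne ((dvd_mul_right e _).trans hd)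
  have h1 : (e * monicReciprocal e).natDegree = 2 * e.natDegree := by
    rw [he.natDegree_mul (monic_monicReciprocal h0), natDegree_monicReciprocal h0, two_mul]
  rw [h1, Nat.mul_div_cancel_left _ two_pos, two_mul e.natDegree, mul_add, pow_add]
  ring

theorem odd_prime (h2 : p ≠ 2) : (1 : ZMod p) ≠ -1 := by
  intro h
  have : Fact (2 < p) := ⟨lt_of_le_of_ne (Fact.out : p.Prime).two_le (Ne.symm h2)⟩
  exact ZMod.neg_one_ne_one h.symm

theorem signRoots_one_of_even (hk : Even k) : signRoots k (1 : ZMod p) = {1, -1} := by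
  ext η
  rw [mem_signRoots, Finset.mem_insert, Finset.mem_singleton, and_iff_left_iff_imp]
  rintro (rfl | rfl)
  · exact one_pow k
  · exact hk.neg_one_pow

theorem signRoots_neg_one_of_even (h2 : p ≠ 2) (hk : Even k) :
    signRoots k (-1 : ZMod p) = ∅ := by
  rw [Finset.eq_empty_iff_forall_notMem]
  intro η hη
  obtain ⟨rfl | rfl, h⟩ := mem_signRoots.1 hη
  · exact odd_prime h2 (by rw [← h, one_pow])
  · exact odd_prime h2 (by rw [← h, hk.neg_one_pow])

theorem signRoots_of_odd (hk : Odd k) (hε : ε = 1 ∨ ε = -1) : signRoots k ε = {ε} := by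
  ext η
  rw [mem_signRoots, Finset.mem_singleton]
  constructor
  · rintro ⟨rfl | rfl, h⟩
    · rwa [one_pow] at h
    · rwa [hk.neg_one_pow] at h
  · rintro rfl
    refine ⟨hε, ?_⟩
    rcases hε with rfl | rfl
    · exact one_pow k
    · exact hk.neg_one_pow

theorem signRoots_two {k : ℕ} (ε : ZMod 2) (hε : ε = 1 ∨ ε = -1) :
    signRoots k ε = {1} := by
  have h1 : (-1 : ZMod 2) = 1 := rfl
  have hε1 : ε = 1 := by rcases hε with rfl | rfl <;> rfl
  subst hε1
  ext η
  rw [mem_signRoots, Finset.mem_singleton, h1, or_self, and_iff_left_iff_imp]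
  rintro rfl
  exact one_pow k

theorem linearEuclidean_one (h2 : p ≠ 2) :
    (linearEuclidean (1 : ZMod p) : ℤ) = p - (-1) ^ ((p + 1) / 2) := by
  have hp := (Fact.out : p.Prime).one_le
  rw [linearEuclidean, if_neg h2]
  rcases Nat.even_or_odd ((p + 1) / 2) with h | h
  · rw [h.neg_one_pow, h.neg_one_pow, if_pos rfl, Nat.cast_sub hp, Nat.cast_one]
  · rw [h.neg_one_pow, h.neg_one_pow, if_neg (odd_prime h2).symm]
    push_cast
    ring

theorem linearEuclidean_neg_one (h2 : p ≠ 2) :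
    (linearEuclidean (-1 : ZMod p) : ℤ) = p - (-1) ^ ((p - 1) / 2) := by
  have hp := (Fact.out : p.Prime).one_le
  rw [linearEuclidean, if_neg h2]
  have h3 : (p + 1) / 2 = (p - 1) / 2 + 1 := by omega
  rw [h3]
  rcases Nat.even_or_odd ((p - 1) / 2) with h | h
  · rw [h.add_one.neg_one_pow, h.neg_one_pow, if_pos rfl, Nat.cast_sub hp, Nat.cast_one]
  · rw [h.add_one.neg_one_pow, h.neg_one_pow, if_neg (odd_prime h2)]
    push_cast
    ring

theorem linearHermitian_one (h2 : p ≠ 2) : linearHermitian (1 : ZMod p) = p + 1 :=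
  if_neg fun h => odd_prime h2 (eq_neg_of_add_eq_zero_left h)

theorem linearHermitian_neg_one : linearHermitian (-1 : ZMod p) = 0 :=
  if_pos (add_neg_cancel 1)

theorem prod_linearEuclidean_two (s k : ℕ) {ε : ZMod 2} (hε : ε = 1 ∨ ε = -1) :
    (∏ η ∈ signRoots k ε, ((2 : ℕ) : ℤ) ^ (2 ^ s - 1) * linearEuclidean η) = 2 ^ 2 ^ s := by
  rw [signRoots_two ε hε, Finset.prod_singleton, linearEuclidean, if_pos rfl]
  push_cast
  rw [← pow_succ, Nat.sub_add_cancel Nat.one_le_two_pow]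

theorem prod_linearHermitian_two (s k : ℕ) {ε : ZMod 2} (hε : ε = 1 ∨ ε = -1) :
    (∏ η ∈ signRoots k ε, ((2 : ℕ) : ℤ) ^ (2 ^ s - 1) * linearHermitian η) = 0 := by
  rw [signRoots_two ε hε, Finset.prod_singleton, linearHermitian, if_pos (by rfl), Nat.cast_zero,
    mul_zero]

theorem prod_linearEuclidean_one (s k : ℕ) :
    (∏ η ∈ signRoots k (1 : ZMod p), (p : ℤ) ^ (p ^ s - 1) * linearEuclidean η) = N₁ p s k := by
  rw [N₁]
  split_ifs with h2 hk
  · subst h2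
    exact prod_linearEuclidean_two s k (Or.inl rfl)
  · rw [signRoots_one_of_even hk, Finset.prod_pair (odd_prime h2), linearEuclidean_one h2,
      linearEuclidean_neg_one h2]
    -- The signs at 1 and -1 are opposite, so the two contributions multiply to p² - 1.
    have h3 : (p + 1) / 2 = (p - 1) / 2 + 1 := by
      have := (Fact.out : p.Prime).one_le
      omega
    have h4 : ((-1 : ℤ) ^ ((p - 1) / 2)) ^ 2 = 1 := by
      rw [← pow_mul, mul_comm, pow_mul, neg_one_sq, one_pow]
    rw [h3, pow_succ (-1 : ℤ)]
    linear_combination (-((p : ℤ) ^ (p ^ s - 1)) ^ 2) * h4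
  · rw [signRoots_of_odd (Nat.not_even_iff_odd.1 hk) (Or.inl rfl), Finset.prod_singleton,
      linearEuclidean_one h2]

theorem prod_linearEuclidean_neg_one (s k : ℕ) :
    (∏ η ∈ signRoots k (-1 : ZMod p), (p : ℤ) ^ (p ^ s - 1) * linearEuclidean η) =
      N₃ p s k := by
  rw [N₃]
  split_ifs with h2 hk
  · subst h2
    exact prod_linearEuclidean_two s k (Or.inr rfl)
  · rw [signRoots_neg_one_of_even h2 hk, Finset.prod_empty]
  · rw [signRoots_of_odd (Nat.not_even_iff_odd.1 hk) (Or.inr rfl), Finset.prod_singleton,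
      linearEuclidean_neg_one h2]

theorem prod_linearHermitian_one (s k : ℕ) :
    (∏ η ∈ signRoots k (1 : ZMod p), (p : ℤ) ^ (p ^ s - 1) * linearHermitian η) = N₂ p s k := by
  rw [N₂]
  split_ifs with h2 hk
  · subst h2
    exact prod_linearHermitian_two s k (Or.inl rfl)
  · rw [signRoots_one_of_even hk, Finset.prod_pair (odd_prime h2), linearHermitian_neg_one,
      Nat.cast_zero, mul_zero, mul_zero]
  · rw [signRoots_of_odd (Nat.not_even_iff_odd.1 hk) (Or.inl rfl), Finset.prod_singleton,
      linearHermitian_one h2, Nat.cast_add, Nat.cast_one]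

theorem prod_linearHermitian_neg_one (s k : ℕ) :
    (∏ η ∈ signRoots k (-1 : ZMod p), (p : ℤ) ^ (p ^ s - 1) * linearHermitian η) = N₄ p k := by
  rw [N₄]
  split_ifs with h2 hk
  · subst h2
    exact prod_linearHermitian_two s k (Or.inr rfl)
  · rw [signRoots_neg_one_of_even h2 hk, Finset.prod_empty]
  · rw [signRoots_of_odd (Nat.not_even_iff_odd.1 hk) (Or.inr rfl), Finset.prod_singleton,
      linearHermitian_neg_one, Nat.cast_zero, mul_zero]

/-- N₄ is 0 or 1, which is why it appears unsquared for λ = -1. -/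
theorem N₄_mul_self (p k : ℕ) : N₄ p k * N₄ p k = N₄ p k := by
  rw [N₄]
  split_ifs <;> norm_num

theorem LengthData.euclideanCount_eq {l : Rv p} {ε₁ ε₀ : ZMod p} (h₁ : LengthData p s t k ε₁)
    (h₀ : LengthData p s t k ε₀) (e₁ : specOne l = algebraMap (ZMod p) (Fq p) ε₁)
    (e₀ : specZero l = algebraMap (ZMod p) (Fq p) ε₀) :
    euclideanCount p k l =
      (lcdCodes k (RingHom.id (Fq p)) (algebraMap (ZMod p) (Fq p) ε₁)).ncard *
        (lcdCodes k (RingHom.id (Fq p)) (algebraMap (ZMod p) (Fq p) ε₀)).ncard := by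
  rw [← e₁, ← e₀]
  exact ncard_lcd_eq_mul (e₁ ▸ h₁.isModulus) (e₀ ▸ h₀.isModulus) (fun _ => rfl) fun _ => rfl

theorem LengthData.hermitianCount_eq {l : Rv p} {ε₁ ε₀ : ZMod p} (h₁ : LengthData p s t k ε₁)
    (h₀ : LengthData p s t k ε₀) (e₁ : specOne l = algebraMap (ZMod p) (Fq p) ε₁)
    (e₀ : specZero l = algebraMap (ZMod p) (Fq p) ε₀) :
    hermitianCount p k l =
      (lcdCodes k (frob p) (algebraMap (ZMod p) (Fq p) ε₁)).ncard *
        (lcdCodes k (frob p) (algebraMap (ZMod p) (Fq p) ε₀)).ncard := by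
  rw [← e₁, ← e₀]
  exact ncard_lcd_eq_mul (e₁ ▸ h₁.isModulus) (e₀ ▸ h₀.isModulus) specOne_theta specZero_theta

end Counting

end SkewLCD

end

/-! ### The six counts -/

theorem mainTheorem2 (p : ℕ) [Fact p.Prime] (s t k : ℕ) (ht : ¬ p ∣ t) (hk : k = p ^ s * t) :
    -- Euclidean LCD codes, `λ = 1`
    ((SkewLCD.euclideanCount p k 1 : ℤ) =
      SkewLCD.N₁ p s k ^ 2
      * (∏ᶠ f ∈ SkewLCD.Fir p ∩ SkewLCD.monicDivisors (X ^ k - 1),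
          ((p : ℤ) ^ f.natDegree - (p : ℤ) ^ (f.natDegree / 2)) ^ 2
            * (p : ℤ) ^ (2 * f.natDegree * (p ^ s - 1)))
      * (∏ᶠ f ∈ SkewLCD.Fred p ∩ SkewLCD.monicDivisors (X ^ k - 1),
          (1 + (p : ℤ) ^ (f.natDegree / 2)) ^ 2
            * (p : ℤ) ^ ((2 * p ^ s - 1) * f.natDegree))) ∧
    -- Euclidean LCD codes, `λ = -1`
    ((SkewLCD.euclideanCount p k (-1) : ℤ) =
      SkewLCD.N₃ p s k ^ 2
      * (∏ᶠ f ∈ SkewLCD.Fir p ∩ SkewLCD.monicDivisors (X ^ k + 1),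
          ((p : ℤ) ^ f.natDegree - (p : ℤ) ^ (f.natDegree / 2)) ^ 2
            * (p : ℤ) ^ (2 * f.natDegree * (p ^ s - 1)))
      * (∏ᶠ f ∈ SkewLCD.Fred p ∩ SkewLCD.monicDivisors (X ^ k + 1),
          (1 + (p : ℤ) ^ (f.natDegree / 2)) ^ 2
            * (p : ℤ) ^ ((2 * p ^ s - 1) * f.natDegree))) ∧
    -- Euclidean LCD codes, `λ = 1 - 2v`
    ((SkewLCD.euclideanCount p k (1 - 2 * SkewLCD.v p) : ℤ) =
      SkewLCD.N₁ p s k * SkewLCD.N₃ p s k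
      * (∏ᶠ f ∈ SkewLCD.Fir p ∩ SkewLCD.monicDivisors (X ^ k - 1),
          ((p : ℤ) ^ f.natDegree - (p : ℤ) ^ (f.natDegree / 2))
            * (p : ℤ) ^ (f.natDegree * (p ^ s - 1)))
      * (∏ᶠ f ∈ SkewLCD.Fred p ∩ SkewLCD.monicDivisors (X ^ k - 1),
          (1 + (p : ℤ) ^ (f.natDegree / 2))
            * (p : ℤ) ^ ((2 * p ^ s - 1) * (f.natDegree / 2)))
      * (∏ᶠ f ∈ SkewLCD.Fir p ∩ SkewLCD.monicDivisors (X ^ k + 1),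
          ((p : ℤ) ^ f.natDegree - (p : ℤ) ^ (f.natDegree / 2))
            * (p : ℤ) ^ (f.natDegree * (p ^ s - 1)))
      * (∏ᶠ f ∈ SkewLCD.Fred p ∩ SkewLCD.monicDivisors (X ^ k + 1),
          (1 + (p : ℤ) ^ (f.natDegree / 2))
            * (p : ℤ) ^ ((2 * p ^ s - 1) * (f.natDegree / 2)))) ∧
    -- Hermitian LCD codes, `λ = 1`
    ((SkewLCD.hermitianCount p k 1 : ℤ) =
      SkewLCD.N₂ p s k ^ 2
      * (∏ᶠ f ∈ SkewLCD.Fir p ∩ SkewLCD.monicDivisors (X ^ k - 1),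
          ((p : ℤ) ^ f.natDegree - (p : ℤ) ^ (f.natDegree / 2)) ^ 2
            * (p : ℤ) ^ (2 * f.natDegree * (p ^ s - 1)))
      * (∏ᶠ f ∈ SkewLCD.Fred p ∩ SkewLCD.monicDivisors (X ^ k - 1),
          (1 + (p : ℤ) ^ (f.natDegree / 2)) ^ 2
            * (p : ℤ) ^ ((2 * p ^ s - 1) * f.natDegree))) ∧
    -- Hermitian LCD codes, `λ = -1`
    ((SkewLCD.hermitianCount p k (-1) : ℤ) =
      SkewLCD.N₄ p k
      * (∏ᶠ f ∈ SkewLCD.Fir p ∩ SkewLCD.monicDivisors (X ^ k + 1),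
          ((p : ℤ) ^ f.natDegree - (p : ℤ) ^ (f.natDegree / 2)) ^ 2
            * (p : ℤ) ^ (2 * f.natDegree * (p ^ s - 1)))
      * (∏ᶠ f ∈ SkewLCD.Fred p ∩ SkewLCD.monicDivisors (X ^ k + 1),
          (1 + (p : ℤ) ^ (f.natDegree / 2)) ^ 2
            * (p : ℤ) ^ ((2 * p ^ s - 1) * f.natDegree))) ∧
    -- Hermitian LCD codes, `λ = 1 - 2v`
    ((SkewLCD.hermitianCount p k (1 - 2 * SkewLCD.v p) : ℤ) =
      SkewLCD.N₄ p k * SkewLCD.N₂ p s k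
      * (∏ᶠ f ∈ SkewLCD.Fir p ∩ SkewLCD.monicDivisors (X ^ k + 1),
          ((p : ℤ) ^ f.natDegree - (p : ℤ) ^ (f.natDegree / 2))
            * (p : ℤ) ^ (f.natDegree * (p ^ s - 1)))
      * (∏ᶠ f ∈ SkewLCD.Fred p ∩ SkewLCD.monicDivisors (X ^ k + 1),
          (1 + (p : ℤ) ^ (f.natDegree / 2))
            * (p : ℤ) ^ ((2 * p ^ s - 1) * (f.natDegree / 2)))
      * (∏ᶠ f ∈ SkewLCD.Fir p ∩ SkewLCD.monicDivisors (X ^ k - 1),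
          ((p : ℤ) ^ f.natDegree - (p : ℤ) ^ (f.natDegree / 2))
            * (p : ℤ) ^ (f.natDegree * (p ^ s - 1)))
      * (∏ᶠ f ∈ SkewLCD.Fred p ∩ SkewLCD.monicDivisors (X ^ k - 1),
          (1 + (p : ℤ) ^ (f.natDegree / 2))
            * (p : ℤ) ^ ((2 * p ^ s - 1) * (f.natDegree / 2)))) := by
  have h₁ : SkewLCD.LengthData p s t k 1 := ⟨ht, hk, Or.inl rfl⟩
  have h₃ : SkewLCD.LengthData p s t k (-1) := ⟨ht, hk, Or.inr rfl⟩
  have c₁ := h₁.ncard_lcdCodes SkewLCD.isLinearCount_euclidean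
  have c₂ := h₁.ncard_lcdCodes SkewLCD.isLinearCount_hermitian
  have c₃ := h₃.ncard_lcdCodes SkewLCD.isLinearCount_euclidean
  have c₄ := h₃.ncard_lcdCodes SkewLCD.isLinearCount_hermitian
  have i₁ := h₁.irredProd_sq
  have r₁ := h₁.redProd_sq
  have i₃ := h₃.irredProd_sq
  have r₃ := h₃.redProd_sq
  have d₁ := h₁.euclideanCount_eq (l := 1) h₁ (by rw [map_one, map_one]) (by rw [map_one, map_one])
  have d₂ := h₁.hermitianCount_eq (l := 1) h₁ (by rw [map_one, map_one]) (by rw [map_one, map_one])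
  have n1 : algebraMap (ZMod p) (SkewLCD.Fq p) (-1) = -1 := by rw [map_neg, map_one]
  have n2 : SkewLCD.specOne (-1 : SkewLCD.Rv p) = -1 := by rw [map_neg, map_one]
  have n3 : SkewLCD.specZero (-1 : SkewLCD.Rv p) = -1 := by rw [map_neg, map_one]
  -- For λ = 1 - 2v the first component, at v = 1, is skew negacyclic and the second, at v = 0, is
  -- skew cyclic.
  have n4 : SkewLCD.specOne (1 - 2 * SkewLCD.v p) = -1 := by
    rw [map_sub, map_mul, map_one, map_ofNat, SkewLCD.specOne_v]
    ring
  have n5 : SkewLCD.specZero (1 - 2 * SkewLCD.v p) = 1 := by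
    rw [map_sub, map_mul, map_one, map_ofNat, SkewLCD.specZero_v]
    ring
  have d₃ := h₃.euclideanCount_eq (l := -1) h₃ (by rw [n1, n2]) (by rw [n1, n3])
  have d₄ := h₃.hermitianCount_eq (l := -1) h₃ (by rw [n1, n2]) (by rw [n1, n3])
  have d₅ := h₃.euclideanCount_eq (l := 1 - 2 * SkewLCD.v p) h₁ (by rw [n1, n4])
    (by rw [n5, map_one])
  have d₆ := h₃.hermitianCount_eq (l := 1 - 2 * SkewLCD.v p) h₁ (by rw [n1, n4])
    (by rw [n5, map_one])
  rw [SkewLCD.prod_linearEuclidean_one] at c₁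
  rw [SkewLCD.prod_linearHermitian_one] at c₂
  rw [SkewLCD.prod_linearEuclidean_neg_one] at c₃
  rw [SkewLCD.prod_linearHermitian_neg_one] at c₄
  have e₁ : (X ^ k - C 1 : (ZMod p)[X]) = X ^ k - 1 := by rw [C_1]
  have e₃ : (X ^ k - C (-1) : (ZMod p)[X]) = X ^ k + 1 := by rw [C_neg, C_1, sub_neg_eq_add]
  rw [e₁] at c₁ c₂ i₁ r₁
  rw [e₃] at c₃ c₄ i₃ r₃
  rw [← i₁, ← r₁, ← i₃, ← r₃, d₁, d₂, d₃, d₄, d₅, d₆]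
  simp only [Nat.cast_mul, c₁, c₂, c₃, c₄]
  refine ⟨by ring, by ring, ?_, by ring, ?_, ?_⟩
  · simp only [SkewLCD.irredProd, SkewLCD.redProd]
    ring
  · linear_combination (SkewLCD.irredProd p s (X ^ k + 1) ^ 2 *
      SkewLCD.redProd p s (X ^ k + 1) ^ 2) * SkewLCD.N₄_mul_self p k
  · simp only [SkewLCD.irredProd, SkewLCD.redProd]
    ring
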